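/- Let $\mathfrak g$ be a finite-dimensional simple complex Lie algebra with Killing form $K$, extended $\mathbb C[x,x^{-1}]$-bilinearly to $\mathfrak g[x,x^{-1}]$. Consider the following Lie algebras with invariant symmetric bilinear forms, each containing $\mathfrak g[x]$ as a subalgebra (the doubles $D(\mathfrak g[x])$). - Case A: $\mathfrak g[x,x^{-1}]$ with $(f_1|f_2)=\mathrm{Res}_{x=0}\,K(f_1,f_2)\,a(x)\,dx$ and the natural inclusion of $\mathfrak g[x]$, where $a=\frac1{1-x}$ (A2), $a=\frac1{(1-x)^2}$ (A3), $a=\frac1{(1-m_1x)(1-m_2x)}$ with $m_1\ne m_2$, $m_1m_2\neq0$ (A4). - Case B: $\mathfrak g[x,x^{-1}]\oplus\mathfrak g$ with $(f_1+g_1|f_2+g_2)=\mathrm{Res}_{x=0}\,K(f_1,f_2)\,x^{-1}b(x)\,dx-K(g_1,g_2)$ and the embedding $f\mapsto (f,f(0))$, where $b=1$ (B1), $b=\frac1{1-x}$ (B2). - Case C: $\mathfrak g[x,x^{-1}]\oplus\mathfrak g[\varepsilon]$, $\varepsilon^2=0$, with $(f_1+g_1\varepsilon+h_1|f_2+g_2\varepsilon+h_2)=\mathrm{Res}_{x=0}\,K(f_1,f_2)\,x^{-2}dx-K(g_1,h_2)-K(h_1,g_2)$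 and the embedding $a_0+a_1x+\cdots\mapsto(a_0+a_1x+\cdots,\;a_0+a_1\varepsilon)$. Let $\mathrm{Lag}(X)$ be the set of Lie subalgebras $W$ of the double of case $X$ with $W=W^\perp$, with $W\oplus\mathfrak g[x]$ equal to the double, and such that the projection of $W$ to $\mathfrak g[x,x^{-1}]$ lies in $x^N\mathfrak g[x^{-1}]$ for some $N$. For $W\in\mathrm{Lag}(X)$, a basis $\{E_k\}$ of $\mathfrak g$, and the system $\{w_{k,n}\}\subset W$ dual to the basis $\{E_kx^n\}_{n\ge0}$ of $\mathfrak g[x]$, the $r$-matrix of $W$ is the rational function $r_W(x,y)$ with values in $\mathfrak g\otimes\mathfrak g$, of the form $P(x,y)/(y-x)$ with $P\in(\mathfrak g\otimes\mathfrak g)[x,y]$, whose expansion in the domain $|x|<|y|$ is $\sum_{k,n}E_kx^n\otimes \bar w_{k,n}(y)$, where $\bar w_{k,n}$ is the component of $w_{k,n}$ in $\mathfrak g[x,x^{-1}]$. Choose a Cartan subalgebra $\mathfrak h$, simple roots $\alpha_i$, root vectors with $K(e_\alpha,e_{-\alpha})=1$, put $h_i=[e_{\alpha_i},e_{-\alpha_i}]$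 and let $\{h_i'\}$ be the basis of $\mathfrak h$ dual to $\{h_i\}$ with respect to $K$. Let $\Omega=\sum_kE_k\otimes E^k$ be the Casimir element ($\{E^k\}$ being the $K$-dual basis of $\{E_k\}$) and $$r_{DJ}=\sum_{\alpha>0}e_\alpha\otimes e_{-\alpha}+\tfrac12\sum_ih_i\otimes h_i',\qquad r_{m_1,m_2}=\sum_{\alpha>0}\left(m_1e_{-\alpha}\otimes e_\alpha+m_2e_\alpha\otimes e_{-\alpha}\right)+\tfrac{m_1+m_2}2\sum_ih_i\otimes h_i'.$$ The basic $r$-matrices are $$r_{A2}=\tfrac{1-x}{y-x}\Omega-r_{DJ},\quad r_{A3}=\tfrac{(x-1)(y-1)}{y-x}\Omega,\quad r_{A4}=\tfrac{1-(m_1+m_2)x+m_1m_2xy}{y-x}\Omega-r_{m_1,m_2},$$ $$r_{B1}=\tfrac{x}{y-x}\Omega+r_{DJ},\quad r_{B2}=\tfrac{x(1-y)}{y-x}\Omega+r_{DJ},\quad r_C=\tfrac{xy}{y-x}\Omega.$$ Let $(X,Y)$ be one of the pairs $(B1,A2)$, $(C,A3)$, $(B2,A4)$, in the last case with arbitrary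 $m_1\ne m_2$, $m_1m_2\ne0$. Then every element of $\mathrm{Lag}(X)$ and of $\mathrm{Lag}(Y)$ has exactly one $r$-matrix. There exist $p,q,s\in\mathbb C$ with $p,s\neq0$ and $$r_X(px+q,py+q)=s\,r_Y(x,y).$$ For all such $p,q,s$ there is a bijection $\Phi:\mathrm{Lag}(X)\to\mathrm{Lag}(Y)$ such that, for every $W\in\mathrm{Lag}(X)$ and every $(\mathfrak g\otimes\mathfrak g)$-valued rational function $r(x,y)$, $r$ is the $r$-matrix of $W$ if and only if $s^{-1}r(px+q,py+q)$ is the $r$-matrix of $\Phi(W)$. -/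

import Mathlib

open scoped TensorProduct LaurentPolynomial

noncomputable section

namespace CurrentLie

/-! ### Doubles of current algebras

All doubles have the form `A ⊗ 𝔤` for a commutative algebra `A` with a trace `A → ℂ`,
an embedding `ℂ[x] → A` and a projection `A → ℂ[x, x⁻¹]`. -/

/-- The data that turns `A ⊗ 𝔤` into a double of `𝔤[x] = ℂ[x] ⊗ 𝔤`. -/
structure DoubleData (A : Type) [CommRing A] [Algebra ℂ A] where
  /-- the trace that defines the canonical form -/
  trace : A →ₗ[ℂ] ℂ
  /-- the embedding of the polynomials -/
  emb : Polynomial ℂ →ₐ[ℂ] A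
  /-- the projection to the Laurent polynomials -/
  proj : A →ₐ[ℂ] ℂ[T;T⁻¹]

/-- The functional `f ↦ Res_{x = 0} (f(x) a(x) x^{-n})` on Laurent polynomials, where `a` is a
formal power series: it sends `x^k` to the coefficient of `x^{n - 1 - k}` in `a`. -/
def residueTrace (n : ℤ) (a : PowerSeries ℂ) : ℂ[T;T⁻¹] →ₗ[ℂ] ℂ :=
  Finsupp.linearCombination ℂ
      (fun k : ℤ => (HahnSeries.ofPowerSeries ℤ ℂ a).coeff (n - 1 - k)) ∘ₗ
    (AddMonoidAlgebra.coeffLinearEquiv ℂ).toLinearMap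

/-- Case A: the double is `𝔤[x, x⁻¹]` with the form `Res_{x = 0} (K(f₁, f₂) a(x))`. -/
def doubleA (a : PowerSeries ℂ) : DoubleData ℂ[T;T⁻¹] where
  trace := residueTrace 0 a
  emb := Polynomial.toLaurentAlg
  proj := AlgHom.id ℂ _

/-- Case B: the double is `𝔤[x, x⁻¹] ⊕ 𝔤`, with the form
`Res_{x = 0} (K(f₁, f₂) x⁻¹ b(x)) - K(g₁, g₂)`, and `f ∈ 𝔤[x]` is embedded as `(f, f(0))`. -/
def doubleB (b : PowerSeries ℂ) : DoubleData (ℂ[T;T⁻¹] × ℂ) where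
  trace := residueTrace 1 b ∘ₗ LinearMap.fst ℂ _ _ - LinearMap.snd ℂ _ _
  emb := Polynomial.toLaurentAlg.prod (Polynomial.aeval (0 : ℂ))
  proj := AlgHom.fst ℂ _ _

/-- Case C: the double is `𝔤[x, x⁻¹] ⊕ 𝔤[ε]`, `ε² = 0`, with the form
`Res_{x = 0} (K(f₁, f₂) x⁻²) - K(g₁, h₂) - K(h₁, g₂)` at the elements `f₁ + g₁ ε + h₁` and
`f₂ + g₂ ε + h₂`, and `f = a₀ + a₁ x + ⋯ ∈ 𝔤[x]` is embedded as `(f, a₀ + a₁ ε)`. -/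
def doubleC : DoubleData (ℂ[T;T⁻¹] × DualNumber ℂ) where
  trace := residueTrace 2 1 ∘ₗ LinearMap.fst ℂ _ _ -
    TrivSqZeroExt.sndHom ℂ ℂ ∘ₗ LinearMap.snd ℂ _ _
  emb := Polynomial.toLaurentAlg.prod (Polynomial.aeval (DualNumber.eps : DualNumber ℂ))
  proj := AlgHom.fst ℂ _ _

/-- `a(x) = 1 / (1 - x)` (case A2). -/
def seriesA2 : PowerSeries ℂ := (1 - PowerSeries.X)⁻¹

/-- `a(x) = 1 / (1 - x)²` (case A3). -/
def seriesA3 : PowerSeries ℂ := ((1 - PowerSeries.X) ^ 2)⁻¹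

/-- `a(x) = 1 / ((1 - m₁ x)(1 - m₂ x))` (case A4). -/
def seriesA4 (m₁ m₂ : ℂ) : PowerSeries ℂ :=
  ((1 - m₁ • PowerSeries.X) * (1 - m₂ • PowerSeries.X))⁻¹

/-- `b(x) = 1` (case B1). -/
def seriesB1 : PowerSeries ℂ := 1

/-- `b(x) = 1 / (1 - x)` (case B2). -/
def seriesB2 : PowerSeries ℂ := (1 - PowerSeries.X)⁻¹

section Lagrangian

variable {A : Type} [CommRing A] [Algebra ℂ A] (d : DoubleData A)
variable (g : Type*) [LieRing g] [LieAlgebra ℂ g]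

/-- The canonical form: `(u ⊗ a | v ⊗ b) = t(u v) K(a, b)` with the Killing form `K` of `𝔤`. -/
def DoubleData.form : LinearMap.BilinForm ℂ (A ⊗[ℂ] g) :=
  LinearMap.BilinForm.tmul ((LinearMap.mul ℂ A).compr₂ d.trace) (killingForm ℂ g)

/-- The image of `𝔤[x]` in the double. -/
def DoubleData.current : Submodule ℂ (A ⊗[ℂ] g) :=
  LinearMap.range (LinearMap.rTensor g d.emb.toLinearMap)

/-- The subspace `x^N 𝔤[x⁻¹]` of `𝔤[x, x⁻¹]`. -/
def boundedPart (N : ℤ) : Submodule ℂ (ℂ[T;T⁻¹] ⊗[ℂ] g) :=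
  Submodule.span ℂ {u | ∃ m : ℤ, m ≤ N ∧ ∃ a : g, u = LaurentPolynomial.T m ⊗ₜ[ℂ] a}

variable {g} in
/-- `W` is a Lagrangian Lie subalgebra of the double which is transversal to `𝔤[x]` and whose
`𝔤[x, x⁻¹]`-component is contained in `x^N 𝔤[x⁻¹]` for some `N`. -/
structure DoubleData.IsTransversalLagrangian (W : Submodule ℂ (A ⊗[ℂ] g)) : Prop where
  lie_mem : ∀ u ∈ W, ∀ v ∈ W, ⁅u, v⁆ ∈ W
  lagrangian : ∀ u, u ∈ W ↔ ∀ v ∈ W, d.form g u v = 0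
  isCompl : IsCompl (d.current g) W
  bounded : ∃ N : ℤ, W.map (LinearMap.rTensor g d.proj.toLinearMap) ≤ boundedPart g N

/-- The set of Lagrangian subalgebras of the double which are transversal to `𝔤[x]`. -/
def DoubleData.Lagrangians : Type _ :=
  {W : Submodule ℂ (A ⊗[ℂ] g) // d.IsTransversalLagrangian W}

end Lagrangian

/-! ### Rational functions of two variables with values in `𝔤 ⊗ 𝔤` -/

/-- The polynomials in `x` (variable `0`) and `y` (variable `1`). -/
abbrev Poly₂ : Type := MvPolynomial (Fin 2) ℂ

/-- The rational functions in `x` and `y`. -/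
abbrev Rat₂ : Type := FractionRing Poly₂

/-- The variable `x`. -/
def rx : Rat₂ := algebraMap Poly₂ Rat₂ (MvPolynomial.X 0)

/-- The variable `y`. -/
def ry : Rat₂ := algebraMap Poly₂ Rat₂ (MvPolynomial.X 1)

/-- The substitution `x ↦ p x + q`, `y ↦ p y + q` on polynomials. -/
def affinePoly (p : ℂˣ) (q : ℂ) : Poly₂ ≃ₐ[ℂ] Poly₂ :=
  AlgEquiv.ofAlgHom
    (MvPolynomial.aeval fun i =>
      MvPolynomial.C (p : ℂ) * MvPolynomial.X i + MvPolynomial.C q)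
    (MvPolynomial.aeval fun i =>
      MvPolynomial.C ((p⁻¹ : ℂˣ) : ℂ) * (MvPolynomial.X i - MvPolynomial.C q))
    (by
      ext i : 1
      simp [MvPolynomial.algebraMap_eq, ← mul_assoc, ← MvPolynomial.C_mul])
    (by
      ext i : 1
      simp [MvPolynomial.algebraMap_eq, ← mul_assoc, ← MvPolynomial.C_mul])

/-- The substitution `x ↦ p x + q`, `y ↦ p y + q` on rational functions. -/
def affineRat (p : ℂˣ) (q : ℂ) : Rat₂ ≃ₐ[ℂ] Rat₂ :=
  IsFractionRing.algEquivOfAlgEquiv (affinePoly p q)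

section RMatrix

variable {g : Type*} [LieRing g] [LieAlgebra ℂ g]

/-- `(τ ⊗ τ)(r) (x, y) = r(p x + q, p y + q)` for the substitution `τ : x ↦ p x + q`. -/
def affineSubst (p : ℂˣ) (q : ℂ) :
    Rat₂ ⊗[ℂ] (g ⊗[ℂ] g) →ₗ[ℂ] Rat₂ ⊗[ℂ] (g ⊗[ℂ] g) :=
  LinearMap.rTensor (g ⊗[ℂ] g) (affineRat p q).toLinearMap

/-- The formal power series in `x` whose coefficients are Laurent polynomials in `y`. -/
abbrev Series₂ : Type := PowerSeries ℂ[T;T⁻¹]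

/-- The inclusion of the polynomials in `x` and `y` into `Series₂`. -/
def polyToSeries : Poly₂ →ₐ[ℂ] Series₂ :=
  MvPolynomial.aeval ![PowerSeries.X, PowerSeries.C (LaurentPolynomial.T 1)]

/-- `s` is the expansion in the domain `|x| < |y|` of `r`, where `r = P / (y - x)` for a
polynomial `P`: one has `P = (y - x) r` and `P = (y - x) s`. -/
def IsExpansion (r : Rat₂ ⊗[ℂ] (g ⊗[ℂ] g)) (s : Series₂ ⊗[ℂ] (g ⊗[ℂ] g)) : Prop :=
  ∃ P : Poly₂ ⊗[ℂ] (g ⊗[ℂ] g),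
    LinearMap.rTensor (g ⊗[ℂ] g) (Algebra.linearMap Poly₂ Rat₂ |>.restrictScalars ℂ) P =
        (ry - rx) • r ∧
      LinearMap.rTensor (g ⊗[ℂ] g) polyToSeries.toLinearMap P =
        polyToSeries (MvPolynomial.X 1 - MvPolynomial.X 0) • s

/-- `r` is the `r`-matrix of the subspace `W` of the double:
`r(x, y) = ∑_{k, n} E_k x^n ⊗ w_{k,n}(y)`, expanded in the domain `|x| < |y|`, where
`{E_k x^n}` is a basis of `𝔤[x]` and `{w_{k,n}}` is the dual system in `W` with respect to the
canonical form, of which the component in `𝔤[y, y⁻¹]` is taken. -/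
def IsRMatrix [FiniteDimensional ℂ g] {A : Type} [CommRing A] [Algebra ℂ A] (d : DoubleData A)
    (W : Submodule ℂ (A ⊗[ℂ] g)) (r : Rat₂ ⊗[ℂ] (g ⊗[ℂ] g)) : Prop :=
  ∃ (E : Module.Basis (Fin (Module.finrank ℂ g)) ℂ g)
    (w : Fin (Module.finrank ℂ g) → ℕ → A ⊗[ℂ] g),
    (∀ k n, w k n ∈ W) ∧
    (∀ k n l m, d.form g (d.emb (Polynomial.X ^ m) ⊗ₜ[ℂ] E l) (w k n) =
      if k = l ∧ n = m then 1 else 0) ∧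
    IsExpansion r (∑ k, ∑ l,
      (PowerSeries.mk fun n => (E.baseChange ℂ[T;T⁻¹]).repr
        (LinearMap.rTensor g d.proj.toLinearMap (w k n)) l) ⊗ₜ[ℂ] (E k ⊗ₜ[ℂ] E l))

end RMatrix

section Basic

variable (g : Type*) [LieRing g] [LieAlgebra ℂ g] [FiniteDimensional ℂ g] [LieAlgebra.IsSimple ℂ g]

open Classical in
/-- A choice of a Cartan subalgebra `𝔥`, of simple roots `α_i`, of root vectors `e_α` with
`K(e_α, e_{-α}) = 1`, and of the basis `h'_i` of `𝔥` dual to the basis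
`h_i = [e_{α_i}, e_{-α_i}]`. -/
structure CartanData where
  /-- the Cartan subalgebra -/
  H : LieSubalgebra ℂ g
  cartan : H.IsCartanSubalgebra
  /-- the simple roots -/
  base : (LieAlgebra.IsKilling.rootSystem H).Base
  /-- the root vectors -/
  e : LieModule.Weight ℂ H g → g
  e_mem : ∀ α : LieModule.Weight ℂ H g, α.IsNonZero → e α ∈ LieAlgebra.rootSpace H α
  e_pair : ∀ α : LieModule.Weight ℂ H g, α.IsNonZero → killingForm ℂ g (e α) (e (-α)) = 1
  /-- the dual basis of the Cartan subalgebra -/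
  h' : base.support → g
  h'_mem : ∀ i, h' i ∈ H
  h'_pair : ∀ i j : base.support,
    killingForm ℂ g ⁅e i.1.1, e (-i.1.1)⁆ (h' j) = if i = j then 1 else 0

variable {g} (c : CartanData g)

/-- The part `∑_{α > 0} e_α ⊗ e_{-α}`. -/
def CartanData.upper : g ⊗[ℂ] g :=
  letI := c.cartan
  open Classical in
  ∑ α : c.H.root with c.base.IsPos α, c.e α.1 ⊗ₜ[ℂ] c.e (-α.1)

/-- The part `∑_{α > 0} e_{-α} ⊗ e_α`. -/
def CartanData.lower : g ⊗[ℂ] g :=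
  letI := c.cartan
  open Classical in
  ∑ α : c.H.root with c.base.IsPos α, c.e (-α.1) ⊗ₜ[ℂ] c.e α.1

/-- The part `∑_i h_i ⊗ h'_i`. -/
def CartanData.middle : g ⊗[ℂ] g :=
  letI := c.cartan
  ∑ i : c.base.support, ⁅c.e i.1.1, c.e (-i.1.1)⁆ ⊗ₜ[ℂ] c.h' i

/-- The Casimir element `Ω = ∑_k E_k ⊗ E^k` of `𝔤 ⊗ 𝔤`, for a basis `{E_k}` of `𝔤` and the dual
basis `{E^k}` with respect to the Killing form. -/
def casimir (g : Type*) [LieRing g] [LieAlgebra ℂ g] [FiniteDimensional ℂ g]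
    [LieAlgebra.IsSimple ℂ g] : g ⊗[ℂ] g :=
  ∑ k, Module.finBasis ℂ g k ⊗ₜ[ℂ]
    LinearMap.BilinForm.dualBasis (killingForm ℂ g)
      (LieAlgebra.IsKilling.killingForm_nondegenerate ℂ g) (Module.finBasis ℂ g) k

/-- The Drinfeld-Jimbo `r`-matrix `r_DJ = ∑_{α > 0} e_α ⊗ e_{-α} + (1/2) ∑_i h_i ⊗ h'_i`. -/
def CartanData.rDJ : g ⊗[ℂ] g := c.upper + (1 / 2 : ℂ) • c.middle

/-- `r_{m₁,m₂} = ∑_{α > 0} (m₁ e_{-α} ⊗ e_α + m₂ e_α ⊗ e_{-α}) + ((m₁ + m₂)/2) ∑_i h_i ⊗ h'_i`. -/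
def CartanData.rm (m₁ m₂ : ℂ) : g ⊗[ℂ] g :=
  m₁ • c.lower + m₂ • c.upper + ((m₁ + m₂) / 2) • c.middle

/-- `r_{A2}(x, y) = (1 - x)/(y - x) Ω - r_DJ`. -/
def CartanData.rA2 : Rat₂ ⊗[ℂ] (g ⊗[ℂ] g) :=
  ((1 - rx) / (ry - rx)) ⊗ₜ[ℂ] casimir g - 1 ⊗ₜ[ℂ] c.rDJ

variable (g) in
/-- `r_{A3}(x, y) = (x - 1)(y - 1)/(y - x) Ω`. -/
def rA3 : Rat₂ ⊗[ℂ] (g ⊗[ℂ] g) :=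
  ((rx - 1) * (ry - 1) / (ry - rx)) ⊗ₜ[ℂ] casimir g

/-- `r_{A4}(x, y) = (1 - (m₁ + m₂) x + m₁ m₂ x y)/(y - x) Ω - r_{m₁,m₂}`. -/
def CartanData.rA4 (m₁ m₂ : ℂ) : Rat₂ ⊗[ℂ] (g ⊗[ℂ] g) :=
  ((1 - (m₁ + m₂) • rx + (m₁ * m₂) • (rx * ry)) / (ry - rx)) ⊗ₜ[ℂ] casimir g -
    1 ⊗ₜ[ℂ] c.rm m₁ m₂

/-- `r_{B1}(x, y) = x/(y - x) Ω + r_DJ`. -/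
def CartanData.rB1 : Rat₂ ⊗[ℂ] (g ⊗[ℂ] g) :=
  (rx / (ry - rx)) ⊗ₜ[ℂ] casimir g + 1 ⊗ₜ[ℂ] c.rDJ

/-- `r_{B2}(x, y) = x (1 - y)/(y - x) Ω + r_DJ`. -/
def CartanData.rB2 : Rat₂ ⊗[ℂ] (g ⊗[ℂ] g) :=
  (rx * (1 - ry) / (ry - rx)) ⊗ₜ[ℂ] casimir g + 1 ⊗ₜ[ℂ] c.rDJ

variable (g) in
/-- `r_C(x, y) = x y/(y - x) Ω`. -/
def rC : Rat₂ ⊗[ℂ] (g ⊗[ℂ] g) :=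
  (rx * ry / (ry - rx)) ⊗ₜ[ℂ] casimir g

end Basic

/-- The sets of transversal Lagrangian subalgebras of two doubles are in a one-to-one
correspondence induced by affine substitutions which relate the basic `r`-matrices `r₁`, `r₂`
of the two cases up to scalars:

* every transversal Lagrangian subalgebra of either double has exactly one `r`-matrix;
* there are a substitution `τ : x ↦ p x + q` and a nonzero scalar `s` with
  `(τ ⊗ τ) r₁ = s r₂`;
* for all such `p`, `q`, `s` there is a bijection `Φ` such that `r` is the `r`-matrix of `W` if and
  only if `s⁻¹ (τ ⊗ τ) r` is the `r`-matrix of `Φ W`. -/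
def AffineCorrespondence {g : Type*} [LieRing g] [LieAlgebra ℂ g] [FiniteDimensional ℂ g]
    {A₁ A₂ : Type} [CommRing A₁] [Algebra ℂ A₁] [CommRing A₂] [Algebra ℂ A₂]
    (d₁ : DoubleData A₁) (d₂ : DoubleData A₂) (r₁ r₂ : Rat₂ ⊗[ℂ] (g ⊗[ℂ] g)) : Prop :=
  (∀ W : d₁.Lagrangians g, ∃! r : Rat₂ ⊗[ℂ] (g ⊗[ℂ] g), IsRMatrix d₁ W.1 r) ∧
  (∀ W : d₂.Lagrangians g, ∃! r : Rat₂ ⊗[ℂ] (g ⊗[ℂ] g), IsRMatrix d₂ W.1 r) ∧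
  (∃ (p : ℂˣ) (q : ℂ) (s : ℂˣ), affineSubst p q r₁ = (s : ℂ) • r₂) ∧
  ∀ (p : ℂˣ) (q : ℂ) (s : ℂˣ), affineSubst p q r₁ = (s : ℂ) • r₂ →
    ∃ Φ : d₁.Lagrangians g ≃ d₂.Lagrangians g,
      ∀ (W : d₁.Lagrangians g) (r : Rat₂ ⊗[ℂ] (g ⊗[ℂ] g)),
        IsRMatrix d₁ W.1 r ↔ IsRMatrix d₂ (Φ W).1 ((s : ℂ)⁻¹ • affineSubst p q r)

end CurrentLie

end

noncomputable section

/-! For this question a double is governed by one polynomial `c`, of degree at most two: `x`,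
`x(1-x)`, `x²` in cases B1, B2, C, and `1-x`, `(1-x)²`, `(1-m₁x)(1-m₂x)` in cases A2, A3, A4. Its
elements `u n = c(x) x^{-n-1}` (zero in the extra summand) are dual to the powers of `x` and span a
complement of `ℂ[x]`. This complement need not be isotropic; it only serves as a reference. Since
`𝔤[x]` is its own orthogonal, the dual system of a Lagrangian `W` is `w_{k,n} = u n ⊗ E^k + (tail in
𝔤[x])`, and boundedness of `W` makes the tails vanish for large `n`. Summing up, the `r`-matrix is
`c(y)/(y-x) Ω + Q(x,y)` with `Q` polynomial. `Represents` describes `Q` without bases: the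
`𝔤[x]`-component of `v ∈ W` along the reference complement is the contraction of `Q` with `(·|v)`.
This determines `Q`, whence existence and uniqueness of the `r`-matrix (`isRMatrix_iff`).

To compare two doubles with polynomials `c₁` and `c₂`, both are mapped densely to one algebra,
`ℂ((x⁻¹)) × ℂ[x]/(c₁)` tensored with `𝔤`. Its trace is the residue of `f dx/c₁` at infinity,
corrected on the second factor so that polynomials have trace zero. The first double is mapped by `x
↦ x`, the second by `x ↦ (x-q)/p`, which is invertible there because `c₁(q) ≠ 0`. Bounded
Lagrangians in a double correspond to open Lagrangians in the completion by closure and preimage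
(`Model.lagrangiansEquiv`), because boundedness and openness are dual under the form. Both reference
complements land in `c₁ x⁻¹ℂ[[x⁻¹]] × 0`, so `Represents` is transported too, up to the substitution
and the scalar by which the form changes.

The transport only needs `c₁(px+q) = p s c₂(x)`. The relation between the basic `r`-matrices implies
this: multiply by `y-x` and restrict to the diagonal (`affineOne_diagonal_of_affineSubst`). Such `p,
q, s` exist: `x ↦ 1-x` serves the first two pairs, and for the third the affine map sends `1/m₂,
1/m₁` to `0, 1`, where the constant terms match by the triangular decomposition of `Ω`
(`CartanData.casimir_eq_add`). -/

namespace CurrentLie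

/-! ### Invariant forms, subspaces and contractions on `A ⊗ 𝔤` -/

section Forms

variable {A B : Type*} [CommRing A] [Algebra ℂ A] [CommRing B] [Algebra ℂ B]
  {g : Type*} [LieRing g] [LieAlgebra ℂ g]

variable (g) in
/-- The form `(u ⊗ a | v ⊗ b) = t(u v) K(a, b)` on `A ⊗ 𝔤`. -/
def tensorForm (t : A →ₗ[ℂ] ℂ) : LinearMap.BilinForm ℂ (A ⊗[ℂ] g) :=
  LinearMap.BilinForm.tmul ((LinearMap.mul ℂ A).compr₂ t) (killingForm ℂ g)

theorem tensorForm_tmul (t : A →ₗ[ℂ] ℂ) (a b : A) (x y : g) :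
    tensorForm g t (a ⊗ₜ x) (b ⊗ₜ y) = t (a * b) * killingForm ℂ g x y := by
  simp [tensorForm, LinearMap.BilinForm.tmul, mul_comm]

theorem killingForm_comm (x y : g) : killingForm ℂ g x y = killingForm ℂ g y x :=
  LieModule.traceForm_comm ℂ g g x y

theorem tensorForm_comm (t : A →ₗ[ℂ] ℂ) (u v : A ⊗[ℂ] g) :
    tensorForm g t u v = tensorForm g t v u := by
  induction u with
  | zero => simp
  | add u u' hu hu' => simp [hu, hu']
  | tmul a x =>
    induction v with
    | zero => simp
    | add v v' hv hv' => simp [hv, hv']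
    | tmul b y => rw [tensorForm_tmul, tensorForm_tmul, mul_comm a b, killingForm_comm]

theorem tensorForm_lie (t : A →ₗ[ℂ] ℂ) (u v w : A ⊗[ℂ] g) :
    tensorForm g t ⁅u, v⁆ w = tensorForm g t u ⁅v, w⁆ := by
  induction u with
  | zero => simp
  | add u u' hu hu' => simp [hu, hu']
  | tmul a x =>
    induction v with
    | zero => simp
    | add v v' hv hv' => simp [hv, hv']
    | tmul b y =>
      induction w with
      | zero => simp
      | add w w' hw hw' => simp only [lie_add, map_add, hw, hw']
      | tmul c z =>
        rw [LieAlgebra.ExtendScalars.bracket_tmul, LieAlgebra.ExtendScalars.bracket_tmul,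
          tensorForm_tmul, tensorForm_tmul, mul_assoc a b c]
        congr 1
        exact LieModule.traceForm_apply_lie_apply ℂ g g x y z

variable (g) in
/-- The homomorphism `A ⊗ 𝔤 → B ⊗ 𝔤` induced by a homomorphism `A → B`. -/
def tensorMap (f : A →ₐ[ℂ] B) : A ⊗[ℂ] g →ₗ[ℂ] B ⊗[ℂ] g := LinearMap.rTensor g f.toLinearMap

@[simp]
theorem tensorMap_tmul (f : A →ₐ[ℂ] B) (a : A) (x : g) :
    tensorMap g f (a ⊗ₜ x) = f a ⊗ₜ x := rfl

theorem tensorMap_lie (f : A →ₐ[ℂ] B) (u v : A ⊗[ℂ] g) :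
    tensorMap g f ⁅u, v⁆ = ⁅tensorMap g f u, tensorMap g f v⁆ := by
  induction u with
  | zero => simp
  | add u u' hu hu' => simp [hu, hu']
  | tmul a x =>
    induction v with
    | zero => simp
    | add v v' hv hv' => simp [hv, hv']
    | tmul b y => simp [LieAlgebra.ExtendScalars.bracket_tmul]

theorem tensorForm_map (f : A →ₐ[ℂ] B) {t : A →ₗ[ℂ] ℂ} {t' : B →ₗ[ℂ] ℂ} {κ : ℂ}
    (h : ∀ a, t' (f a) = κ * t a) (u v : A ⊗[ℂ] g) :
    tensorForm g t' (tensorMap g f u) (tensorMap g f v) = κ * tensorForm g t u v := by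
  induction u with
  | zero => simp
  | add u u' hu hu' => simp [hu, hu', mul_add]
  | tmul a x =>
    induction v with
    | zero => simp
    | add v v' hv hv' => simp only [map_add, hv, hv', mul_add]
    | tmul b y =>
      rw [tensorMap_tmul, tensorMap_tmul, tensorForm_tmul, tensorForm_tmul, ← map_mul, h, mul_assoc]

variable (g) in
/-- The subspace `S ⊗ 𝔤` of `A ⊗ 𝔤`. -/
def tensorSub (S : Submodule ℂ A) : Submodule ℂ (A ⊗[ℂ] g) :=
  Submodule.span ℂ {u | ∃ a ∈ S, ∃ x : g, u = a ⊗ₜ x}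

theorem tmul_mem_tensorSub {S : Submodule ℂ A} {a : A} (ha : a ∈ S) (x : g) :
    a ⊗ₜ x ∈ tensorSub g S := Submodule.subset_span ⟨a, ha, x, rfl⟩

theorem tensorSub_le {S : Submodule ℂ A} {W : Submodule ℂ (A ⊗[ℂ] g)}
    (h : ∀ a ∈ S, ∀ x : g, a ⊗ₜ x ∈ W) : tensorSub g S ≤ W :=
  Submodule.span_le.2 (by rintro _ ⟨a, ha, x, rfl⟩; exact h a ha x)

theorem tensorSub_mono {S S' : Submodule ℂ A} (h : S ≤ S') : tensorSub g S ≤ tensorSub g S' :=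
  tensorSub_le fun _ ha x => tmul_mem_tensorSub (h ha) x

theorem range_tensorMap (f : A →ₐ[ℂ] B) :
    LinearMap.range (tensorMap g f) = tensorSub g (LinearMap.range f.toLinearMap) := by
  apply le_antisymm
  · rintro _ ⟨u, rfl⟩
    induction u with
    | zero => simp
    | add u u' hu hu' => rw [map_add]; exact add_mem hu hu'
    | tmul a x => exact tmul_mem_tensorSub (LinearMap.mem_range_self f.toLinearMap a) x
  · refine tensorSub_le ?_
    rintro _ ⟨a, rfl⟩ x
    exact ⟨a ⊗ₜ x, rfl⟩

theorem tensorSub_sup_eq_top {S S' : Submodule ℂ A} (h : S ⊔ S' = ⊤) :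
    tensorSub g S ⊔ tensorSub g S' = ⊤ := by
  rw [eq_top_iff]
  rintro u -
  induction u with
  | zero => simp
  | add u u' hu hu' => exact add_mem hu hu'
  | tmul a x =>
    have ha : a ∈ S ⊔ S' := h ▸ Submodule.mem_top
    obtain ⟨b, hb, b', hb', rfl⟩ := Submodule.mem_sup.1 ha
    rw [TensorProduct.add_tmul]
    exact Submodule.add_mem_sup (tmul_mem_tensorSub hb x) (tmul_mem_tensorSub hb' x)

theorem tensorForm_eq_zero_of_mem {t : A →ₗ[ℂ] ℂ} {S S' : Submodule ℂ A}
    (h : ∀ a ∈ S, ∀ b ∈ S', t (a * b) = 0) {u v : A ⊗[ℂ] g} (hu : u ∈ tensorSub g S)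
    (hv : v ∈ tensorSub g S') : tensorForm g t u v = 0 := by
  have h1 : tensorSub g S ≤ LinearMap.ker ((tensorForm g t).flip v) := by
    refine tensorSub_le fun a ha x => ?_
    have h2 : tensorSub g S' ≤ LinearMap.ker (tensorForm g t (a ⊗ₜ x)) := by
      refine tensorSub_le fun b hb y => ?_
      rw [LinearMap.mem_ker, tensorForm_tmul, h a ha b hb, zero_mul]
    exact h2 hv
  exact h1 hu

/-- The contraction `b ⊗ y ↦ K(x, y) b`. -/
def contract {M : Type*} [AddCommGroup M] [Module ℂ M] (x : g) : M ⊗[ℂ] g →ₗ[ℂ] M :=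
  (TensorProduct.rid ℂ M).toLinearMap ∘ₗ LinearMap.lTensor M (killingForm ℂ g x)

@[simp]
theorem contract_tmul {M : Type*} [AddCommGroup M] [Module ℂ M] (x y : g) (b : M) :
    contract x (b ⊗ₜ[ℂ] y) = killingForm ℂ g x y • b := by
  simp [contract]

/-- Together with `contract_map` this reduces orthogonality in `A ⊗ 𝔤` to orthogonality in the
commutative algebra `A`. -/
theorem tensorForm_tmul_left (t : A →ₗ[ℂ] ℂ) (a : A) (x : g) (u : A ⊗[ℂ] g) :
    tensorForm g t (a ⊗ₜ x) u = t (a * contract x u) := by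
  induction u with
  | zero => simp
  | add u u' hu hu' => simp [hu, hu', mul_add]
  | tmul b y => rw [tensorForm_tmul, contract_tmul]; simp [mul_comm]

theorem contract_map (f : A →ₗ[ℂ] B) (x : g) (u : A ⊗[ℂ] g) :
    contract x (LinearMap.rTensor g f u) = f (contract x u) := by
  induction u with
  | zero => simp
  | add u u' hu hu' => simp [hu, hu']
  | tmul b y => simp

theorem contract_mem_of_mem_tensorSub {S : Submodule ℂ A} {u : A ⊗[ℂ] g}
    (h : u ∈ tensorSub g S) (x : g) : contract x u ∈ S := by
  have : tensorSub g S ≤ S.comap (contract x) := tensorSub_le fun a ha y => by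
    simpa using S.smul_mem _ ha
  exact this h

section Killing

variable [LieAlgebra.IsKilling ℂ g]

/-- The dual basis with respect to the Killing form. -/
def killingDual {ι : Type*} [Finite ι] [DecidableEq ι] (E : Module.Basis ι ℂ g) :
    Module.Basis ι ℂ g :=
  LinearMap.BilinForm.dualBasis (killingForm ℂ g)
    (LieAlgebra.IsKilling.killingForm_nondegenerate ℂ g) E

variable {ι : Type*} [Fintype ι] [DecidableEq ι] (E : Module.Basis ι ℂ g)

theorem killingForm_killingDual (i j : ι) :
    killingForm ℂ g (E i) (killingDual E j) = if i = j then 1 else 0 :=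
  LinearMap.BilinForm.apply_dualBasis_right _ ⟨killingForm_comm⟩ E i j

theorem sum_killingForm_smul_killingDual (x : g) :
    ∑ k, killingForm ℂ g (E k) x • killingDual E k = x := by
  conv_rhs => rw [← (killingDual E).sum_repr x]
  refine Finset.sum_congr rfl fun k _ => ?_
  rw [killingDual, LinearMap.BilinForm.dualBasis_repr_apply, killingForm_comm]

theorem sum_killingForm_killingDual_smul (x : g) :
    ∑ k, killingForm ℂ g (killingDual E k) x • E k = x := by
  conv_rhs => rw [← E.sum_repr x]
  refine Finset.sum_congr rfl fun k _ => ?_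
  congr 1
  rw [killingForm_comm]
  conv_lhs => rw [← E.sum_repr x]
  simp only [map_sum, LinearMap.sum_apply, map_smul, LinearMap.smul_apply,
    killingForm_killingDual, smul_eq_mul, mul_ite, mul_one, mul_zero, Finset.sum_ite_eq',
    Finset.mem_univ, if_true]

theorem sum_contract_tmul_killingDual {M : Type*} [AddCommGroup M] [Module ℂ M] (u : M ⊗[ℂ] g) :
    ∑ k, contract (E k) u ⊗ₜ killingDual E k = u := by
  induction u with
  | zero => simp
  | add u u' hu hu' =>
    simp only [map_add, TensorProduct.add_tmul, Finset.sum_add_distrib, hu, hu']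
  | tmul b y =>
    simp only [contract_tmul, TensorProduct.smul_tmul]
    rw [← TensorProduct.tmul_sum, sum_killingForm_smul_killingDual]

/-- By nondegeneracy of the Killing form, `u` is rebuilt from its contractions with a basis and the
dual basis. -/
theorem mem_tensorSub_of_contract [FiniteDimensional ℂ g] {S : Submodule ℂ A} {u : A ⊗[ℂ] g}
    (h : ∀ x, contract x u ∈ S) : u ∈ tensorSub g S := by
  classical
  rw [← sum_contract_tmul_killingDual (Module.finBasis ℂ g) u]
  exact sum_mem fun k _ => tmul_mem_tensorSub (h _) _

end Killing

end Forms

/-! ### Completions of doubles and the correspondence of Lagrangian subalgebras -/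

/-- The subspace `x^N ℂ[x⁻¹]` of `ℂ[x, x⁻¹]`. -/
def laurentBounded (N : ℤ) : Submodule ℂ ℂ[T;T⁻¹] :=
  Submodule.span ℂ {f | ∃ m ≤ N, f = LaurentPolynomial.T m}

theorem boundedPart_eq (g : Type*) [LieRing g] [LieAlgebra ℂ g] (N : ℤ) :
    boundedPart g N = tensorSub g (laurentBounded N) := by
  apply le_antisymm
  · refine Submodule.span_le.2 ?_
    rintro _ ⟨m, hm, a, rfl⟩
    have : LaurentPolynomial.T m ∈ laurentBounded N := Submodule.subset_span ⟨m, hm, rfl⟩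
    exact tmul_mem_tensorSub this a
  · refine tensorSub_le fun f hf x => ?_
    have : laurentBounded N ≤
        (boundedPart g N).comap ((TensorProduct.mk ℂ ℂ[T;T⁻¹] g).flip x) := by
      refine Submodule.span_le.2 ?_
      rintro _ ⟨m, hm, rfl⟩
      exact Submodule.subset_span ⟨m, hm, x, rfl⟩
    exact this hf

/-- A linearly topologized algebra with a continuous trace, which contains the polynomials as a
subalgebra with a chosen complement, the kernel of `pr`. -/
structure Completion (R : Type*) [CommRing R] [Algebra ℂ R] where
  /-- the trace -/
  trace : R →ₗ[ℂ] ℂ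
  /-- the embedding of the polynomials -/
  emb : Polynomial ℂ →ₐ[ℂ] R
  /-- the neighbourhoods of zero -/
  nhd : ℤ → Submodule ℂ R
  /-- the projection to the polynomials -/
  pr : R →ₗ[ℂ] Polynomial ℂ
  pr_emb : ∀ f, pr (emb f) = f
  trace_emb : ∀ f, trace (emb f) = 0
  anti : Antitone nhd
  perp : ∀ r, ∃ M, ∀ a ∈ nhd M, trace (a * r) = 0
  pr_nhd : ∃ M, ∀ a ∈ nhd M, pr a = 0

/-- A dense homomorphism of a double to a completion, which preserves the form up to a scalar
and the polynomials up to a substitution. -/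
structure Model {A R : Type} [CommRing A] [Algebra ℂ A] [CommRing R] [Algebra ℂ R]
    (d : DoubleData A) (h : Completion R) where
  /-- the homomorphism -/
  hom : A →ₐ[ℂ] R
  /-- the substitution -/
  subst : Polynomial ℂ ≃ₐ[ℂ] Polynomial ℂ
  /-- the scalar -/
  scalar : ℂ
  scalar_ne : scalar ≠ 0
  trace_hom : ∀ a, h.trace (hom a) = scalar * d.trace a
  hom_emb : ∀ f, hom (d.emb f) = h.emb (subst f)
  dense : ∀ M r, ∃ a, r - hom a ∈ h.nhd M
  perp_of_bounded : ∀ N, ∃ M, ∀ a, d.proj a ∈ laurentBounded N →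
    ∀ b ∈ h.nhd M, h.trace (b * hom a) = 0
  bounded_of_perp : ∀ M, ∃ N, ∀ a, (∀ b ∈ h.nhd M, h.trace (b * hom a) = 0) →
    d.proj a ∈ laurentBounded N

section

variable {A R : Type} [CommRing A] [Algebra ℂ A] [CommRing R] [Algebra ℂ R]
  {g : Type*} [LieRing g] [LieAlgebra ℂ g]
  (h : Completion R)

namespace Completion

variable {h} in
/-- The Lagrangian subalgebras of `R ⊗ 𝔤` which are open and transversal to `𝔤[x]`. -/
structure IsTransversalLagrangian (W : Submodule ℂ (R ⊗[ℂ] g)) : Prop where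
  lie_mem : ∀ u ∈ W, ∀ v ∈ W, ⁅u, v⁆ ∈ W
  lagrangian : ∀ u, u ∈ W ↔ ∀ v ∈ W, tensorForm g h.trace u v = 0
  isCompl : IsCompl (LinearMap.range (tensorMap g h.emb)) W
  nhd_le : ∃ M, tensorSub g (h.nhd M) ≤ W

variable (g) in
/-- The set of transversal open Lagrangian subalgebras of `R ⊗ 𝔤`. -/
def Lagrangians : Type _ :=
  {W : Submodule ℂ (R ⊗[ℂ] g) // IsTransversalLagrangian (h := h) W}

/-- Continuity of the form: `u` involves finitely many elements of `R`, and each is orthogonal to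
some neighbourhood of zero. -/
theorem exists_perp (u : R ⊗[ℂ] g) :
    ∃ M, ∀ o ∈ tensorSub g (h.nhd M), tensorForm g h.trace o u = 0 := by
  induction u with
  | zero => exact ⟨0, by simp⟩
  | add u v hu hv =>
    obtain ⟨M, hM⟩ := hu
    obtain ⟨M', hM'⟩ := hv
    refine ⟨max M M', fun o ho => ?_⟩
    rw [map_add, hM o (tensorSub_mono (h.anti (le_max_left _ _)) ho),
      hM' o (tensorSub_mono (h.anti (le_max_right _ _)) ho), add_zero]
  | tmul r x =>
    obtain ⟨M, hM⟩ := h.perp r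
    refine ⟨M, fun o ho => ?_⟩
    refine tensorForm_eq_zero_of_mem (S' := Submodule.span ℂ {r}) ?_ ho
      (tmul_mem_tensorSub (Submodule.mem_span_singleton_self r) x)
    intro a ha b hb
    obtain ⟨z, rfl⟩ := Submodule.mem_span_singleton.1 hb
    rw [mul_smul_comm, map_smul, hM a ha, smul_zero]

theorem tensorMap_emb_injective : Function.Injective (tensorMap g h.emb) :=
  Module.Flat.rTensor_preserves_injective_linearMap _
    (Function.LeftInverse.injective (g := h.pr) h.pr_emb)

/-- The orthogonal complement. -/
def orthogonal (W : Submodule ℂ (R ⊗[ℂ] g)) : Submodule ℂ (R ⊗[ℂ] g) where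
  carrier := {u | ∀ v ∈ W, tensorForm g h.trace u v = 0}
  zero_mem' := by simp
  add_mem' := fun hu hv w hw => by rw [map_add, LinearMap.add_apply, hu w hw, hv w hw, add_zero]
  smul_mem' := fun z u hu w hw => by rw [map_smul, LinearMap.smul_apply, hu w hw, smul_zero]

end Completion

namespace Model

variable {h} {d : DoubleData A} (m : Model d h)

theorem form_eq (u v : A ⊗[ℂ] g) : d.form g u v = tensorForm g d.trace u v := rfl

theorem form_hom (u v : A ⊗[ℂ] g) :
    tensorForm g h.trace (tensorMap g m.hom u) (tensorMap g m.hom v) =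
      m.scalar * d.form g u v :=
  tensorForm_map m.hom m.trace_hom u v

theorem exists_sub_mem (M : ℤ) (v : R ⊗[ℂ] g) :
    ∃ u : A ⊗[ℂ] g, v - tensorMap g m.hom u ∈ tensorSub g (h.nhd M) := by
  have h1 : LinearMap.range m.hom.toLinearMap ⊔ h.nhd M = ⊤ := by
    rw [eq_top_iff]
    rintro r -
    obtain ⟨a, ha⟩ := m.dense M r
    rw [← add_sub_cancel (m.hom a) r]
    exact Submodule.add_mem_sup ⟨a, rfl⟩ ha
  have h2 : v ∈ LinearMap.range (tensorMap g m.hom) ⊔ tensorSub g (h.nhd M) := by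
    rw [range_tensorMap, tensorSub_sup_eq_top h1]; trivial
  obtain ⟨_, ⟨u, rfl⟩, o, ho, rfl⟩ := Submodule.mem_sup.1 h2
  exact ⟨u, by simpa using ho⟩

theorem tensorMap_hom_emb (q : Polynomial ℂ ⊗[ℂ] g) :
    tensorMap g m.hom (tensorMap g d.emb q) =
      tensorMap g h.emb (tensorMap g m.subst.toAlgHom q) := by
  induction q with
  | zero => simp
  | add q q' hq hq' => simp [hq, hq']
  | tmul f x => simp [m.hom_emb]

theorem tensorMap_subst_symm (q : Polynomial ℂ ⊗[ℂ] g) :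
    tensorMap g m.subst.toAlgHom (tensorMap g m.subst.symm.toAlgHom q) = q := by
  induction q with
  | zero => simp
  | add q q' hq hq' => simp only [map_add, hq, hq']
  | tmul f x => simp

section ToCompletion

variable {W : Submodule ℂ (A ⊗[ℂ] g)}

/-- The closure of a Lagrangian subalgebra of a double. -/
def closure (W : Submodule ℂ (A ⊗[ℂ] g)) : Submodule ℂ (R ⊗[ℂ] g) :=
  h.orthogonal (W.map (tensorMap g m.hom))

theorem mem_closure {v : R ⊗[ℂ] g} : v ∈ m.closure W ↔
    ∀ w ∈ W, tensorForm g h.trace v (tensorMap g m.hom w) = 0 := by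
  simp [closure, Completion.orthogonal]

/-- The homomorphism multiplies the form by a nonzero scalar, and `W` is its own orthogonal
complement. -/
theorem hom_mem_closure (hW : d.IsTransversalLagrangian W) (u : A ⊗[ℂ] g) :
    tensorMap g m.hom u ∈ m.closure W ↔ u ∈ W := by
  rw [mem_closure, hW.lagrangian]
  simp only [m.form_hom, mul_eq_zero, m.scalar_ne, false_or]

/-- Elements of high order at infinity are orthogonal to everything of bounded degree, so
boundedness of `W` becomes openness of its closure. -/
theorem nhd_le_closure (hW : d.IsTransversalLagrangian W) :
    ∃ M, tensorSub g (h.nhd M) ≤ m.closure W := by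
  obtain ⟨N, hN⟩ := hW.bounded
  obtain ⟨M, hM⟩ := m.perp_of_bounded N
  refine ⟨M, tensorSub_le fun b hb x => m.mem_closure.2 fun w hw => ?_⟩
  rw [tensorForm_tmul_left]
  have h1 := hN (Submodule.mem_map_of_mem hw)
  rw [boundedPart_eq] at h1
  have h2 := contract_mem_of_mem_tensorSub h1 x
  rw [contract_map] at h2
  have h3 := hM _ h2 b hb
  rwa [tensorMap, contract_map]

/-- Justifies the name `closure`, which is defined by orthogonality: approximate `v` by some
`tensorMap g m.hom u`; the error is already in the open subspace `m.closure W`, so `u` is in `W`. -/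
theorem exists_closure_eq (hW : d.IsTransversalLagrangian W) :
    ∃ M₀, ∀ M ≥ M₀, ∀ v ∈ m.closure W, ∃ w ∈ W,
      v - tensorMap g m.hom w ∈ tensorSub g (h.nhd M) := by
  obtain ⟨M₀, hM₀⟩ := m.nhd_le_closure hW
  refine ⟨M₀, fun M hM v hv => ?_⟩
  obtain ⟨u, hu⟩ := m.exists_sub_mem M v
  refine ⟨u, ?_, hu⟩
  rw [← m.hom_mem_closure hW]
  have h1 := hM₀ (tensorSub_mono (h.anti hM) hu)
  simpa using sub_mem hv h1

theorem closure_isotropic (hW : d.IsTransversalLagrangian W) {v v' : R ⊗[ℂ] g}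
    (hv : v ∈ m.closure W) (hv' : v' ∈ m.closure W) : tensorForm g h.trace v v' = 0 := by
  obtain ⟨M₀, hM₀⟩ := m.exists_closure_eq hW
  obtain ⟨M₁, hM₁⟩ := h.exists_perp v
  obtain ⟨w, hw, ho⟩ := hM₀ (max M₀ M₁) (le_max_left _ _) v' hv'
  have h1 := m.mem_closure.1 hv w hw
  have h2 := hM₁ _ (tensorSub_mono (h.anti (le_max_right _ _)) ho)
  rw [tensorForm_comm, map_sub, h1, sub_zero] at h2
  exact h2

theorem closure_isTransversalLagrangian (hW : d.IsTransversalLagrangian W) :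
    Completion.IsTransversalLagrangian (h := h) (m.closure W) where
  lie_mem := by
    -- Invariance of the form moves a bracket to the other side. First one factor is taken from `W`;
    -- then isotropy of the closure handles two general factors.
    have h1 : ∀ u ∈ m.closure W, ∀ w ∈ W, ⁅u, tensorMap g m.hom w⁆ ∈ m.closure W := by
      intro u hu w hw
      refine m.mem_closure.2 fun w' hw' => ?_
      rw [tensorForm_lie, ← tensorMap_lie]
      exact m.mem_closure.1 hu _ (hW.lie_mem w hw w' hw')
    intro u hu v hv
    refine m.mem_closure.2 fun w hw => ?_
    rw [tensorForm_lie]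
    exact m.closure_isotropic hW hu (h1 v hv w hw)
  lagrangian := fun u => by
    refine ⟨fun hu v hv => m.closure_isotropic hW hu hv, fun hu => ?_⟩
    exact m.mem_closure.2 fun w hw => hu _ ((m.hom_mem_closure hW w).2 hw)
  isCompl := by
    constructor
    · rw [Submodule.disjoint_def]
      rintro _ ⟨q, rfl⟩ hq
      rw [← m.tensorMap_subst_symm q, ← m.tensorMap_hom_emb, m.hom_mem_closure hW] at hq
      have h1 := (Submodule.disjoint_def.1 hW.isCompl.disjoint) _ ⟨_, rfl⟩ hq
      rw [← m.tensorMap_subst_symm q, ← m.tensorMap_hom_emb]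
      exact (congrArg _ h1).trans (map_zero _)
    · rw [codisjoint_iff, eq_top_iff]
      rintro v -
      obtain ⟨M, hM⟩ := m.nhd_le_closure hW
      obtain ⟨u, hu⟩ := m.exists_sub_mem M v
      have h1 : u ∈ d.current g ⊔ W := by rw [hW.isCompl.sup_eq_top]; trivial
      obtain ⟨_, ⟨q, rfl⟩, w, hw, rfl⟩ := Submodule.mem_sup.1 h1
      have h2 : v = tensorMap g h.emb (tensorMap g m.subst.toAlgHom q) +
          (tensorMap g m.hom w + (v - tensorMap g m.hom (tensorMap g d.emb q + w))) := by
        rw [← m.tensorMap_hom_emb, map_add]; abel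
      rw [h2]
      exact Submodule.add_mem_sup ⟨_, rfl⟩
        (add_mem ((m.hom_mem_closure hW w).2 hw) (hM hu))
  nhd_le := m.nhd_le_closure hW

end ToCompletion

section OfCompletion

variable {V : Submodule ℂ (R ⊗[ℂ] g)}

theorem exists_comap_eq (hV : Completion.IsTransversalLagrangian (h := h) V) :
    ∃ M₀, ∀ M ≥ M₀, ∀ v ∈ V, ∃ w ∈ V.comap (tensorMap g m.hom),
      v - tensorMap g m.hom w ∈ tensorSub g (h.nhd M) := by
  obtain ⟨M₀, hM₀⟩ := hV.nhd_le
  refine ⟨M₀, fun M hM v hv => ?_⟩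
  obtain ⟨u, hu⟩ := m.exists_sub_mem M v
  refine ⟨u, ?_, hu⟩
  have h1 := hM₀ (tensorSub_mono (h.anti hM) hu)
  simpa using sub_mem hv h1

/-- An open `V` is approximated by elements of its preimage, so being orthogonal to these is being
orthogonal to `V`, which is `V` itself. -/
theorem closure_comap (hV : Completion.IsTransversalLagrangian (h := h) V) :
    m.closure (V.comap (tensorMap g m.hom)) = V := by
  ext v
  rw [mem_closure]
  constructor
  · intro hv
    rw [hV.lagrangian]
    intro v' hv'
    obtain ⟨M₀, hM₀⟩ := m.exists_comap_eq hV
    obtain ⟨M₁, hM₁⟩ := h.exists_perp v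
    obtain ⟨w, hw, ho⟩ := hM₀ (max M₀ M₁) (le_max_left _ _) v' hv'
    have h1 := hv w hw
    have h2 := hM₁ _ (tensorSub_mono (h.anti (le_max_right _ _)) ho)
    rw [tensorForm_comm, map_sub, h1, sub_zero] at h2
    exact h2
  · intro hv w hw
    exact (hV.lagrangian v).1 hv _ hw

variable [FiniteDimensional ℂ g] [LieAlgebra.IsKilling ℂ g]

theorem comap_isTransversalLagrangian (hV : Completion.IsTransversalLagrangian (h := h) V) :
    d.IsTransversalLagrangian (V.comap (tensorMap g m.hom)) where
  lie_mem := fun u hu v hv => by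
    rw [Submodule.mem_comap, tensorMap_lie]
    exact hV.lie_mem _ hu _ hv
  lagrangian := fun u => by
    rw [Submodule.mem_comap]
    conv_lhs => rw [← m.closure_comap hV]
    rw [mem_closure]
    simp only [m.form_hom, mul_eq_zero, m.scalar_ne, false_or]
  isCompl := by
    constructor
    · rw [Submodule.disjoint_def]
      rintro _ ⟨q, rfl⟩ hq
      have h0 : tensorMap g h.emb (tensorMap g m.subst.toAlgHom q) ∈ V := by
        rw [← m.tensorMap_hom_emb]; exact hq
      have h1 := (Submodule.disjoint_def.1 hV.isCompl.disjoint) _ ⟨_, rfl⟩ h0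
      have h2 := h.tensorMap_emb_injective (h1.trans (map_zero _).symm)
      have h3 : q = 0 := by
        have h4 : Function.Injective (tensorMap g m.subst.toAlgHom) :=
          Module.Flat.rTensor_preserves_injective_linearMap _ m.subst.injective
        exact h4 (h2.trans (map_zero _).symm)
      rw [h3, map_zero]
    · rw [codisjoint_iff, eq_top_iff]
      rintro u -
      have h1 : tensorMap g m.hom u ∈ LinearMap.range (tensorMap g h.emb) ⊔ V := by
        rw [hV.isCompl.sup_eq_top]; trivial
      obtain ⟨_, ⟨q, rfl⟩, v, hv, hu⟩ := Submodule.mem_sup.1 h1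
      rw [← m.tensorMap_subst_symm q, ← m.tensorMap_hom_emb] at hu
      rw [← add_sub_cancel (tensorMap g d.emb (tensorMap g m.subst.symm.toAlgHom q)) u]
      refine Submodule.add_mem_sup ⟨_, rfl⟩ ?_
      rw [Submodule.mem_comap, map_sub, ← hu, add_sub_cancel_left]
      exact hv
  bounded := by
    obtain ⟨M, hM⟩ := hV.nhd_le
    obtain ⟨N, hN⟩ := m.bounded_of_perp M
    refine ⟨N, ?_⟩
    rintro _ ⟨w, hw, rfl⟩
    rw [boundedPart_eq]
    refine mem_tensorSub_of_contract fun x => ?_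
    rw [contract_map]
    refine hN _ fun b hb => ?_
    -- An open Lagrangian is orthogonal to the neighbourhood that it contains; this bounds the
    -- degree of its elements.
    have h1 := (hV.lagrangian _).1 (hM (tmul_mem_tensorSub hb x)) _ hw
    rw [tensorForm_tmul_left, tensorMap, contract_map] at h1
    exact h1

end OfCompletion

/-- The Lagrangian subalgebras of a double correspond to those of its completion. -/
def lagrangiansEquiv [FiniteDimensional ℂ g] [LieAlgebra.IsKilling ℂ g] :
    d.Lagrangians g ≃ h.Lagrangians g where
  toFun W := ⟨m.closure W.1, m.closure_isTransversalLagrangian W.2⟩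
  invFun V := ⟨V.1.comap (tensorMap g m.hom), m.comap_isTransversalLagrangian V.2⟩
  left_inv W := Subtype.ext (by ext u; exact m.hom_mem_closure W.2 u)
  right_inv V := Subtype.ext (m.closure_comap V.2)

end Model

end

/-! ### Contractions and the basis-free description of the polynomial part -/

section Contraction

variable {M N : Type*} [AddCommGroup M] [Module ℂ M] [AddCommGroup N] [Module ℂ N]

/-- The contraction of the first tensor factor with a functional. -/
def leftContract (φ : M →ₗ[ℂ] ℂ) : M ⊗[ℂ] N →ₗ[ℂ] N :=
  (TensorProduct.lid ℂ N).toLinearMap ∘ₗ LinearMap.rTensor N φ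

@[simp]
theorem leftContract_tmul (φ : M →ₗ[ℂ] ℂ) (x : M) (y : N) :
    leftContract φ (x ⊗ₜ[ℂ] y) = φ x • y := by
  simp [leftContract]

theorem leftContract_add (φ ψ : M →ₗ[ℂ] ℂ) (Q : M ⊗[ℂ] N) :
    leftContract (φ + ψ) Q = leftContract φ Q + leftContract ψ Q := by
  simp [leftContract, LinearMap.rTensor_add]

theorem leftContract_smul (z : ℂ) (φ : M →ₗ[ℂ] ℂ) (Q : M ⊗[ℂ] N) :
    leftContract (z • φ) Q = z • leftContract φ Q := by
  simp [leftContract, LinearMap.rTensor_smul]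

theorem leftContract_ext {ι : Type*} (b : Module.Basis ι ℂ M) {Q Q' : M ⊗[ℂ] N}
    (h : ∀ i, leftContract (b.coord i) Q = leftContract (b.coord i) Q') : Q = Q' := by
  classical
  apply (TensorProduct.equivFinsuppOfBasisLeft (N := N) b).injective
  ext i
  rw [TensorProduct.equivFinsuppOfBasisLeft_apply, TensorProduct.equivFinsuppOfBasisLeft_apply]
  exact h i

end Contraction

section Represents

variable {A : Type*} [CommRing A] [Algebra ℂ A] {g : Type*} [LieRing g] [LieAlgebra ℂ g]

/-- The functional `f ↦ (f | v)` on `𝔤[x]`. -/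
def pairing (e : Polynomial ℂ →ₐ[ℂ] A) (t : A →ₗ[ℂ] ℂ) (v : A ⊗[ℂ] g) :
    Polynomial ℂ ⊗[ℂ] g →ₗ[ℂ] ℂ :=
  (tensorForm g t).flip v ∘ₗ tensorMap g e

theorem pairing_apply (e : Polynomial ℂ →ₐ[ℂ] A) (t : A →ₗ[ℂ] ℂ) (v : A ⊗[ℂ] g)
    (q : Polynomial ℂ ⊗[ℂ] g) : pairing e t v q = tensorForm g t (tensorMap g e q) v := rfl

/-- The `𝔤[x]`-components of the elements `v` of `W` are given by contraction of `Q` with the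
functionals `(· | v)`. -/
def Represents (e : Polynomial ℂ →ₐ[ℂ] A) (t : A →ₗ[ℂ] ℂ) (π : A →ₗ[ℂ] Polynomial ℂ)
    (W : Submodule ℂ (A ⊗[ℂ] g)) (Q : (Polynomial ℂ ⊗[ℂ] g) ⊗[ℂ] (Polynomial ℂ ⊗[ℂ] g)) : Prop :=
  ∀ v ∈ W, LinearMap.rTensor g π v = leftContract (pairing e t v) Q

theorem represents_span {e : Polynomial ℂ →ₐ[ℂ] A} {t : A →ₗ[ℂ] ℂ} {π : A →ₗ[ℂ] Polynomial ℂ}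
    {s : Set (A ⊗[ℂ] g)} {Q : (Polynomial ℂ ⊗[ℂ] g) ⊗[ℂ] (Polynomial ℂ ⊗[ℂ] g)}
    (h : ∀ v ∈ s, LinearMap.rTensor g π v = leftContract (pairing e t v) Q) :
    Represents e t π (Submodule.span ℂ s) Q := by
  intro v hv
  induction hv using Submodule.span_induction with
  | mem v hv => exact h v hv
  | zero => simp [pairing, leftContract]
  | add u v _ _ hu hv =>
    have : pairing e t (u + v) = pairing e t u + pairing e t v := by ext; simp [pairing]
    rw [this, leftContract_add, map_add, hu, hv]
  | smul z v _ hv =>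
    have : pairing e t (z • v) = z • pairing e t v := by ext; simp [pairing]
    rw [this, leftContract_smul, map_smul, hv]

end Represents

/-! ### Standard doubles and dual systems -/

/-- The double of `𝔤[x]` is standard with denominator `c(x)`: the elements
`u n = c(x) x^{-n-1}` are dual to the powers of `x` and span a complement of `ℂ[x]`. -/
structure DoubleData.IsStandard {A : Type} [CommRing A] [Algebra ℂ A] (d : DoubleData A)
    (c : Polynomial ℂ) (u : ℕ → A) : Prop where
  proj_emb : ∀ f, d.proj (d.emb f) = Polynomial.toLaurent f
  proj_u : ∀ n : ℕ, d.proj (u n) = Polynomial.toLaurent c * LaurentPolynomial.T (-(n : ℤ) - 1)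
  trace_emb : ∀ f, d.trace (d.emb f) = 0
  trace_u : ∀ n a, d.trace (u n * a) = (d.proj a).coeff (n : ℤ)
  span : LinearMap.range d.emb.toLinearMap ⊔ Submodule.span ℂ (Set.range u) = ⊤

theorem laurent_mem_bounded (f : ℂ[T;T⁻¹]) : ∃ N : ℤ, f ∈ laurentBounded N := by
  induction f using LaurentPolynomial.induction_on' with
  | add p q hp hq =>
    obtain ⟨N, hN⟩ := hp
    obtain ⟨N', hN'⟩ := hq
    have h : ∀ {a b : ℤ}, a ≤ b → laurentBounded a ≤ laurentBounded b := by
      intro a b hab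
      refine Submodule.span_mono ?_
      rintro _ ⟨m, hm, rfl⟩
      exact ⟨m, hm.trans hab, rfl⟩
    exact ⟨max N N', add_mem (h (le_max_left _ _) hN) (h (le_max_right _ _) hN')⟩
  | C_mul_T n a =>
    refine ⟨n, ?_⟩
    rw [← LaurentPolynomial.smul_eq_C_mul]
    exact Submodule.smul_mem _ _ (Submodule.subset_span ⟨n, le_rfl, rfl⟩)

theorem coeff_eq_zero_of_mem_laurentBounded {N : ℤ} {f : ℂ[T;T⁻¹]} (hf : f ∈ laurentBounded N)
    {k : ℤ} (hk : N < k) : f.coeff k = 0 := by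
  induction hf using Submodule.span_induction with
  | mem v hv =>
    obtain ⟨m, hm, rfl⟩ := hv
    rw [LaurentPolynomial.T_apply, if_neg (by omega)]
  | zero => rfl
  | add u v _ _ hu hv => simp [hu, hv]
  | smul z v _ hv => simp [hv]

namespace DoubleData.IsStandard

variable {A : Type} [CommRing A] [Algebra ℂ A] {d : DoubleData A} {c : Polynomial ℂ} {u : ℕ → A}
  {g : Type*} [LieRing g] [LieAlgebra ℂ g]

theorem trace_emb_mul_emb (hd : d.IsStandard c u) (f f' : Polynomial ℂ) :
    d.trace (d.emb f * d.emb f') = 0 := by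
  rw [← map_mul, hd.trace_emb]

theorem trace_X_pow_mul_u (hd : d.IsStandard c u) (m n : ℕ) :
    d.trace (d.emb (Polynomial.X ^ m) * u n) = if n = m then 1 else 0 := by
  rw [mul_comm, hd.trace_u, hd.proj_emb, Polynomial.toLaurent_X_pow, LaurentPolynomial.T_apply]
  simp [eq_comm]

/-- The trace vanishes on products of polynomials and pairs `X ^ n` with `u n`, so traces against
powers of `X` read off the `u n`-coefficients of `a`. -/
theorem exists_eq (hd : d.IsStandard c u) (a : A) :
    ∃ N, (∀ n ≥ N, d.trace (d.emb (Polynomial.X ^ n) * a) = 0) ∧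
      a - ∑ n ∈ Finset.range N, d.trace (d.emb (Polynomial.X ^ n) * a) • u n ∈
        LinearMap.range d.emb.toLinearMap := by
  have ha : a ∈ LinearMap.range d.emb.toLinearMap ⊔ Submodule.span ℂ (Set.range u) := by
    rw [hd.span]; trivial
  obtain ⟨_, ⟨f, rfl⟩, b, hb, rfl⟩ := Submodule.mem_sup.1 ha
  obtain ⟨α, rfl⟩ := (Finsupp.mem_span_range_iff_exists_finsupp).1 hb
  have h1 : ∀ n, d.trace (d.emb (Polynomial.X ^ n) *
      (d.emb.toLinearMap f + α.sum fun i z => z • u i)) = α n := by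
    intro n
    rw [mul_add, map_add, AlgHom.toLinearMap_apply, hd.trace_emb_mul_emb, zero_add, Finsupp.sum,
      Finset.mul_sum, map_sum]
    simp only [mul_smul_comm, map_smul, hd.trace_X_pow_mul_u, smul_eq_mul, mul_ite, mul_one,
      mul_zero, Finset.sum_ite_eq', Finsupp.mem_support_iff]
    split_ifs with h
    · rfl
    · exact (not_not.1 h).symm
  obtain ⟨N, hN⟩ := α.support.exists_nat_subset_range
  refine ⟨N, fun n hn => ?_, ?_⟩
  · rw [h1]
    by_contra h
    have := Finset.mem_range.1 (hN (Finsupp.mem_support_iff.2 h))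
    omega
  · refine ⟨f, ?_⟩
    simp only [h1]
    rw [Finsupp.sum_of_support_subset α hN _ (by simp)]
    simp

theorem mem_range_of_trace (hd : d.IsStandard c u) {a : A}
    (ha : ∀ n : ℕ, d.trace (d.emb (Polynomial.X ^ n) * a) = 0) :
    a ∈ LinearMap.range d.emb.toLinearMap := by
  obtain ⟨N, -, hN⟩ := hd.exists_eq a
  simpa only [ha, zero_smul, Finset.sum_const_zero, sub_zero] using hN

theorem form_emb_emb (hd : d.IsStandard c u) (q q' : Polynomial ℂ ⊗[ℂ] g) :
    tensorForm g d.trace (tensorMap g d.emb q) (tensorMap g d.emb q') = 0 := by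
  rw [tensorForm_map (t := 0) d.emb (κ := 0) (fun f => by simp [hd.trace_emb]), zero_mul]

theorem form_eventually (hd : d.IsStandard c u) (v : A ⊗[ℂ] g) :
    ∃ N, ∀ n ≥ N, ∀ x : g, tensorForm g d.trace (d.emb (Polynomial.X ^ n) ⊗ₜ x) v = 0 := by
  induction v with
  | zero => exact ⟨0, by simp⟩
  | add v w hv hw =>
    obtain ⟨N, hN⟩ := hv
    obtain ⟨N', hN'⟩ := hw
    refine ⟨max N N', fun n hn x => ?_⟩
    rw [map_add, hN n (le_of_max_le_left hn) x, hN' n (le_of_max_le_right hn) x, add_zero]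
  | tmul a y =>
    obtain ⟨N, hN, -⟩ := hd.exists_eq a
    refine ⟨N, fun n hn x => ?_⟩
    rw [tensorForm_tmul, hN n hn, zero_mul]

/-- Pairing with `u n` extracts the coefficient of `x^n` of the Laurent component, and this vanishes
on `W` once `n` exceeds the degree bound. -/
theorem u_tmul_mem {W : Submodule ℂ (A ⊗[ℂ] g)} (hd : d.IsStandard c u) (hW : d.IsTransversalLagrangian W) :
    ∃ N : ℕ, ∀ n ≥ N, ∀ x : g, u n ⊗ₜ x ∈ W := by
  obtain ⟨N, hN⟩ := hW.bounded
  refine ⟨(N + 1).toNat, fun n hn x => (hW.lagrangian _).2 fun w hw => ?_⟩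
  rw [Model.form_eq, tensorForm_tmul_left, hd.trace_u]
  have h1 := hN (Submodule.mem_map_of_mem hw)
  rw [boundedPart_eq] at h1
  have h2 := contract_mem_of_mem_tensorSub h1 x
  rw [contract_map] at h2
  exact coeff_eq_zero_of_mem_laurentBounded h2 (by omega)

section Basis

variable [LieAlgebra.IsKilling ℂ g]
  {ι : Type*} [Fintype ι] [DecidableEq ι] (E : Module.Basis ι ℂ g)

theorem form_emb_u (hd : d.IsStandard c u) (m n : ℕ) (l k : ι) :
    tensorForm g d.trace (d.emb (Polynomial.X ^ m) ⊗ₜ E l) (u n ⊗ₜ killingDual E k) =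
      if k = l ∧ n = m then 1 else 0 := by
  rw [tensorForm_tmul, hd.trace_X_pow_mul_u, killingForm_killingDual]
  by_cases h1 : k = l <;> by_cases h2 : n = m <;> simp [h1, h2, eq_comm]
  intro h; exact absurd h.symm h1

theorem mem_range_of_form (hd : d.IsStandard c u) {v : A ⊗[ℂ] g}
    (hv : ∀ m l, tensorForm g d.trace (d.emb (Polynomial.X ^ m) ⊗ₜ E l) v = 0) :
    ∃ q, tensorMap g d.emb q = v := by
  suffices v ∈ LinearMap.range (tensorMap g d.emb) from this
  rw [range_tensorMap, ← sum_contract_tmul_killingDual E v]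
  refine sum_mem fun k _ => tmul_mem_tensorSub (hd.mem_range_of_trace fun n => ?_) _
  rw [← tensorForm_tmul_left]
  exact hv n k

variable {W : Submodule ℂ (A ⊗[ℂ] g)}

/-- The dual system to the basis `{E_k x^n}` in a Lagrangian subalgebra. -/
def IsDualSystem (d : DoubleData A) (W : Submodule ℂ (A ⊗[ℂ] g)) (E : Module.Basis ι ℂ g)
    (w : ι → ℕ → A ⊗[ℂ] g) : Prop :=
  (∀ k n, w k n ∈ W) ∧
    ∀ k n l m, d.form g (d.emb (Polynomial.X ^ m) ⊗ₜ[ℂ] E l) (w k n) =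
      if k = l ∧ n = m then 1 else 0

/-- The component in `W` of `u n ⊗ E^k` pairs with `𝔤[x]` as `u n ⊗ E^k` does, since `𝔤[x]` is
isotropic. -/
theorem exists_isDualSystem (hd : d.IsStandard c u) (hW : d.IsTransversalLagrangian W) :
    ∃ w, IsDualSystem d W E w := by
  have h1 : ∀ k n, ∃ w ∈ W, ∃ q, tensorMap g d.emb q + w = u n ⊗ₜ killingDual E k := by
    intro k n
    have h2 : u n ⊗ₜ killingDual E k ∈ d.current g ⊔ W := by rw [hW.isCompl.sup_eq_top]; trivial
    obtain ⟨_, ⟨q, rfl⟩, w, hw, h⟩ := Submodule.mem_sup.1 h2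
    exact ⟨w, hw, q, h⟩
  choose w hw q hq using h1
  refine ⟨w, hw, fun k n l m => ?_⟩
  have h2 : tensorForm g d.trace (tensorMap g d.emb ((Polynomial.X ^ m) ⊗ₜ[ℂ] E l))
      (tensorMap g d.emb (q k n) + w k n) = if k = l ∧ n = m then 1 else 0 := by
    rw [hq, tensorMap_tmul, hd.form_emb_u]
  rwa [map_add, hd.form_emb_emb, zero_add, tensorMap_tmul] at h2

/-- The tails of a dual system. -/
theorem exists_tails (hd : d.IsStandard c u) (hW : d.IsTransversalLagrangian W)
    {w : ι → ℕ → A ⊗[ℂ] g} (hw : IsDualSystem d W E w) :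
    ∃ (q : ι → ℕ → Polynomial ℂ ⊗[ℂ] g) (N : ℕ),
      (∀ k n, w k n = u n ⊗ₜ killingDual E k + tensorMap g d.emb (q k n)) ∧
        ∀ k, ∀ n ≥ N, q k n = 0 := by
  have h1 : ∀ k n, ∃ q, tensorMap g d.emb q = w k n - u n ⊗ₜ killingDual E k := by
    intro k n
    refine hd.mem_range_of_form E fun m l => ?_
    rw [map_sub, hd.form_emb_u]
    exact sub_eq_zero.2 (hw.2 k n l m)
  choose q hq using h1
  obtain ⟨N, hN⟩ := hd.u_tmul_mem hW
  refine ⟨q, N, fun k n => by rw [hq]; abel, fun k n hn => ?_⟩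
  -- For large `n` both `w k n` and `u n ⊗ E^k` are in `W`, so the tail is in `W ∩ 𝔤[x] = 0`.
  have h2 : tensorMap g d.emb (q k n) ∈ W := by
    rw [hq]; exact sub_mem (hw.1 k n) (hN n hn _)
  have h3 := (Submodule.disjoint_def.1 hW.isCompl.disjoint) _ ⟨q k n, rfl⟩ h2
  have h4 : Function.Injective (tensorMap g d.emb) := by
    refine Module.Flat.rTensor_preserves_injective_linearMap _ fun f f' h => ?_
    apply Polynomial.toLaurent_injective
    rw [← hd.proj_emb, ← hd.proj_emb]
    exact congrArg d.proj h
  exact h4 (h3.trans (map_zero _).symm)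

/-- An element of `W` pairs nontrivially with only finitely many `E_k x^n`. Subtracting the
corresponding combination of the `w k n` leaves an element orthogonal to `𝔤[x]`, hence in `W ∩ 𝔤[x]
= 0`. -/
theorem span_eq (hd : d.IsStandard c u) (hW : d.IsTransversalLagrangian W)
    {w : ι → ℕ → A ⊗[ℂ] g} (hw : IsDualSystem d W E w) :
    W ≤ Submodule.span ℂ (Set.range fun kn : ι × ℕ => w kn.1 kn.2) := by
  intro v hv
  obtain ⟨N, hN⟩ := hd.form_eventually v
  let v' := ∑ n ∈ Finset.range N, ∑ k,
    tensorForm g d.trace (d.emb (Polynomial.X ^ n) ⊗ₜ E k) v • w k n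
  have h1 : v' ∈ Submodule.span ℂ (Set.range fun kn : ι × ℕ => w kn.1 kn.2) :=
    sum_mem fun n _ => sum_mem fun k _ =>
      Submodule.smul_mem _ _ (Submodule.subset_span ⟨(k, n), rfl⟩)
  have h2 : v' ∈ W := sum_mem fun n _ => sum_mem fun k _ => Submodule.smul_mem _ _ (hw.1 k n)
  obtain ⟨q, hq⟩ : ∃ q, tensorMap g d.emb q = v - v' := by
    refine hd.mem_range_of_form E fun m l => ?_
    have h3 : ∀ k n, tensorForm g d.trace (d.emb (Polynomial.X ^ m) ⊗ₜ[ℂ] E l) (w k n) =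
      if k = l ∧ n = m then 1 else 0 := fun k n => hw.2 k n l m
    simp only [v', map_sub, map_sum, map_smul, h3, ite_and, smul_eq_mul, mul_ite, mul_one, mul_zero,
      Finset.sum_ite_eq', Finset.mem_univ, if_true, Finset.mem_range]
    split_ifs with h
    · exact sub_self _
    · rw [hN m (not_lt.1 h), sub_zero]
  have h3 := (Submodule.disjoint_def.1 hW.isCompl.disjoint) _ ⟨q, rfl⟩
    (show tensorMap g d.emb q ∈ W by rw [hq]; exact sub_mem hv h2)
  have h4 : v = v' := sub_eq_zero.1 (hq.symm.trans h3)
  rwa [h4]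

/-- The polynomial tensor given by the tails of a dual system. -/
def tailTensor (E : Module.Basis ι ℂ g) (q : ι → ℕ → Polynomial ℂ ⊗[ℂ] g) (N : ℕ) :
    (Polynomial ℂ ⊗[ℂ] g) ⊗[ℂ] (Polynomial ℂ ⊗[ℂ] g) :=
  ∑ n ∈ Finset.range N, ∑ k, ((Polynomial.X ^ n) ⊗ₜ[ℂ] E k) ⊗ₜ[ℂ] q k n

/-- Both sides are linear in the element of `W`, so they are compared on the dual system:
contraction with `(·|w l m)` selects the tail `q l m`, which is also the polynomial component of `w
l m` because `π` kills `u m`. -/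
theorem represents_tailTensor (hd : d.IsStandard c u) (hW : d.IsTransversalLagrangian W)
    {π : A →ₗ[ℂ] Polynomial ℂ} (hπ : ∀ f, π (d.emb f) = f) (hπu : ∀ n, π (u n) = 0)
    {w : ι → ℕ → A ⊗[ℂ] g} (hw : IsDualSystem d W E w) {q : ι → ℕ → Polynomial ℂ ⊗[ℂ] g} {N : ℕ}
    (hq : ∀ k n, w k n = u n ⊗ₜ killingDual E k + tensorMap g d.emb (q k n))
    (hN : ∀ k, ∀ n ≥ N, q k n = 0) :
    Represents d.emb d.trace π W (tailTensor E q N) := by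
  have h1 := represents_span (e := d.emb) (t := d.trace) (π := π) (Q := tailTensor E q N)
    (s := Set.range fun kn : ι × ℕ => w kn.1 kn.2) (by
      rintro _ ⟨⟨l, m⟩, rfl⟩
      have h2 : ∀ q : Polynomial ℂ ⊗[ℂ] g, LinearMap.rTensor g π (tensorMap g d.emb q) = q := by
        intro q
        induction q with
        | zero => simp
        | add q q' h h' => rw [map_add, map_add, h, h']
        | tmul f x => simp [hπ]
      have h3 : ∀ k n, pairing d.emb d.trace (w l m) ((Polynomial.X ^ n) ⊗ₜ[ℂ] E k) =
          if l = k ∧ m = n then 1 else 0 := fun k n => hw.2 l m k n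
      simp only [tailTensor, map_sum, leftContract_tmul, h3, ite_and, ite_smul, one_smul, zero_smul]
      simp only [Finset.sum_ite_eq, Finset.mem_univ, if_true, Finset.mem_range]
      rw [hq, map_add, h2, LinearMap.rTensor_tmul, hπu, TensorProduct.zero_tmul, zero_add]
      split_ifs with h
      · rfl
      · exact hN l m (not_lt.1 h))
  exact fun v hv => h1 v (hd.span_eq E hW hw hv)

/-- For a dual system the functionals `(·|w k n)` are the coordinates of the basis `x^n ⊗ E_k`, so
all coordinates of `Q` are prescribed. -/
theorem represents_unique [FiniteDimensional ℂ g] (hd : d.IsStandard c u) (hW : d.IsTransversalLagrangian W)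
    {π : A →ₗ[ℂ] Polynomial ℂ} {Q Q' : (Polynomial ℂ ⊗[ℂ] g) ⊗[ℂ] (Polynomial ℂ ⊗[ℂ] g)}
    (hQ : Represents d.emb d.trace π W Q) (hQ' : Represents d.emb d.trace π W Q') : Q = Q' := by
  obtain ⟨w, hw⟩ := hd.exists_isDualSystem (Module.finBasis ℂ g) hW
  refine leftContract_ext ((Polynomial.basisMonomials ℂ).tensorProduct (Module.finBasis ℂ g)) ?_
  rintro ⟨n, k⟩
  have h1 : ((Polynomial.basisMonomials ℂ).tensorProduct (Module.finBasis ℂ g)).coord (n, k) =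
      pairing d.emb d.trace (w k n) := by
    refine ((Polynomial.basisMonomials ℂ).tensorProduct (Module.finBasis ℂ g)).ext ?_
    rintro ⟨m, l⟩
    have h2 := hw.2 k n l m
    rw [Module.Basis.coord_apply, Module.Basis.repr_self, Module.Basis.tensorProduct_apply,
      Polynomial.coe_basisMonomials, Finsupp.single_apply]
    dsimp only
    rw [← Polynomial.X_pow_eq_monomial]
    refine Eq.trans ?_ h2.symm
    by_cases h3 : k = l <;> by_cases h4 : n = m <;> simp [h3, h4, eq_comm]
  rw [h1, ← hQ _ (hw.1 k n), ← hQ' _ (hw.1 k n)]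

end Basis

end DoubleData.IsStandard

/-! ### Tensors over polynomials, rational functions and series in two variables -/

section TwoVariables

/-- The product `f(x) h(y)`. -/
def mulXY : Polynomial ℂ ⊗[ℂ] Polynomial ℂ →ₗ[ℂ] Poly₂ :=
  LinearMap.mul' ℂ Poly₂ ∘ₗ TensorProduct.map
    (Polynomial.aeval (MvPolynomial.X 0 : Poly₂)).toLinearMap
    (Polynomial.aeval (MvPolynomial.X 1 : Poly₂)).toLinearMap

variable {g : Type*} [LieRing g] [LieAlgebra ℂ g]

/-- The identification of `𝔤[x] ⊗ 𝔤[y]` with `(𝔤 ⊗ 𝔤)[x, y]`. -/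
def twoVar : (Polynomial ℂ ⊗[ℂ] g) ⊗[ℂ] (Polynomial ℂ ⊗[ℂ] g) →ₗ[ℂ] Poly₂ ⊗[ℂ] (g ⊗[ℂ] g) :=
  LinearMap.rTensor (g ⊗[ℂ] g) mulXY ∘ₗ
    (TensorProduct.tensorTensorTensorComm ℂ (Polynomial ℂ) g (Polynomial ℂ) g).toLinearMap

@[simp]
theorem twoVar_tmul (f h : Polynomial ℂ) (a b : g) :
    twoVar ((f ⊗ₜ[ℂ] a) ⊗ₜ[ℂ] (h ⊗ₜ[ℂ] b)) =
      (Polynomial.aeval (MvPolynomial.X 0 : Poly₂) f *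
        Polynomial.aeval (MvPolynomial.X 1 : Poly₂) h) ⊗ₜ[ℂ] (a ⊗ₜ[ℂ] b) := by
  simp [twoVar, mulXY]

variable (g) in
/-- The inclusion of `(𝔤 ⊗ 𝔤)[x, y]` into the rational functions. -/
def toRat : Poly₂ ⊗[ℂ] (g ⊗[ℂ] g) →ₗ[ℂ] Rat₂ ⊗[ℂ] (g ⊗[ℂ] g) :=
  LinearMap.rTensor (g ⊗[ℂ] g) (Algebra.linearMap Poly₂ Rat₂ |>.restrictScalars ℂ)

@[simp]
theorem toRat_tmul (f : Poly₂) (a : g ⊗[ℂ] g) :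
    toRat g (f ⊗ₜ a) = algebraMap Poly₂ Rat₂ f ⊗ₜ a := rfl

theorem toRat_smul (f : Poly₂) (P : Poly₂ ⊗[ℂ] (g ⊗[ℂ] g)) :
    toRat g (f • P) = algebraMap Poly₂ Rat₂ f • toRat g P := by
  induction P with
  | zero => simp
  | add P P' h h' => simp only [smul_add, map_add, h, h']
  | tmul f x => simp [TensorProduct.smul_tmul', Algebra.smul_def]

variable (g) in
/-- The inclusion of `(𝔤 ⊗ 𝔤)[x, y]` into the formal series. -/
def toSeries : Poly₂ ⊗[ℂ] (g ⊗[ℂ] g) →ₗ[ℂ] Series₂ ⊗[ℂ] (g ⊗[ℂ] g) :=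
  LinearMap.rTensor (g ⊗[ℂ] g) polyToSeries.toLinearMap

@[simp]
theorem toSeries_tmul (f : Poly₂) (a : g ⊗[ℂ] g) :
    toSeries g (f ⊗ₜ a) = polyToSeries f ⊗ₜ a := rfl

theorem toSeries_smul (f : Poly₂) (P : Poly₂ ⊗[ℂ] (g ⊗[ℂ] g)) :
    toSeries g (f • P) = polyToSeries f • toSeries g P := by
  induction P with
  | zero => simp
  | add P P' h h' => simp only [smul_add, map_add, h, h']
  | tmul f x => simp [TensorProduct.smul_tmul']

theorem ry_sub_rx : ry - rx = algebraMap Poly₂ Rat₂ (MvPolynomial.X 1 - MvPolynomial.X 0) := by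
  simp [ry, rx]

theorem ry_sub_rx_ne_zero : ry - rx ≠ 0 := by
  rw [ry_sub_rx]
  refine (map_ne_zero_iff _ (IsFractionRing.injective Poly₂ Rat₂)).2 ?_
  rw [sub_ne_zero]
  exact fun h => by simpa using MvPolynomial.X_injective h

theorem polyToSeries_X_zero : polyToSeries (MvPolynomial.X 0) = PowerSeries.X := by
  simp [polyToSeries]

theorem polyToSeries_X_one :
    polyToSeries (MvPolynomial.X 1) = PowerSeries.C (LaurentPolynomial.T 1) := by
  simp [polyToSeries]

/-- Every coefficient of a polynomial can be recovered from its series, which gives injectivity. -/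
theorem coeff_polyToSeries (f : Poly₂) (m : Fin 2 →₀ ℕ) :
    (PowerSeries.coeff (m 0) (polyToSeries f)).coeff (m 1 : ℤ) = f.coeff m := by
  induction f using MvPolynomial.induction_on' with
  | monomial k a =>
    have h1 : polyToSeries (MvPolynomial.monomial k a) =
        a • (PowerSeries.X ^ k 0 * PowerSeries.C (LaurentPolynomial.T (k 1 : ℤ))) := by
      rw [polyToSeries, MvPolynomial.aeval_monomial, Finsupp.prod_fintype _ _ (by simp),
        Fin.prod_univ_two, Algebra.algebraMap_eq_smul_one]
      simp [LaurentPolynomial.T_pow, ← map_pow]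
    have h2 : k = m ↔ k 0 = m 0 ∧ k 1 = m 1 := by
      rw [Finsupp.ext_iff, Fin.forall_fin_two]
    rw [h1, MvPolynomial.coeff_monomial, PowerSeries.coeff_smul, PowerSeries.coeff_mul_C,
      PowerSeries.coeff_X_pow]
    by_cases h3 : k 0 = m 0
    · by_cases h4 : k 1 = m 1 <;> simp [h2, h3, h4]
    · simp [h2, h3, Ne.symm h3]
  | add p q hp hq => simp [hp, hq]

theorem polyToSeries_injective : Function.Injective polyToSeries := by
  intro f f' h
  ext m
  rw [← coeff_polyToSeries, h, coeff_polyToSeries]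

/-- The series fixes the numerator `P` because polynomials embed in `Series₂`, and `y - x` is
invertible among rational functions. -/
theorem IsExpansion.unique {r r' : Rat₂ ⊗[ℂ] (g ⊗[ℂ] g)} {s : Series₂ ⊗[ℂ] (g ⊗[ℂ] g)}
    (h : IsExpansion r s) (h' : IsExpansion r' s) : r = r' := by
  obtain ⟨P, h1, h2⟩ := h
  obtain ⟨P', h1', h2'⟩ := h'
  have h3 : P = P' := by
    have : Function.Injective (toSeries g) :=
      Module.Flat.rTensor_preserves_injective_linearMap _ polyToSeries_injective
    exact this (h2.trans h2'.symm)
  rw [← h3, h1] at h1'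
  have h4 := congrArg (fun t => (ry - rx)⁻¹ • t) h1'
  simpa [smul_smul, inv_mul_cancel₀ ry_sub_rx_ne_zero] using h4

theorem polyToSeries_aeval_X_zero (f : Polynomial ℂ) :
    polyToSeries (Polynomial.aeval (MvPolynomial.X 0 : Poly₂) f) =
      Polynomial.aeval PowerSeries.X f := by
  rw [← Polynomial.aeval_algHom_apply, polyToSeries_X_zero]

theorem polyToSeries_aeval_X_one (f : Polynomial ℂ) :
    polyToSeries (Polynomial.aeval (MvPolynomial.X 1 : Poly₂) f) =
      PowerSeries.C (Polynomial.toLaurent f) := by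
  rw [← Polynomial.aeval_algHom_apply, polyToSeries_X_one]
  induction f using Polynomial.induction_on' with
  | add p q hp hq => simp [hp, hq]
  | monomial n a =>
    rw [Polynomial.aeval_monomial, ← Polynomial.C_mul_X_pow_eq_monomial, map_mul,
      Polynomial.toLaurent_C, Polynomial.toLaurent_X_pow, map_mul, ← map_pow,
      LaurentPolynomial.T_pow, mul_one, PowerSeries.algebraMap_apply]
    rfl

theorem toSeries_twoVar {ι : Type*} [Fintype ι] (E : Module.Basis ι ℂ g) (n : ℕ) (a : g)
    (q : Polynomial ℂ ⊗[ℂ] g) :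
    toSeries g (twoVar (((Polynomial.X ^ n) ⊗ₜ[ℂ] a) ⊗ₜ[ℂ] q)) =
      ∑ l, (PowerSeries.X ^ n * PowerSeries.C ((E.baseChange ℂ[T;T⁻¹]).repr
        (LinearMap.rTensor g Polynomial.toLaurentAlg.toLinearMap q) l)) ⊗ₜ[ℂ] (a ⊗ₜ[ℂ] E l) := by
  induction q with
  | zero => simp
  | add q q' h h' =>
    simp only [TensorProduct.tmul_add, map_add, h, h', Finsupp.add_apply, mul_add,
      TensorProduct.add_tmul, Finset.sum_add_distrib]
  | tmul f b =>
    rw [twoVar_tmul, toSeries_tmul, map_mul, polyToSeries_aeval_X_zero, polyToSeries_aeval_X_one]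
    conv_lhs => rw [← E.sum_repr b]
    simp only [TensorProduct.tmul_sum, LinearMap.rTensor_tmul, Module.Basis.baseChange_repr_tmul,
      TensorProduct.tmul_smul, map_pow, Polynomial.aeval_X]
    refine Finset.sum_congr rfl fun l _ => ?_
    rw [TensorProduct.smul_tmul']
    congr 1
    rw [← mul_smul_comm]
    congr 1
    ext1 k
    rw [PowerSeries.coeff_smul, PowerSeries.coeff_C, PowerSeries.coeff_C]
    split_ifs
    · rfl
    · simp

end TwoVariables

/-! ### The `r`-matrix of a Lagrangian subalgebra -/

section RMatrix

variable {g : Type*} [LieRing g] [LieAlgebra ℂ g] [FiniteDimensional ℂ g] [LieAlgebra.IsSimple ℂ g]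

theorem casimir_eq {ι : Type*} [Fintype ι] [DecidableEq ι] (E : Module.Basis ι ℂ g) :
    casimir g = ∑ k, E k ⊗ₜ[ℂ] killingDual E k := by
  have h1 : casimir g = ∑ k, Module.finBasis ℂ g k ⊗ₜ[ℂ] killingDual (Module.finBasis ℂ g) k := rfl
  rw [h1]
  conv_lhs =>
    enter [2, k, 3]
    rw [← sum_killingForm_smul_killingDual E (killingDual (Module.finBasis ℂ g) k)]
  simp only [TensorProduct.tmul_sum, TensorProduct.tmul_smul, TensorProduct.smul_tmul']
  rw [Finset.sum_comm]
  refine Finset.sum_congr rfl fun k _ => ?_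
  rw [← TensorProduct.sum_tmul]
  congr 1
  conv_rhs => rw [← sum_killingForm_killingDual_smul (Module.finBasis ℂ g) (E k)]
  simp only [killingForm_comm (E k)]

/-- The rational function `c(y) / (y - x) Ω + Q(x, y)`. -/
def rationalTensor (c : Polynomial ℂ)
    (Q : (Polynomial ℂ ⊗[ℂ] g) ⊗[ℂ] (Polynomial ℂ ⊗[ℂ] g)) : Rat₂ ⊗[ℂ] (g ⊗[ℂ] g) :=
  (algebraMap Poly₂ Rat₂ (Polynomial.aeval (MvPolynomial.X 1 : Poly₂) c) / (ry - rx)) ⊗ₜ casimir g +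
    toRat g (twoVar Q)

/-- The expansion of `c(y) / (y - x)`. -/
def poleSeries (c : Polynomial ℂ) : Series₂ :=
  PowerSeries.mk fun n => Polynomial.toLaurent c * LaurentPolynomial.T (-(n : ℤ) - 1)

/-- Telescoping geometric series: `∑ c(y) y^{-n-1} x^n` times `y - x` leaves only `c(y)`. -/
theorem sub_mul_poleSeries (c : Polynomial ℂ) :
    polyToSeries (MvPolynomial.X 1 - MvPolynomial.X 0) * poleSeries c =
      polyToSeries (Polynomial.aeval (MvPolynomial.X 1 : Poly₂) c) := by
  rw [map_sub, polyToSeries_X_zero, polyToSeries_X_one, polyToSeries_aeval_X_one, sub_mul]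
  ext1 n
  rw [map_sub, PowerSeries.coeff_C_mul, poleSeries, PowerSeries.coeff_mk, PowerSeries.coeff_C]
  rcases n with _ | n
  · rw [PowerSeries.coeff_zero_X_mul, mul_left_comm, ← LaurentPolynomial.T_add]
    simp
  · rw [PowerSeries.coeff_succ_X_mul, PowerSeries.coeff_mk, mul_left_comm,
      ← LaurentPolynomial.T_add, if_neg (Nat.succ_ne_zero n), sub_eq_zero]
    congr 2
    push_cast
    ring

theorem isExpansion_rationalTensor (c : Polynomial ℂ)
    (Q : (Polynomial ℂ ⊗[ℂ] g) ⊗[ℂ] (Polynomial ℂ ⊗[ℂ] g)) :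
    IsExpansion (rationalTensor c Q)
      (poleSeries c ⊗ₜ casimir g + toSeries g (twoVar Q)) := by
  refine ⟨Polynomial.aeval (MvPolynomial.X 1 : Poly₂) c ⊗ₜ casimir g +
    (MvPolynomial.X 1 - MvPolynomial.X 0 : Poly₂) • twoVar Q, ?_, ?_⟩
  · change toRat g _ = _
    rw [map_add, toRat_tmul, toRat_smul, rationalTensor, smul_add, ← ry_sub_rx,
      TensorProduct.smul_tmul', smul_eq_mul, mul_div_cancel₀ _ ry_sub_rx_ne_zero]
  · change toSeries g _ = _
    rw [map_add, toSeries_tmul, toSeries_smul, smul_add, TensorProduct.smul_tmul', smul_eq_mul,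
      sub_mul_poleSeries]

/-- The parts `u n ⊗ E^k` of the dual system sum to the expansion of `c(y)/(y-x) Ω`; the finitely
many tails give the polynomial part. -/
theorem series_eq {A : Type} [CommRing A] [Algebra ℂ A] {d : DoubleData A} {c : Polynomial ℂ}
    {u : ℕ → A} (hd : d.IsStandard c u) {ι : Type*} [Fintype ι] [DecidableEq ι]
    (E : Module.Basis ι ℂ g)
    {w : ι → ℕ → A ⊗[ℂ] g} {q : ι → ℕ → Polynomial ℂ ⊗[ℂ] g} {N : ℕ}
    (hq : ∀ k n, w k n = u n ⊗ₜ killingDual E k + tensorMap g d.emb (q k n))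
    (hN : ∀ k, ∀ n ≥ N, q k n = 0) :
    ∑ k, ∑ l, (PowerSeries.mk fun n => (E.baseChange ℂ[T;T⁻¹]).repr
        (LinearMap.rTensor g d.proj.toLinearMap (w k n)) l) ⊗ₜ[ℂ] (E k ⊗ₜ[ℂ] E l) =
      poleSeries c ⊗ₜ casimir g +
        toSeries g (twoVar (DoubleData.IsStandard.tailTensor E q N)) := by
  have h1 : ∀ q : Polynomial ℂ ⊗[ℂ] g,
      LinearMap.rTensor g d.proj.toLinearMap (tensorMap g d.emb q) =
        LinearMap.rTensor g Polynomial.toLaurentAlg.toLinearMap q := by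
    intro q
    induction q with
    | zero => simp
    | add q q' h h' => simp only [map_add, h, h']
    | tmul f b => simp [hd.proj_emb]
  have h2 : ∀ k l, (PowerSeries.mk fun n => (E.baseChange ℂ[T;T⁻¹]).repr
      (LinearMap.rTensor g d.proj.toLinearMap (w k n)) l) =
      E.repr (killingDual E k) l • poleSeries c + ∑ n ∈ Finset.range N,
        PowerSeries.X ^ n * PowerSeries.C ((E.baseChange ℂ[T;T⁻¹]).repr
          (LinearMap.rTensor g Polynomial.toLaurentAlg.toLinearMap (q k n)) l) := by
    intro k l
    ext1 n
    rw [PowerSeries.coeff_mk, hq, map_add, map_add, h1, Finsupp.add_apply, map_add,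
      PowerSeries.coeff_smul, poleSeries, PowerSeries.coeff_mk, LinearMap.rTensor_tmul,
      Module.Basis.baseChange_repr_tmul, AlgHom.toLinearMap_apply, hd.proj_u, map_sum]
    congr 1
    simp only [PowerSeries.coeff_mul_C, PowerSeries.coeff_X_pow, ite_mul, one_mul, zero_mul,
      Finset.sum_ite_eq, Finset.mem_range]
    split_ifs with h
    · rfl
    · rw [hN k n (not_lt.1 h)]; simp
  simp only [h2, TensorProduct.add_tmul, Finset.sum_add_distrib]
  congr 1
  · rw [casimir_eq E, TensorProduct.tmul_sum]
    refine Finset.sum_congr rfl fun k _ => ?_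
    conv_rhs => rw [← E.sum_repr (killingDual E k)]
    simp only [TensorProduct.tmul_sum, TensorProduct.tmul_smul, ← TensorProduct.smul_tmul']
  · simp only [DoubleData.IsStandard.tailTensor, map_sum, toSeries_twoVar E]
    rw [Finset.sum_comm (s := Finset.range N)]
    refine Finset.sum_congr rfl fun k _ => ?_
    rw [Finset.sum_comm (s := Finset.range N)]
    exact Finset.sum_congr rfl fun l _ => TensorProduct.sum_tmul _ _ _

variable {A : Type} [CommRing A] [Algebra ℂ A] {d : DoubleData A} {c : Polynomial ℂ}
  {u : ℕ → A} {W : Submodule ℂ (A ⊗[ℂ] g)} {π : A →ₗ[ℂ] Polynomial ℂ}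

theorem exists_represents (hd : d.IsStandard c u) (hW : d.IsTransversalLagrangian W)
    (hπ : ∀ f, π (d.emb f) = f) (hπu : ∀ n, π (u n) = 0) :
    ∃ Q, Represents d.emb d.trace π W Q := by
  obtain ⟨w, hw⟩ := hd.exists_isDualSystem (Module.finBasis ℂ g) hW
  obtain ⟨q, N, hq, hN⟩ := hd.exists_tails _ hW hw
  exact ⟨_, hd.represents_tailTensor _ hW hπ hπu hw hq hN⟩

/-- The definition of an `r`-matrix allows any basis and dual system, but the tail tensor of each
choice represents `W` and hence equals `Q`. -/
theorem isRMatrix_iff (hd : d.IsStandard c u) (hW : d.IsTransversalLagrangian W)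
    (hπ : ∀ f, π (d.emb f) = f) (hπu : ∀ n, π (u n) = 0)
    {Q : (Polynomial ℂ ⊗[ℂ] g) ⊗[ℂ] (Polynomial ℂ ⊗[ℂ] g)}
    (hQ : Represents d.emb d.trace π W Q) (r : Rat₂ ⊗[ℂ] (g ⊗[ℂ] g)) :
    IsRMatrix d W r ↔ r = rationalTensor c Q := by
  have key : ∀ (E : Module.Basis (Fin (Module.finrank ℂ g)) ℂ g) (w),
      DoubleData.IsStandard.IsDualSystem d W E w →
      IsExpansion (rationalTensor c Q) (∑ k, ∑ l,
      (PowerSeries.mk fun n => (E.baseChange ℂ[T;T⁻¹]).repr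
        (LinearMap.rTensor g d.proj.toLinearMap (w k n)) l) ⊗ₜ[ℂ] (E k ⊗ₜ[ℂ] E l)) := by
    intro E w hw
    obtain ⟨q, N, hq, hN⟩ := hd.exists_tails E hW hw
    rw [series_eq hd E hq hN, hd.represents_unique hW hQ
      (hd.represents_tailTensor E hW hπ hπu hw hq hN)]
    exact isExpansion_rationalTensor c _
  constructor
  · rintro ⟨E, w, h1, h2, h3⟩
    exact h3.unique (key E w ⟨h1, h2⟩)
  · rintro rfl
    obtain ⟨w, hw⟩ := hd.exists_isDualSystem (Module.finBasis ℂ g) hW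
    exact ⟨Module.finBasis ℂ g, w, hw.1, hw.2, key _ w hw⟩

end RMatrix

/-! ### Evaluation of Laurent polynomials and orders of Laurent series at infinity -/

section LaurentEval

variable {S : Type*} [CommRing S] [Algebra ℂ S]

/-- The evaluation of Laurent polynomials at a unit. -/
def laurentEval (y : Sˣ) : ℂ[T;T⁻¹] →ₐ[ℂ] S :=
  { LaurentPolynomial.eval₂ (algebraMap ℂ S) y with
    commutes' := fun r => LaurentPolynomial.eval₂_C _ _ r }

@[simp]
theorem laurentEval_T (y : Sˣ) (n : ℤ) : laurentEval y (LaurentPolynomial.T n) = ↑(y ^ n) :=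
  LaurentPolynomial.eval₂_T _ _ n

@[simp]
theorem laurentEval_toLaurent (y : Sˣ) (f : Polynomial ℂ) :
    laurentEval y (Polynomial.toLaurent f) = Polynomial.aeval (y : S) f :=
  LaurentPolynomial.eval₂_toLaurent _ _ f

theorem laurentEval_map {S' : Type*} [CommRing S'] [Algebra ℂ S'] (φ : S →ₐ[ℂ] S') (y : Sˣ)
    (f : ℂ[T;T⁻¹]) : φ (laurentEval y f) = laurentEval (Units.map (φ : S →* S') y) f := by
  induction f using LaurentPolynomial.induction_on' with
  | add p q hp hq => simp only [map_add, hp, hq]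
  | C_mul_T n a =>
    rw [← LaurentPolynomial.smul_eq_C_mul, map_smul, map_smul, map_smul, laurentEval_T,
      laurentEval_T, ← map_zpow]
    rfl

end LaurentEval

theorem mem_laurentBounded {N : ℤ} {f : ℂ[T;T⁻¹]} :
    f ∈ laurentBounded N ↔ ∀ k, N < k → f.coeff k = 0 := by
  refine ⟨fun hf k hk => coeff_eq_zero_of_mem_laurentBounded hf hk, fun h => ?_⟩
  have h1 : f = ∑ k ∈ f.coeff.support, f.coeff k • LaurentPolynomial.T k := by
    conv_lhs => rw [← AddMonoidAlgebra.sum_coeff_single f]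
    simp [Finsupp.sum, LaurentPolynomial.single_eq_C_mul_T, LaurentPolynomial.smul_eq_C_mul]
  rw [h1]
  refine sum_mem fun k hk => Submodule.smul_mem _ _ (Submodule.subset_span ⟨k, ?_, rfl⟩)
  by_contra h2
  exact Finsupp.mem_support_iff.1 hk (h k (not_le.1 h2))

section Order

/-- The coefficientwise algebra structure, as opposed to the one obtained from power series. -/
instance laurentSeriesAlgebra : Algebra ℂ (LaurentSeries ℂ) := HahnSeries.instAlgebra

instance laurentSeriesSMulCommClass : SMulCommClass ℂ (LaurentSeries ℂ) (LaurentSeries ℂ) :=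
  Algebra.to_smulCommClass (R := ℂ) (A := LaurentSeries ℂ)

instance laurentSeriesIsScalarTower : IsScalarTower ℂ (LaurentSeries ℂ) (LaurentSeries ℂ) :=
  IsScalarTower.right (R := ℂ) (A := LaurentSeries ℂ)

/-- The Laurent series in `x⁻¹` of degree at most `-M` in `x`. -/
def ordGE (M : ℤ) : Submodule ℂ (LaurentSeries ℂ) where
  carrier := {f | ∀ k < M, f.coeff k = 0}
  zero_mem' := fun _ _ => rfl
  add_mem' := fun hf hg k hk => by rw [HahnSeries.coeff_add, hf k hk, hg k hk, add_zero]
  smul_mem' := fun z f hf k hk => by rw [HahnSeries.coeff_smul, hf k hk, smul_zero]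

theorem ordGE_anti : Antitone ordGE := fun _ _ h _ hf k hk => hf k (hk.trans_le h)

theorem mul_mem_ordGE {M N : ℤ} {f g : LaurentSeries ℂ} (hf : f ∈ ordGE M) (hg : g ∈ ordGE N) :
    f * g ∈ ordGE (M + N) := by
  intro k hk
  rw [HahnSeries.coeff_mul]
  refine Finset.sum_eq_zero fun ij hij => ?_
  have h := (Finset.mem_antidiagonal.1 hij)
  by_cases h1 : ij.1 < M
  · rw [hf _ h1, zero_mul]
  · rw [hg _ (by have := h.2.2; omega), mul_zero]

theorem exists_mem_ordGE (f : LaurentSeries ℂ) : ∃ M, f ∈ ordGE M :=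
  ⟨f.order, fun _ hk => HahnSeries.coeff_eq_zero_of_lt_order hk⟩

theorem mem_ordGE_succ {M : ℤ} {f : LaurentSeries ℂ} (hf : f ∈ ordGE M) (h : f.coeff M = 0) :
    f ∈ ordGE (M + 1) := by
  intro k hk
  rcases (Int.lt_add_one_iff.1 hk).lt_or_eq with h1 | rfl
  · exact hf k h1
  · exact h

theorem mem_ordGE_order (f : LaurentSeries ℂ) : f ∈ ordGE f.order :=
  fun _ hk => HahnSeries.coeff_eq_zero_of_lt_order hk

theorem coeff_order_ne_zero {f : LaurentSeries ℂ} (hf : f ≠ 0) : f.coeff f.order ≠ 0 :=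
  fun h => hf (HahnSeries.coeff_order_eq_zero.1 h)

theorem order_eq {f : LaurentSeries ℂ} {M : ℤ} (hf : f ∈ ordGE M) (h : f.coeff M ≠ 0) :
    f.order = M := by
  apply le_antisymm
  · exact HahnSeries.order_le_of_coeff_ne_zero h
  · by_contra h1
    refine coeff_order_ne_zero (f := f) ?_ (hf _ (not_le.1 h1))
    rintro rfl
    exact h rfl

theorem order_zpow {y : LaurentSeries ℂ} (hy : y ≠ 0) (n : ℤ) : (y ^ n).order = n * y.order := by
  have h1 : ∀ n : ℕ, (y ^ n).order = n * y.order := by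
    intro n
    induction n with
    | zero => simp
    | succ n ih =>
      rw [pow_succ, HahnSeries.order_mul (pow_ne_zero n hy) hy, ih]
      push_cast
      ring
  obtain ⟨k, rfl | rfl⟩ := n.eq_nat_or_neg
  · simp [h1 k]
  · have h2 := HahnSeries.order_mul (zpow_ne_zero (-(k : ℤ)) hy) (pow_ne_zero k hy)
    rw [← zpow_natCast, ← zpow_add₀ hy, neg_add_cancel, zpow_zero, HahnSeries.order_one,
      zpow_natCast, h1] at h2
    linarith

/-- A subspace which contains elements of all orders less than `M` is dense modulo `ordGE M`. -/
theorem exists_sub_mem_ordGE (S : Submodule ℂ (LaurentSeries ℂ)) (M : ℤ)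
    (hS : ∀ k < M, ∃ s ∈ S, s ≠ 0 ∧ s.order = k) (f : LaurentSeries ℂ) :
    ∃ s ∈ S, f - s ∈ ordGE M := by
  have h1 : ∀ (k : ℕ) (f : LaurentSeries ℂ), f ∈ ordGE (M - k) → ∃ s ∈ S, f - s ∈ ordGE M := by
    intro k
    induction k with
    | zero => intro f hf; exact ⟨0, S.zero_mem, by simpa using hf⟩
    | succ k ih =>
      intro f hf
      obtain ⟨s, hs, h0, hk⟩ := hS (M - (k + 1 : ℕ)) (by push_cast; omega)
      have hs1 := coeff_order_ne_zero h0
      have hs2 := mem_ordGE_order s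
      rw [hk] at hs1 hs2
      let z := f.coeff (M - (k + 1 : ℕ)) / s.coeff (M - (k + 1 : ℕ))
      have h2 : f - z • s ∈ ordGE (M - (k + 1 : ℕ) + 1) := by
        refine mem_ordGE_succ (sub_mem hf (Submodule.smul_mem _ _ hs2)) ?_
        rw [HahnSeries.coeff_sub, HahnSeries.coeff_smul, smul_eq_mul, div_mul_cancel₀ _ hs1,
          sub_self]
      rw [show M - ((k + 1 : ℕ) : ℤ) + 1 = M - k by push_cast; ring] at h2
      obtain ⟨s', hs', h3⟩ := ih _ h2
      exact ⟨z • s + s', add_mem (Submodule.smul_mem _ _ hs) hs', by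
        rwa [← sub_sub]⟩
  obtain ⟨M', hM'⟩ := exists_mem_ordGE f
  exact h1 (M - M').toNat f (ordGE_anti (by omega) hM')

variable {y : (LaurentSeries ℂ)ˣ}

theorem unit_order_zpow (hy : (y : LaurentSeries ℂ).order = -1) (n : ℤ) :
    ((y ^ n : (LaurentSeries ℂ)ˣ) : LaurentSeries ℂ).order = -n := by
  rw [Units.val_zpow_eq_zpow_val, order_zpow y.ne_zero, hy]
  ring

theorem laurentEval_mem_ordGE (hy : (y : LaurentSeries ℂ).order = -1) {N : ℤ} {f : ℂ[T;T⁻¹]}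
    (hf : f ∈ laurentBounded N) : laurentEval y f ∈ ordGE (-N) := by
  have : laurentBounded N ≤ (ordGE (-N)).comap (laurentEval y).toLinearMap := by
    refine Submodule.span_le.2 ?_
    rintro _ ⟨m, hm, rfl⟩
    change laurentEval y _ ∈ ordGE (-N)
    rw [laurentEval_T]
    refine ordGE_anti (neg_le_neg hm) ?_
    rw [← unit_order_zpow hy]
    exact mem_ordGE_order _
  exact this hf

/-- The powers `y ^ n` have distinct orders `-n`, so the image of the top term cannot cancel; terms
of degree above `N` are removed one at a time, from the top. -/
theorem mem_laurentBounded_of_laurentEval (hy : (y : LaurentSeries ℂ).order = -1) {N : ℤ}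
    {f : ℂ[T;T⁻¹]} (hf : laurentEval y f ∈ ordGE (-N)) : f ∈ laurentBounded N := by
  have h1 : ∀ k : ℕ, f ∈ laurentBounded (N + k) → f ∈ laurentBounded N := by
    intro k
    induction k with
    | zero => intro h; simpa using h
    | succ k ih =>
      intro h
      apply ih
      set n : ℤ := N + (k + 1 : ℕ) with hn
      have h2 : f - f.coeff n • LaurentPolynomial.T n ∈ laurentBounded (N + k) := by
        rw [mem_laurentBounded] at h ⊢
        intro j hj
        rcases eq_or_ne n j with rfl | h3
        · simp [AddMonoidAlgebra.coeff_sub]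
        · simp [AddMonoidAlgebra.coeff_sub, h3, h j (by push_cast at hn; omega)]
      have h3 := laurentEval_mem_ordGE hy h2
      rw [map_sub, map_smul, laurentEval_T] at h3
      have h4 := h3 (-n) (by push_cast at hn; omega)
      rw [HahnSeries.coeff_sub, HahnSeries.coeff_smul, hf (-n) (by push_cast at hn; omega),
        zero_sub, neg_eq_zero, smul_eq_zero] at h4
      have h5 := coeff_order_ne_zero (y ^ n).ne_zero
      rw [unit_order_zpow hy] at h5
      have h6 := h4.resolve_right h5
      rwa [h6, zero_smul, sub_zero] at h2
  obtain ⟨N', hN'⟩ := laurent_mem_bounded f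
  refine h1 (N' - N).toNat (mem_laurentBounded.2 fun k hk => mem_laurentBounded.1 hN' k ?_)
  omega

end Order

/-! ### The common completion `ℂ((x⁻¹)) × ℂ[x]/(c)` -/

section PoleVariable

/-- The variable `x` as a Laurent series in `x⁻¹`. -/
def invVar : LaurentSeries ℂ := HahnSeries.single (-1) 1

theorem aeval_invVar_monomial (n : ℕ) (a : ℂ) :
    Polynomial.aeval invVar (Polynomial.monomial n a) = HahnSeries.single (-(n : ℤ)) a := by
  rw [Polynomial.aeval_monomial, invVar, HahnSeries.single_pow, ← Algebra.smul_def]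
  ext k
  simp [HahnSeries.coeff_single]

theorem coeff_aeval_invVar (f : Polynomial ℂ) (k : ℤ) :
    (Polynomial.aeval invVar f).coeff k = if k ≤ 0 then f.coeff (-k).toNat else 0 := by
  induction f using Polynomial.induction_on' with
  | add p q hp hq =>
    rw [map_add, HahnSeries.coeff_add, hp, hq]
    split_ifs <;> simp
  | monomial n a =>
    rw [aeval_invVar_monomial, HahnSeries.coeff_single, Polynomial.coeff_monomial]
    split_ifs <;> first | rfl | omega

theorem eq_zero_of_aeval_mem_ordGE {f : Polynomial ℂ}
    (hf : Polynomial.aeval invVar f ∈ ordGE 1) : f = 0 := by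
  ext n
  have h := hf (-(n : ℤ)) (by omega)
  rw [coeff_aeval_invVar, if_pos (by omega)] at h
  simpa using h

theorem coeff_one_aeval_invVar (f : Polynomial ℂ) : (Polynomial.aeval invVar f).coeff 1 = 0 := by
  rw [coeff_aeval_invVar, if_neg (by omega)]

theorem aeval_invVar_injective : Function.Injective (Polynomial.aeval (R := ℂ) invVar) := by
  rw [injective_iff_map_eq_zero]
  intro f hf
  exact eq_zero_of_aeval_mem_ordGE (by rw [hf]; exact zero_mem _)

theorem order_invVar : invVar.order = -1 := HahnSeries.order_single one_ne_zero

theorem exists_sub_aeval_mem (f : LaurentSeries ℂ) :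
    ∃ p : Polynomial ℂ, f - Polynomial.aeval invVar p ∈ ordGE 1 := by
  obtain ⟨_, ⟨p, rfl⟩, hp⟩ := exists_sub_mem_ordGE
    (LinearMap.range (Polynomial.aeval (R := ℂ) invVar).toLinearMap) 1 (fun k hk => by
      refine ⟨_, ⟨Polynomial.monomial (-k).toNat 1, rfl⟩, ?_, ?_⟩
      · change Polynomial.aeval invVar _ ≠ 0
        rw [aeval_invVar_monomial]
        exact HahnSeries.single_ne_zero one_ne_zero
      · change (Polynomial.aeval invVar _).order = _
        rw [aeval_invVar_monomial, HahnSeries.order_single one_ne_zero]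
        omega) f
  exact ⟨p, hp⟩

end PoleVariable

section PoleCompletion

variable (c : Polynomial ℂ)

/-- The denominator as a Laurent series in `x⁻¹`. -/
def denom : LaurentSeries ℂ := Polynomial.aeval invVar c

/-- The algebra `ℂ((x⁻¹)) × ℂ[x]/(c)`. -/
abbrev PoleAlgebra : Type := LaurentSeries ℂ × AdjoinRoot c

/-- The embedding of the polynomials into `ℂ((x⁻¹)) × ℂ[x]/(c)`. -/
def poleEmb : Polynomial ℂ →ₐ[ℂ] PoleAlgebra c :=
  (Polynomial.aeval invVar).prod (AdjoinRoot.mkₐ c)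

theorem poleEmb_fst (f : Polynomial ℂ) : (poleEmb c f).1 = Polynomial.aeval invVar f := rfl

theorem poleEmb_snd (f : Polynomial ℂ) : (poleEmb c f).2 = AdjoinRoot.mk c f := rfl

/-- The subspace of all `(c h, 0)`, where `h` has negative degree in `x`. -/
def polePart : Submodule ℂ (PoleAlgebra c) :=
  (ordGE 1).map (LinearMap.inl ℂ (LaurentSeries ℂ) (AdjoinRoot c) ∘ₗ LinearMap.mulLeft ℂ (denom c))

/-- The linear functional `f ↦ Res (f / c)` on `ℂ((x⁻¹))`. -/
def residueInf : LaurentSeries ℂ →ₗ[ℂ] ℂ where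
  toFun f := ((denom c)⁻¹ * f).coeff 1
  map_add' f f' := by rw [mul_add, HahnSeries.coeff_add]
  map_smul' z f := by rw [mul_smul_comm, HahnSeries.coeff_smul]; rfl

variable {c} (hc : c ≠ 0)
include hc

theorem denom_ne_zero : denom c ≠ 0 := fun h =>
  hc (aeval_invVar_injective (h.trans (map_zero _).symm))

theorem residueInf_denom_mul (f : LaurentSeries ℂ) : residueInf c (denom c * f) = f.coeff 1 := by
  change ((denom c)⁻¹ * (denom c * f)).coeff 1 = _
  rw [inv_mul_cancel_left₀ (denom_ne_zero hc)]

/-- Well defined modulo `c`: the residue of `c f' / c = f'` at infinity vanishes for a polynomial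
`f'`. -/
theorem exists_residueRoot : ∃ l : AdjoinRoot c →ₗ[ℂ] ℂ, ∀ f,
    l (AdjoinRoot.mk c f) = residueInf c (Polynomial.aeval invVar f) := by
  have h1 : LinearMap.ker (AdjoinRoot.mkₐ c).toLinearMap ≤
      LinearMap.ker (residueInf c ∘ₗ (Polynomial.aeval invVar).toLinearMap) := by
    intro f hf
    obtain ⟨f', rfl⟩ := AdjoinRoot.mk_eq_zero.1 (show AdjoinRoot.mk c f = 0 from hf)
    change residueInf c (Polynomial.aeval invVar (c * f')) = 0
    rw [map_mul]
    exact (residueInf_denom_mul hc _).trans (coeff_one_aeval_invVar f')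
  have h2 : LinearMap.range (AdjoinRoot.mkₐ c).toLinearMap = ⊤ :=
    LinearMap.range_eq_top.2 AdjoinRoot.mk_surjective
  refine ⟨(Submodule.liftQ _ _ h1) ∘ₗ
    ((AdjoinRoot.mkₐ c).toLinearMap.quotKerEquivOfSurjective AdjoinRoot.mk_surjective).symm.toLinearMap,
    fun f => ?_⟩
  have h3 : ((AdjoinRoot.mkₐ c).toLinearMap.quotKerEquivOfSurjective
      AdjoinRoot.mk_surjective).symm (AdjoinRoot.mk c f) = Submodule.Quotient.mk f := by
    rw [LinearEquiv.symm_apply_eq]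
    rfl
  rw [LinearMap.comp_apply]
  erw [h3]
  rfl

/-- The sum of the residues at the zeros of `c`, up to the sign. -/
def residueRoot : AdjoinRoot c →ₗ[ℂ] ℂ := (exists_residueRoot hc).choose

theorem residueRoot_mk (f : Polynomial ℂ) :
    residueRoot hc (AdjoinRoot.mk c f) = residueInf c (Polynomial.aeval invVar f) :=
  (exists_residueRoot hc).choose_spec f

/-- Given `(f, b)`, lift `b` to a polynomial `p` and divide `f - p` by `c`; the polynomial part `p'`
of the quotient changes the lift to `p + c p'`. Conversely, a polynomial in `polePart` is `c f'`
with `f'` of negative degree, so it is zero. -/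
theorem isCompl_polePart : IsCompl (LinearMap.range (poleEmb c).toLinearMap) (polePart c) := by
  constructor
  · rw [Submodule.disjoint_def]
    rintro _ ⟨f, rfl⟩ ⟨h, hh, h1⟩
    have h2 : denom c * h = Polynomial.aeval invVar f := congrArg Prod.fst h1
    have h3 : (0 : AdjoinRoot c) = AdjoinRoot.mk c f := congrArg Prod.snd h1
    obtain ⟨f', rfl⟩ := AdjoinRoot.mk_eq_zero.1 h3.symm
    rw [map_mul] at h2
    have h4 := mul_left_cancel₀ (denom_ne_zero hc) h2
    rw [SetLike.mem_coe, h4] at hh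
    rw [eq_zero_of_aeval_mem_ordGE hh, mul_zero, map_zero]
  · rw [codisjoint_iff, eq_top_iff]
    rintro ⟨f, b⟩ -
    obtain ⟨p, rfl⟩ := AdjoinRoot.mk_surjective b
    obtain ⟨p', hp'⟩ := exists_sub_aeval_mem ((denom c)⁻¹ * (f - Polynomial.aeval invVar p))
    refine Submodule.mem_sup.2 ⟨_, ⟨p + c * p', rfl⟩, _, ⟨_, hp', rfl⟩, ?_⟩
    refine Prod.ext ?_ ?_
    · change Polynomial.aeval invVar (p + c * p') + denom c * (_ - _) = f
      rw [mul_sub, mul_inv_cancel_left₀ (denom_ne_zero hc), map_add, map_mul]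
      change _ + denom c * _ + _ = _
      ring
    · change AdjoinRoot.mk c (p + c * p') + 0 = AdjoinRoot.mk c p
      simp

/-- The projection to the polynomials along `polePart`. -/
theorem exists_poleProj : ∃ π : PoleAlgebra c →ₗ[ℂ] Polynomial ℂ,
    (∀ f, π (poleEmb c f) = f) ∧ ∀ v ∈ polePart c, π v = 0 := by
  have h1 : Function.Injective (poleEmb c).toLinearMap := fun f f' h =>
    aeval_invVar_injective (congrArg Prod.fst h)
  let e := LinearEquiv.ofInjective (poleEmb c).toLinearMap h1
  refine ⟨e.symm.toLinearMap ∘ₗ Submodule.projectionOnto _ _ (isCompl_polePart hc),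
    fun f => ?_, fun v hv => ?_⟩
  · have h2 := Submodule.projectionOnto_apply_left (isCompl_polePart hc) (e f)
    have h3 : ((e f : LinearMap.range (poleEmb c).toLinearMap) : PoleAlgebra c) = poleEmb c f := rfl
    rw [h3] at h2
    rw [LinearMap.comp_apply, h2]
    exact e.symm_apply_apply f
  · rw [LinearMap.comp_apply, Submodule.projectionOnto_apply_eq_zero_iff _ |>.2 hv, map_zero]

/-- The subspace of all `(h, 0)` with `h` of degree at most `-M`. -/
def poleNhd (c : Polynomial ℂ) (M : ℤ) : Submodule ℂ (PoleAlgebra c) := (ordGE M).prod ⊥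

theorem exists_poleNhd_le : ∃ M, poleNhd c M ≤ polePart c := by
  obtain ⟨M, hM⟩ := exists_mem_ordGE (denom c)⁻¹
  refine ⟨1 - M, fun v hv => ?_⟩
  refine ⟨(denom c)⁻¹ * v.1, ?_, ?_⟩
  · have := mul_mem_ordGE hM hv.1
    rwa [add_sub_cancel] at this
  · refine Prod.ext ?_ ?_
    · exact mul_inv_cancel_left₀ (denom_ne_zero hc) v.1
    · exact ((Submodule.mem_bot ℂ).1 hv.2).symm

/-- The completion `ℂ((x⁻¹)) × ℂ[x]/(c)` with the trace that is the sum of residues of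
`f dx / c`. -/
def poleCompletion : Completion (PoleAlgebra c) where
  trace := residueInf c ∘ₗ LinearMap.fst ℂ _ _ - residueRoot hc ∘ₗ LinearMap.snd ℂ _ _
  emb := poleEmb c
  nhd := poleNhd c
  pr := (exists_poleProj hc).choose
  pr_emb := (exists_poleProj hc).choose_spec.1
  trace_emb f := by
    change residueInf c (Polynomial.aeval invVar f) - residueRoot hc (AdjoinRoot.mk c f) = 0
    rw [residueRoot_mk, sub_self]
  anti := fun _ _ h => Submodule.prod_mono (ordGE_anti h) le_rfl
  perp r := by
    obtain ⟨M, hM⟩ := exists_mem_ordGE (denom c)⁻¹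
    obtain ⟨M', hM'⟩ := exists_mem_ordGE r.1
    -- With this bound `a r / c` has order at least 2, so its coefficient of index 1, the residue,
    -- vanishes.
    refine ⟨2 - M - M', fun a ha => ?_⟩
    have h1 : (a * r).2 = 0 := by
      rw [Prod.snd_mul, (Submodule.mem_bot ℂ).1 ha.2, zero_mul]
    change residueInf c (a.1 * r.1) - residueRoot hc (a * r).2 = 0
    rw [h1, map_zero, sub_zero]
    exact mul_mem_ordGE hM (mul_mem_ordGE ha.1 hM') 1 (by omega)
  pr_nhd := by
    obtain ⟨M, hM⟩ := exists_poleNhd_le hc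
    exact ⟨M, fun a ha => (exists_poleProj hc).choose_spec.2 a (hM ha)⟩

theorem poleCompletion_trace_fst (f : LaurentSeries ℂ) :
    (poleCompletion hc).trace (f, 0) = residueInf c f := by
  change residueInf c f - residueRoot hc 0 = _
  rw [map_zero, sub_zero]

theorem poleCompletion_pr {f : LaurentSeries ℂ} (hf : f ∈ ordGE 1) :
    (poleCompletion hc).pr (denom c * f, 0) = 0 :=
  (exists_poleProj hc).choose_spec.2 _ ⟨f, hf, rfl⟩

end PoleCompletion

/-! ### Standard doubles as dense subalgebras of the completion -/

section PoleModel

variable {A : Type} [CommRing A] [Algebra ℂ A] {d : DoubleData A} {c' : Polynomial ℂ} {u : ℕ → A}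
  {c : Polynomial ℂ}

/-- A homomorphism of a standard double to `ℂ((x⁻¹)) × ℂ[x]/(c)`. -/
structure IsPoleHom (d : DoubleData A) (u : ℕ → A) (c : Polynomial ℂ) (hom : A →ₐ[ℂ] PoleAlgebra c)
    (subst : Polynomial ℂ ≃ₐ[ℂ] Polynomial ℂ) (y : (LaurentSeries ℂ)ˣ) (κ : ℂ) : Prop where
  order_y : (y : LaurentSeries ℂ).order = -1
  hom_emb : ∀ f, hom (d.emb f) = poleEmb c (subst f)
  hom_fst : ∀ a, (hom a).1 = laurentEval y (d.proj a)
  hom_u : ∀ n : ℕ, hom (u n) = κ • (denom c * ↑(y ^ (-(n : ℤ) - 1)), 0)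

variable {hom : A →ₐ[ℂ] PoleAlgebra c} {subst : Polynomial ℂ ≃ₐ[ℂ] Polynomial ℂ}
  {y : (LaurentSeries ℂ)ˣ} {κ : ℂ}

theorem IsPoleHom.mem_ordGE (hm : IsPoleHom d u c hom subst y κ) (n : ℕ) :
    ((y ^ (-(n : ℤ) - 1) : (LaurentSeries ℂ)ˣ) : LaurentSeries ℂ) ∈ ordGE (n + 1) := by
  have h := mem_ordGE_order ((y ^ (-(n : ℤ) - 1) : (LaurentSeries ℂ)ˣ) : LaurentSeries ℂ)
  rw [unit_order_zpow hm.order_y] at h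
  rwa [show -(-(n : ℤ) - 1) = n + 1 by ring] at h

/-- The powers `y^{-n-1}` have negative degree, so the reference complement lands in `polePart c`
whatever affine coordinate `y` is used. -/
theorem IsPoleHom.pr_u (hc : c ≠ 0) (hm : IsPoleHom d u c hom subst y κ) (n : ℕ) :
    (poleCompletion hc).pr (hom (u n)) = 0 := by
  rw [hm.hom_u, map_smul, poleCompletion_pr hc, smul_zero]
  exact ordGE_anti (by omega) (hm.mem_ordGE n)

/-- Compare on the spanning set: polynomials have trace zero on both sides, and among the `u n` only
`u 0` contributes, with the coefficient of `y⁻¹` at `x⁻¹`. -/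
theorem IsPoleHom.trace_hom (hc : c ≠ 0) (hd : d.IsStandard c' u)
    (hm : IsPoleHom d u c hom subst y κ) (a : A) :
    (poleCompletion hc).trace (hom a) =
      κ * ((y⁻¹ : (LaurentSeries ℂ)ˣ) : LaurentSeries ℂ).coeff 1 * d.trace a := by
  have h1 : LinearMap.range d.emb.toLinearMap ⊔ Submodule.span ℂ (Set.range u) ≤
      LinearMap.ker ((poleCompletion hc).trace ∘ₗ hom.toLinearMap -
        (κ * ((y⁻¹ : (LaurentSeries ℂ)ˣ) : LaurentSeries ℂ).coeff 1) • d.trace) := by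
    refine sup_le ?_ (Submodule.span_le.2 ?_)
    · rintro _ ⟨f, rfl⟩
      change (poleCompletion hc).trace (hom (d.emb f)) - _ * d.trace (d.emb f) = 0
      rw [hm.hom_emb, hd.trace_emb, mul_zero, sub_zero]
      exact (poleCompletion hc).trace_emb _
    · rintro _ ⟨n, rfl⟩
      change (poleCompletion hc).trace (hom (u n)) - _ * d.trace (u n) = 0
      rw [hm.hom_u, map_smul, poleCompletion_trace_fst, residueInf_denom_mul hc]
      have h2 := hd.trace_X_pow_mul_u 0 n
      rw [pow_zero, map_one, one_mul] at h2
      rw [h2]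
      rcases n with _ | n
      · simp
      · rw [hm.mem_ordGE (n + 1) 1 (by push_cast; omega)]
        simp
  have h2 := h1 (x := a) (by rw [hd.span]; trivial)
  exact sub_eq_zero.1 h2

/-- The homomorphism of a standard double to `ℂ((x⁻¹)) × ℂ[x]/(c)` as a model. -/
def IsPoleHom.model (hc : c ≠ 0) (hd : d.IsStandard c' u)
    (hm : IsPoleHom d u c hom subst y κ) (hκ : κ ≠ 0) : Model d (poleCompletion hc) where
  hom := hom
  subst := subst
  scalar := κ * ((y⁻¹ : (LaurentSeries ℂ)ˣ) : LaurentSeries ℂ).coeff 1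
  scalar_ne := by
    refine mul_ne_zero hκ ?_
    have h := coeff_order_ne_zero (y ^ (-1 : ℤ)).ne_zero
    rw [unit_order_zpow hm.order_y] at h
    simpa using h
  trace_hom := hm.trace_hom hc hd
  hom_emb := hm.hom_emb
  dense := by
    rintro M ⟨f, b⟩
    obtain ⟨p, rfl⟩ := AdjoinRoot.mk_surjective b
    have h1 : ∀ k < M, ∃ s ∈ (LinearMap.range hom.toLinearMap).comap
        (LinearMap.inl ℂ (LaurentSeries ℂ) (AdjoinRoot c)), s ≠ 0 ∧ s.order = k := by
      intro k _
      -- Multiples of `c` among the polynomials provide the orders `n ≤ 0`, the elements `u n` the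
      -- positive ones; both have second component zero.
      have h2 : ∀ n : ℤ, ∃ a, ∃ s : LaurentSeries ℂ, s ≠ 0 ∧ s.order = n ∧
          hom a = (denom c * s, 0) := by
        intro n
        rcases le_or_gt n 0 with hn | hn
        · refine ⟨d.emb (subst.symm (c * Polynomial.X ^ (-n).toNat)),
            HahnSeries.single n 1, HahnSeries.single_ne_zero one_ne_zero,
            HahnSeries.order_single one_ne_zero, ?_⟩
          rw [hm.hom_emb, AlgEquiv.apply_symm_apply]
          refine Prod.ext ?_ ?_
          · rw [poleEmb_fst, map_mul, Polynomial.X_pow_eq_monomial, aeval_invVar_monomial]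
            rw [show -((-n).toNat : ℤ) = n by omega]
            rfl
          · rw [poleEmb_snd, map_mul, AdjoinRoot.mk_self, zero_mul]
        · refine ⟨κ⁻¹ • u (n - 1).toNat, ↑(y ^ (-n)), (y ^ (-n)).ne_zero, ?_, ?_⟩
          · rw [unit_order_zpow hm.order_y, neg_neg]
          · rw [map_smul, hm.hom_u, smul_smul, inv_mul_cancel₀ hκ, one_smul]
            congr 4
            omega
      obtain ⟨a, s, hs, hs', ha⟩ := h2 (k - (denom c).order)
      refine ⟨denom c * s, ⟨a, ha⟩, mul_ne_zero (denom_ne_zero hc) hs, ?_⟩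
      rw [HahnSeries.order_mul (denom_ne_zero hc) hs, hs']
      ring
    obtain ⟨s, ⟨a, ha⟩, hs⟩ := exists_sub_mem_ordGE _ M h1 (f - Polynomial.aeval invVar p)
    have ha' : hom a = (s, 0) := ha
    refine ⟨d.emb (subst.symm p) + a, ?_⟩
    rw [map_add, hm.hom_emb, AlgEquiv.apply_symm_apply, ha']
    refine ⟨?_, ?_⟩
    · change f - (Polynomial.aeval invVar p + s) ∈ ordGE M
      rwa [← sub_sub]
    · change AdjoinRoot.mk c p - (AdjoinRoot.mk c p + 0) ∈ (⊥ : Submodule ℂ _)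
      simp
  perp_of_bounded N := by
    obtain ⟨M, hM⟩ := exists_mem_ordGE (denom c)⁻¹
    -- Again the integrand gets order at least 2, as `hom a` has order at least `-N`.
    refine ⟨2 - M + N, fun a ha b hb => ?_⟩
    have h1 : b * hom a = (b.1 * laurentEval y (d.proj a), 0) := by
      refine Prod.ext ?_ ?_
      · rw [Prod.fst_mul, hm.hom_fst]
      · rw [Prod.snd_mul, (Submodule.mem_bot ℂ).1 hb.2, zero_mul]
    rw [h1, poleCompletion_trace_fst]
    exact mul_mem_ordGE hM (mul_mem_ordGE hb.1 (laurentEval_mem_ordGE hm.order_y ha)) 1 (by omega)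
  bounded_of_perp M := by
    obtain ⟨M', hM'⟩ := exists_mem_ordGE (denom c)
    refine ⟨-(M' + (2 - M)), fun a ha => ?_⟩
    refine mem_laurentBounded_of_laurentEval hm.order_y ?_
    rw [neg_neg, ← mul_inv_cancel_left₀ (denom_ne_zero hc) (laurentEval y (d.proj a))]
    refine mul_mem_ordGE hM' fun k hk => ?_
    -- Testing against `x^{k-1}` extracts the coefficient of index `k` of `hom a / c`; the test
    -- element is allowed since `k < 2 - M` means `1 - k ≥ M`.
    have h1 := ha (HahnSeries.single (1 - k) 1, 0)
      ⟨fun j hj => HahnSeries.coeff_single_of_ne (by omega), Submodule.zero_mem _⟩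
    have h2 : ((HahnSeries.single (1 - k) (1 : ℂ), 0) : PoleAlgebra c) * hom a =
        (HahnSeries.single (1 - k) 1 * laurentEval y (d.proj a), 0) := by
      refine Prod.ext ?_ ?_
      · rw [Prod.fst_mul, hm.hom_fst]
      · rw [Prod.snd_mul, zero_mul]
    rw [h2, poleCompletion_trace_fst] at h1
    change ((denom c)⁻¹ * (HahnSeries.single (1 - k) 1 * _)).coeff 1 = 0 at h1
    rw [mul_left_comm, HahnSeries.coeff_single_mul, one_mul, sub_sub_cancel] at h1
    exact h1

end PoleModel

/-! ### Transport of the polynomial part between a double and its completion -/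

section Transfer

variable {M N M' N' : Type*} [AddCommGroup M] [Module ℂ M] [AddCommGroup N] [Module ℂ N]
  [AddCommGroup M'] [Module ℂ M'] [AddCommGroup N'] [Module ℂ N']

theorem leftContract_map (φ : M' →ₗ[ℂ] ℂ) (f : M →ₗ[ℂ] M') (f' : N →ₗ[ℂ] N') (Q : M ⊗[ℂ] N) :
    leftContract φ (TensorProduct.map f f' Q) = f' (leftContract (φ ∘ₗ f) Q) := by
  induction Q with
  | zero => simp
  | add Q Q' h h' => simp only [map_add, h, h']
  | tmul x y => simp

end Transfer

namespace Model

variable {A R : Type} [CommRing A] [Algebra ℂ A] [CommRing R] [Algebra ℂ R]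
  {g : Type*} [LieRing g] [LieAlgebra ℂ g] {h : Completion R} {d : DoubleData A} (m : Model d h)

/-- The projection of a double to the polynomials which is induced by a model. -/
def proj : A →ₗ[ℂ] Polynomial ℂ :=
  m.subst.symm.toLinearMap ∘ₗ h.pr ∘ₗ m.hom.toLinearMap

theorem proj_apply (a : A) : m.proj a = m.subst.symm (h.pr (m.hom a)) := rfl

theorem proj_emb (f : Polynomial ℂ) : m.proj (d.emb f) = f := by
  rw [proj_apply, m.hom_emb, h.pr_emb, AlgEquiv.symm_apply_apply]

/-- The action of the substitution on `𝔤[x] ⊗ 𝔤[y]`. -/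
def mapTwo (τ : Polynomial ℂ →ₐ[ℂ] Polynomial ℂ) :
    (Polynomial ℂ ⊗[ℂ] g) ⊗[ℂ] (Polynomial ℂ ⊗[ℂ] g) →ₗ[ℂ]
      (Polynomial ℂ ⊗[ℂ] g) ⊗[ℂ] (Polynomial ℂ ⊗[ℂ] g) :=
  TensorProduct.map (tensorMap g τ) (tensorMap g τ)

theorem rTensor_proj (w : A ⊗[ℂ] g) : LinearMap.rTensor g m.proj w =
    tensorMap g m.subst.symm.toAlgHom (LinearMap.rTensor g h.pr (tensorMap g m.hom w)) := by
  induction w with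
  | zero => simp
  | add u v hu hv => simp only [map_add, hu, hv]
  | tmul a x => rfl

theorem rTensor_pr_hom (w : A ⊗[ℂ] g) : LinearMap.rTensor g h.pr (tensorMap g m.hom w) =
    tensorMap g m.subst.toAlgHom (LinearMap.rTensor g m.proj w) := by
  rw [rTensor_proj, tensorMap_subst_symm]

theorem pairing_hom (w : A ⊗[ℂ] g) :
    pairing h.emb h.trace (tensorMap g m.hom w) ∘ₗ tensorMap g m.subst.toAlgHom =
      m.scalar • pairing d.emb d.trace w := by
  refine LinearMap.ext fun q => ?_
  rw [LinearMap.comp_apply, pairing_apply, ← m.tensorMap_hom_emb, m.form_hom]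
  rfl

theorem pairing_symm (w : A ⊗[ℂ] g) :
    m.scalar • pairing d.emb d.trace w ∘ₗ tensorMap g m.subst.symm.toAlgHom =
      pairing h.emb h.trace (tensorMap g m.hom w) := by
  refine LinearMap.ext fun q => ?_
  rw [← LinearMap.smul_comp, ← m.pairing_hom, LinearMap.comp_apply, LinearMap.comp_apply,
    m.tensorMap_subst_symm]

/-- The scalar enters because `Q` is contracted with the form, which the model rescales, while the
polynomial component is not rescaled. -/
theorem represents_comap {V : Submodule ℂ (R ⊗[ℂ] g)}
    {Q : (Polynomial ℂ ⊗[ℂ] g) ⊗[ℂ] (Polynomial ℂ ⊗[ℂ] g)}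
    (hQ : Represents h.emb h.trace h.pr V Q) :
    Represents d.emb d.trace m.proj (V.comap (tensorMap g m.hom))
      (m.scalar • mapTwo m.subst.symm.toAlgHom Q) := by
  intro w hw
  rw [rTensor_proj, hQ _ hw, map_smul, mapTwo, leftContract_map, ← m.pairing_symm,
    leftContract_smul, map_smul]

theorem _root_.CurrentLie.Completion.exists_contract_eq_zero (h : Completion R)
    (Q : (Polynomial ℂ ⊗[ℂ] g) ⊗[ℂ] (Polynomial ℂ ⊗[ℂ] g)) :
    ∃ M, ∀ o ∈ tensorSub g (h.nhd M), leftContract (pairing h.emb h.trace o) Q = 0 := by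
  induction Q with
  | zero => exact ⟨0, by simp⟩
  | add Q Q' hQ hQ' =>
    obtain ⟨M, hM⟩ := hQ
    obtain ⟨M', hM'⟩ := hQ'
    refine ⟨max M M', fun o ho => ?_⟩
    rw [map_add, hM o (tensorSub_mono (h.anti (le_max_left _ _)) ho),
      hM' o (tensorSub_mono (h.anti (le_max_right _ _)) ho), add_zero]
  | tmul q q' =>
    obtain ⟨M, hM⟩ := h.exists_perp (tensorMap g h.emb q)
    refine ⟨M, fun o ho => ?_⟩
    rw [leftContract_tmul, pairing_apply, tensorForm_comm, hM o ho, zero_smul]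

/-- An element of the closure differs from the image of some `w ∈ W` by an error so small that both
the projection to polynomials and the contraction with the fixed tensor kill it. -/
theorem represents_closure {W : Submodule ℂ (A ⊗[ℂ] g)} (hW : d.IsTransversalLagrangian W)
    {Q : (Polynomial ℂ ⊗[ℂ] g) ⊗[ℂ] (Polynomial ℂ ⊗[ℂ] g)}
    (hQ : Represents d.emb d.trace m.proj W Q) :
    Represents h.emb h.trace h.pr (m.closure W) (m.scalar⁻¹ • mapTwo m.subst.toAlgHom Q) := by
  intro v hv
  obtain ⟨M₀, hM₀⟩ := m.exists_closure_eq hW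
  obtain ⟨M₁, hM₁⟩ := h.exists_contract_eq_zero (m.scalar⁻¹ • mapTwo m.subst.toAlgHom Q)
  obtain ⟨M₂, hM₂⟩ := h.pr_nhd
  obtain ⟨w, hw, ho⟩ := hM₀ (max M₀ (max M₁ M₂)) (le_max_left _ _) v hv
  have h1 := hM₁ _ (tensorSub_mono (h.anti ((le_max_left _ _).trans (le_max_right _ _))) ho)
  have h2 : LinearMap.rTensor g h.pr (v - tensorMap g m.hom w) = 0 := by
    have h3 : tensorSub g (h.nhd M₂) ≤ LinearMap.ker (LinearMap.rTensor g h.pr) :=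
      tensorSub_le fun a ha x => by
        rw [LinearMap.mem_ker, LinearMap.rTensor_tmul, hM₂ a ha, TensorProduct.zero_tmul]
    exact h3 (tensorSub_mono (h.anti ((le_max_right _ _).trans (le_max_right _ _))) ho)
  have h4 : pairing h.emb h.trace v = pairing h.emb h.trace (v - tensorMap g m.hom w) +
      pairing h.emb h.trace (tensorMap g m.hom w) := by
    ext q; simp [pairing]
  rw [h4, leftContract_add, h1, zero_add, map_smul, mapTwo, leftContract_map, m.pairing_hom,
    leftContract_smul, map_smul, inv_smul_smul₀ m.scalar_ne, ← hQ w hw, ← m.rTensor_pr_hom]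
  rw [map_sub, sub_eq_zero] at h2
  exact h2

end Model

/-! ### Affine substitutions -/

section Affine

/-- The substitution `x ↦ p x + q` on polynomials in one variable. -/
def affineOne (p : ℂˣ) (q : ℂ) : Polynomial ℂ ≃ₐ[ℂ] Polynomial ℂ :=
  AlgEquiv.ofAlgHom
    (Polynomial.aeval (Polynomial.C (p : ℂ) * Polynomial.X + Polynomial.C q))
    (Polynomial.aeval (Polynomial.C ((p⁻¹ : ℂˣ) : ℂ) * (Polynomial.X - Polynomial.C q)))
    (by
      ext1
      simp [Polynomial.algebraMap_eq, ← mul_assoc, ← Polynomial.C_mul])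
    (by
      ext1
      simp [Polynomial.algebraMap_eq, ← mul_assoc, ← Polynomial.C_mul])

theorem affineOne_X (p : ℂˣ) (q : ℂ) : affineOne p q Polynomial.X =
    Polynomial.C (p : ℂ) * Polynomial.X + Polynomial.C q := by
  simp [affineOne]

theorem affineOne_symm_X (p : ℂˣ) (q : ℂ) : (affineOne p q).symm Polynomial.X =
    Polynomial.C ((p⁻¹ : ℂˣ) : ℂ) * (Polynomial.X - Polynomial.C q) := by
  simp [affineOne]

theorem affineOne_apply (p : ℂˣ) (q : ℂ) (f : Polynomial ℂ) : affineOne p q f =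
    f.comp (Polynomial.C (p : ℂ) * Polynomial.X + Polynomial.C q) := rfl

theorem affinePoly_X (p : ℂˣ) (q : ℂ) (i : Fin 2) : affinePoly p q (MvPolynomial.X i) =
    MvPolynomial.C (p : ℂ) * MvPolynomial.X i + MvPolynomial.C q :=
  MvPolynomial.aeval_X _ i

theorem affinePoly_aeval_X (p : ℂˣ) (q : ℂ) (i : Fin 2) (f : Polynomial ℂ) :
    affinePoly p q (Polynomial.aeval (MvPolynomial.X i : Poly₂) f) =
      Polynomial.aeval (MvPolynomial.X i : Poly₂) (affineOne p q f) := by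
  have h : ((affinePoly p q).toAlgHom.comp (Polynomial.aeval (MvPolynomial.X i : Poly₂))) =
      (Polynomial.aeval (MvPolynomial.X i : Poly₂)).comp (affineOne p q).toAlgHom := by
    ext1
    simp [affinePoly_X, affineOne_X, MvPolynomial.algebraMap_eq]
  exact DFunLike.congr_fun h f

theorem affineRat_algebraMap (p : ℂˣ) (q : ℂ) (f : Poly₂) :
    affineRat p q (algebraMap Poly₂ Rat₂ f) = algebraMap Poly₂ Rat₂ (affinePoly p q f) :=
  IsFractionRing.algEquivOfAlgEquiv_algebraMap (affinePoly p q) f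

theorem algebraMap_C_mul (z : ℂ) (f : Poly₂) :
    algebraMap Poly₂ Rat₂ (MvPolynomial.C z * f) = z • algebraMap Poly₂ Rat₂ f := by
  rw [map_mul, ← MvPolynomial.algebraMap_eq, ← IsScalarTower.algebraMap_apply ℂ Poly₂ Rat₂,
    Algebra.smul_def]

theorem affineRat_sub (p : ℂˣ) (q : ℂ) : affineRat p q (ry - rx) = (p : ℂ) • (ry - rx) := by
  rw [ry_sub_rx, affineRat_algebraMap, map_sub, affinePoly_X, affinePoly_X, add_sub_add_right_eq_sub,
    ← mul_sub, algebraMap_C_mul]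

variable {g : Type*} [LieRing g] [LieAlgebra ℂ g]

theorem affineSubst_toRat_twoVar (p : ℂˣ) (q : ℂ)
    (Q : (Polynomial ℂ ⊗[ℂ] g) ⊗[ℂ] (Polynomial ℂ ⊗[ℂ] g)) :
    affineSubst p q (toRat g (twoVar Q)) =
      toRat g (twoVar (Model.mapTwo (affineOne p q).toAlgHom Q)) := by
  induction Q with
  | zero => simp
  | add Q Q' h h' => simp only [map_add, h, h']
  | tmul v w =>
    induction v with
    | zero => simp
    | add v v' h h' => simp only [TensorProduct.add_tmul, map_add, h, h']
    | tmul f a =>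
      induction w with
      | zero => simp
      | add w w' h h' => simp only [TensorProduct.tmul_add, map_add, h, h']
      | tmul f' b =>
        simp only [Model.mapTwo, TensorProduct.map_tmul, tensorMap_tmul, twoVar_tmul, toRat_tmul,
          affineSubst, LinearMap.rTensor_tmul, AlgEquiv.toLinearMap_apply, affineRat_algebraMap,
          map_mul, affinePoly_aeval_X]
        rfl

theorem affineSubst_injective (p : ℂˣ) (q : ℂ) :
    Function.Injective (affineSubst (g := g) p q) :=
  Module.Flat.rTensor_preserves_injective_linearMap _ (affineRat p q).injective

variable [FiniteDimensional ℂ g] [LieAlgebra.IsSimple ℂ g]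

/-- The substitution multiplies `y - x` by `p` and turns `c` into `p s c'`, so after division by `s`
the polar part is again of standard form. -/
theorem affineSubst_rationalTensor {p s : ℂˣ} {q : ℂ} {c c' : Polynomial ℂ}
    (hc : affineOne p q c = Polynomial.C ((p : ℂ) * s) * c')
    (Q : (Polynomial ℂ ⊗[ℂ] g) ⊗[ℂ] (Polynomial ℂ ⊗[ℂ] g)) :
    (s : ℂ)⁻¹ • affineSubst p q (rationalTensor c Q) =
      rationalTensor c' ((s : ℂ)⁻¹ • Model.mapTwo (affineOne p q).toAlgHom Q) := by
  rw [rationalTensor, rationalTensor, map_add, smul_add, affineSubst_toRat_twoVar, map_smul,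
    map_smul]
  congr 1
  rw [affineSubst, LinearMap.rTensor_tmul, AlgEquiv.toLinearMap_apply, map_div₀, affineRat_sub,
    affineRat_algebraMap, affinePoly_aeval_X, hc, map_mul, Polynomial.aeval_C,
    MvPolynomial.algebraMap_eq, algebraMap_C_mul, TensorProduct.smul_tmul']
  congr 1
  have h1 := ry_sub_rx_ne_zero
  simp only [Algebra.smul_def, map_mul, map_inv₀]
  have h2 : algebraMap ℂ Rat₂ p ≠ 0 := (map_ne_zero _).2 p.ne_zero
  have h3 : algebraMap ℂ Rat₂ s ≠ 0 := (map_ne_zero _).2 s.ne_zero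
  field_simp

end Affine

/-! ### The doubles of cases A, B and C are standard -/

section Residue

theorem residueTrace_T (n : ℤ) (a : PowerSeries ℂ) (k : ℤ) :
    residueTrace n a (LaurentPolynomial.T k) =
      (HahnSeries.ofPowerSeries ℤ ℂ a).coeff (n - 1 - k) := by
  have h : (AddMonoidAlgebra.coeffLinearEquiv ℂ).toLinearMap
      (LaurentPolynomial.T k : ℂ[T;T⁻¹]) = Finsupp.single k (1 : ℂ) := rfl
  rw [residueTrace, LinearMap.comp_apply, h, Finsupp.linearCombination_single, one_smul]

theorem ofPowerSeries_coeff_neg (a : PowerSeries ℂ) {k : ℤ} (hk : k < 0) :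
    (HahnSeries.ofPowerSeries ℤ ℂ a).coeff k = 0 := by
  apply HahnSeries.embDomain_of_notMem_range
  rintro ⟨m, hm⟩
  have : (m : ℤ) = k := hm
  omega

theorem residueTrace_toLaurent_mul_T (n : ℤ) (a : PowerSeries ℂ) (f : Polynomial ℂ) (j : ℤ) :
    residueTrace n a (Polynomial.toLaurent f * LaurentPolynomial.T j) =
      (HahnSeries.ofPowerSeries ℤ ℂ (f * a)).coeff (n - 1 - j) := by
  induction f using Polynomial.induction_on' with
  | add p q hp hq => simp only [map_add, add_mul, Polynomial.coe_add, HahnSeries.coeff_add, hp, hq]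
  | monomial i z =>
    rw [← Polynomial.C_mul_X_pow_eq_monomial, map_mul Polynomial.toLaurent, Polynomial.toLaurent_C,
      Polynomial.toLaurent_X_pow, mul_assoc, ← LaurentPolynomial.T_add,
      ← LaurentPolynomial.smul_eq_C_mul, map_smul, residueTrace_T, Polynomial.coe_mul,
      Polynomial.coe_C, Polynomial.coe_pow, Polynomial.coe_X, mul_assoc, map_mul, map_mul,
      HahnSeries.ofPowerSeries_C, HahnSeries.ofPowerSeries_X_pow, HahnSeries.C_mul_eq_smul,
      HahnSeries.coeff_smul, HahnSeries.coeff_single_mul, one_mul]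
    congr 2
    ring

/-- As `c a = x^n`, the factor `c` cancels the weight of the residue, and a single coefficient of
`f` remains. -/
theorem residueTrace_dual {n : ℕ} {a : PowerSeries ℂ} {c : Polynomial ℂ}
    (hc : (c : PowerSeries ℂ) * a = PowerSeries.X ^ n) (m : ℕ) (f : ℂ[T;T⁻¹]) :
    residueTrace n a (Polynomial.toLaurent c * LaurentPolynomial.T (-(m : ℤ) - 1) * f) =
      f.coeff (m : ℤ) := by
  induction f using LaurentPolynomial.induction_on' with
  | add p q hp hq => simp only [mul_add, map_add, hp, hq, AddMonoidAlgebra.coeff_add,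
      Finsupp.add_apply]
  | C_mul_T k z =>
    rw [← LaurentPolynomial.smul_eq_C_mul, mul_smul_comm, map_smul, mul_assoc,
      ← LaurentPolynomial.T_add, residueTrace_toLaurent_mul_T, hc, HahnSeries.ofPowerSeries_X_pow,
      HahnSeries.coeff_single, AddMonoidAlgebra.coeff_smul, Finsupp.smul_apply,
      LaurentPolynomial.T_apply]
    congr 1
    have : (n : ℤ) - 1 - (-(m : ℤ) - 1 + k) = n ↔ k = m := by omega
    simp only [this]

end Residue

theorem toLaurent_mul_T_mem {S : Submodule ℂ ℂ[T;T⁻¹]} {n : ℤ}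
    (hS : ∀ k ≥ n, LaurentPolynomial.T k ∈ S) (f : Polynomial ℂ) :
    Polynomial.toLaurent f * LaurentPolynomial.T n ∈ S := by
  induction f using Polynomial.induction_on' with
  | add p q hp hq => rw [map_add, add_mul]; exact add_mem hp hq
  | monomial i z =>
    rw [← Polynomial.C_mul_X_pow_eq_monomial, map_mul, Polynomial.toLaurent_C,
      Polynomial.toLaurent_X_pow, mul_assoc, ← LaurentPolynomial.T_add,
      ← LaurentPolynomial.smul_eq_C_mul]
    exact S.smul_mem _ (hS _ (by omega))

/-- A subspace which contains the large powers of `x` and all `c(x) x^{-n}`, where `c(0) = 1`, is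
everything. -/
theorem laurent_submodule_eq_top {S : Submodule ℂ ℂ[T;T⁻¹]} {c : Polynomial ℂ} (hc : c.coeff 0 = 1)
    (N : ℤ) (h1 : ∀ k ≥ N, LaurentPolynomial.T k ∈ S)
    (h2 : ∀ k < N, Polynomial.toLaurent c * LaurentPolynomial.T k ∈ S) : S = ⊤ := by
  have h3 : ∀ m : ℕ, ∀ k ≥ N - m, LaurentPolynomial.T k ∈ S := by
    intro m
    induction m with
    | zero => simpa using h1
    | succ m ih =>
      intro k hk
      rcases lt_or_ge k (N - m) with h | h
      · by_cases h4 : k < N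
        · have h5 := h2 k h4
          -- Since `c = 1 + x c.divX`, the monomial `x^k` differs from `c x^k` by higher powers,
          -- which are in `S` by induction.
          rw [← Polynomial.X_mul_divX_add c, hc, map_add, map_mul, Polynomial.toLaurent_X, map_one,
            map_one, add_mul, one_mul, mul_comm (LaurentPolynomial.T 1), mul_assoc,
            ← LaurentPolynomial.T_add] at h5
          have h6 := toLaurent_mul_T_mem (S := S) (n := 1 + k)
            (fun j hj => ih j (by push_cast at hk; omega)) c.divX
          exact (S.add_mem_iff_right h6).1 h5
        · exact h1 k (not_lt.1 h4)
      · exact ih k h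
  rw [eq_top_iff]
  rintro f -
  induction f using LaurentPolynomial.induction_on' with
  | add p q hp hq => exact add_mem hp hq
  | C_mul_T k z =>
    rw [← LaurentPolynomial.smul_eq_C_mul]
    exact S.smul_mem _ (h3 (N - k).toNat k (by omega))

theorem linearMap_eq_zero_of_X_pow {φ : Polynomial ℂ →ₗ[ℂ] ℂ}
    (h : ∀ n : ℕ, φ (Polynomial.X ^ n) = 0) (f : Polynomial ℂ) : φ f = 0 := by
  induction f using Polynomial.induction_on' with
  | add p q hp hq => rw [map_add, hp, hq, add_zero]
  | monomial n z =>
    rw [← Polynomial.C_mul_X_pow_eq_monomial, ← Polynomial.smul_eq_C_mul, map_smul, h, smul_zero]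

/-- The element `c(x) x^{-n-1}`. -/
def poleTerm (c : Polynomial ℂ) (n : ℕ) : ℂ[T;T⁻¹] :=
  Polynomial.toLaurent c * LaurentPolynomial.T (-(n : ℤ) - 1)

section CaseA

variable {a : PowerSeries ℂ} {c : Polynomial ℂ}

theorem doubleA_isStandard (hc0 : c.coeff 0 = 1) (hc : (c : PowerSeries ℂ) * a = 1) :
    (doubleA a).IsStandard c (poleTerm c) where
  proj_emb _ := rfl
  proj_u _ := rfl
  trace_emb f := by
    refine linearMap_eq_zero_of_X_pow
      (φ := (doubleA a).trace ∘ₗ (doubleA a).emb.toLinearMap) (fun n => ?_) f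
    change residueTrace 0 a (Polynomial.toLaurent (Polynomial.X ^ n)) = 0
    rw [Polynomial.toLaurent_X_pow, residueTrace_T, ofPowerSeries_coeff_neg _ (by omega)]
  trace_u n f := residueTrace_dual (n := 0) (by simpa using hc) n f
  span := by
    refine laurent_submodule_eq_top hc0 0 (fun k hk => ?_) (fun k hk => ?_)
    · refine Submodule.mem_sup_left ⟨Polynomial.X ^ k.toNat, ?_⟩
      change Polynomial.toLaurent (Polynomial.X ^ k.toNat) = _
      rw [Polynomial.toLaurent_X_pow, Int.toNat_of_nonneg hk]
    · refine Submodule.mem_sup_right (Submodule.subset_span ⟨(-k - 1).toNat, ?_⟩)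
      rw [poleTerm]
      congr 2
      omega

end CaseA

section CaseB

variable {b : PowerSeries ℂ} {c : Polynomial ℂ}

theorem doubleB_isStandard (hc0 : c.coeff 0 = 1) (hc : (c : PowerSeries ℂ) * b = 1) :
    (doubleB b).IsStandard (Polynomial.X * c) (fun n => (poleTerm (Polynomial.X * c) n, 0)) where
  proj_emb _ := rfl
  proj_u _ := rfl
  trace_emb f := by
    refine linearMap_eq_zero_of_X_pow
      (φ := (doubleB b).trace ∘ₗ (doubleB b).emb.toLinearMap) (fun n => ?_) f
    change residueTrace 1 b (Polynomial.toLaurent (Polynomial.X ^ n)) -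
      Polynomial.aeval (0 : ℂ) (Polynomial.X ^ n : Polynomial ℂ) = 0
    rw [Polynomial.toLaurent_X_pow, residueTrace_T, map_pow, Polynomial.aeval_X]
    rcases n with _ | n
    · have h : PowerSeries.coeff 0 b = 1 := by
        have h := congrArg PowerSeries.constantCoeff hc
        rw [map_mul, map_one, ← PowerSeries.coeff_zero_eq_constantCoeff_apply,
          ← PowerSeries.coeff_zero_eq_constantCoeff_apply, Polynomial.coeff_coe, hc0,
          one_mul] at h
        exact h
      have h2 : (HahnSeries.ofPowerSeries ℤ ℂ b).coeff ((0 : ℕ) : ℤ) = PowerSeries.coeff 0 b :=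
        HahnSeries.ofPowerSeries_apply_coeff b 0
      rw [pow_zero, show (1 : ℤ) - 1 - (0 : ℕ) = ((0 : ℕ) : ℤ) by norm_num, h2, h, sub_self]
    · rw [ofPowerSeries_coeff_neg _ (by push_cast; omega)]
      simp
  trace_u n f := by
    change residueTrace 1 b (poleTerm (Polynomial.X * c) n * f.1) - 0 * f.2 = _
    rw [zero_mul, sub_zero]
    refine residueTrace_dual (n := 1) ?_ n f.1
    rw [Polynomial.coe_mul, mul_assoc, hc, Polynomial.coe_X, mul_one, pow_one]
  span := by
    set S := LinearMap.range (doubleB b).emb.toLinearMap ⊔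
      Submodule.span ℂ (Set.range fun n => ((poleTerm (Polynomial.X * c) n, 0) : ℂ[T;T⁻¹] × ℂ))
      with hS
    -- The powers `x^k` with `k ≥ 1` vanish at 0 and the other generators are `c x^{-n}`, so all
    -- `(f, 0)` are reached; the element `(1, 1)` then supplies the second summand.
    have h1 : S.comap (LinearMap.inl ℂ ℂ[T;T⁻¹] ℂ) = ⊤ := by
      refine laurent_submodule_eq_top hc0 1 (fun k hk => ?_) (fun k hk => ?_)
      · refine Submodule.mem_sup_left ⟨Polynomial.X ^ k.toNat, ?_⟩
        refine Prod.ext ?_ ?_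
        · change Polynomial.toLaurent (Polynomial.X ^ k.toNat) = LaurentPolynomial.T k
          rw [Polynomial.toLaurent_X_pow, Int.toNat_of_nonneg (by omega)]
        · change Polynomial.aeval (0 : ℂ) (Polynomial.X ^ k.toNat : Polynomial ℂ) = 0
          rw [map_pow, Polynomial.aeval_X, zero_pow (by omega)]
      · refine Submodule.mem_sup_right (Submodule.subset_span ⟨(-k).toNat, ?_⟩)
        refine Prod.ext ?_ rfl
        change poleTerm (Polynomial.X * c) (-k).toNat = _
        rw [poleTerm, map_mul, Polynomial.toLaurent_X, mul_comm (LaurentPolynomial.T 1), mul_assoc,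
          ← LaurentPolynomial.T_add]
        congr 2
        omega
    have h2 : ∀ f : ℂ[T;T⁻¹], ((f, 0) : ℂ[T;T⁻¹] × ℂ) ∈ S := fun f => by
      have : f ∈ S.comap (LinearMap.inl ℂ ℂ[T;T⁻¹] ℂ) := by rw [h1]; trivial
      exact this
    have h3 : ((1, 1) : ℂ[T;T⁻¹] × ℂ) ∈ S := Submodule.mem_sup_left ⟨1, map_one (doubleB b).emb⟩
    rw [eq_top_iff]
    rintro ⟨f, z⟩ -
    have h4 : ((f, z) : ℂ[T;T⁻¹] × ℂ) = (f - z • 1, 0) + z • (1, 1) := by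
      refine Prod.ext ?_ ?_ <;> simp
    rw [h4]
    exact add_mem (h2 _) (S.smul_mem _ h3)

end CaseB

theorem doubleC_isStandard :
    doubleC.IsStandard (Polynomial.X ^ 2) (fun n => (poleTerm (Polynomial.X ^ 2) n, 0)) where
  proj_emb _ := rfl
  proj_u _ := rfl
  trace_emb f := by
    refine linearMap_eq_zero_of_X_pow
      (φ := doubleC.trace ∘ₗ doubleC.emb.toLinearMap) (fun n => ?_) f
    change residueTrace 2 1 (Polynomial.toLaurent (Polynomial.X ^ n)) -
      TrivSqZeroExt.snd (Polynomial.aeval (DualNumber.eps : DualNumber ℂ)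
        (Polynomial.X ^ n : Polynomial ℂ)) = 0
    rw [Polynomial.toLaurent_X_pow, residueTrace_T, map_pow, Polynomial.aeval_X, map_one]
    rcases n with _ | _ | n
    · simp [HahnSeries.coeff_one]
    · simp [HahnSeries.coeff_one]
    · rw [add_assoc, pow_add, DualNumber.eps_pow_two, mul_zero, HahnSeries.coeff_one, if_neg (by push_cast; omega)]
      simp
  trace_u n f := by
    change residueTrace 2 1 (poleTerm (Polynomial.X ^ 2) n * f.1) -
      TrivSqZeroExt.snd (0 * f.2) = _
    rw [zero_mul, TrivSqZeroExt.snd_zero, sub_zero]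
    exact residueTrace_dual (n := 2) (by simp) n f.1
  span := by
    set S := LinearMap.range doubleC.emb.toLinearMap ⊔
      Submodule.span ℂ
        (Set.range fun n => ((poleTerm (Polynomial.X ^ 2) n, 0) : ℂ[T;T⁻¹] × DualNumber ℂ))
      with hS
    have h1 : S.comap (LinearMap.inl ℂ ℂ[T;T⁻¹] (DualNumber ℂ)) = ⊤ := by
      -- Here `x² x^{-n-1}` is itself a monomial: `u (1 - k)` is `(x^k, 0)` for `k < 2`, and for `k
      -- ≥ 2` the embedded `x^k` has no component in the dual numbers.
      refine laurent_submodule_eq_top (c := 1) (by simp) 2 (fun k hk => ?_) (fun k hk => ?_)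
      · refine Submodule.mem_sup_left ⟨Polynomial.X ^ k.toNat, ?_⟩
        refine Prod.ext ?_ ?_
        · change Polynomial.toLaurent (Polynomial.X ^ k.toNat) = LaurentPolynomial.T k
          rw [Polynomial.toLaurent_X_pow, Int.toNat_of_nonneg (by omega)]
        · change Polynomial.aeval (DualNumber.eps : DualNumber ℂ)
            (Polynomial.X ^ k.toNat : Polynomial ℂ) = 0
          rw [map_pow, Polynomial.aeval_X,
            show k.toNat = (k - 2).toNat + 2 by omega, pow_add, DualNumber.eps_pow_two, mul_zero]
      · refine Submodule.mem_sup_right (Submodule.subset_span ⟨(1 - k).toNat, ?_⟩)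
        refine Prod.ext ?_ rfl
        change poleTerm (Polynomial.X ^ 2) (1 - k).toNat = _
        rw [poleTerm, Polynomial.toLaurent_X_pow, map_one, one_mul, ← LaurentPolynomial.T_add]
        congr 1
        push_cast
        omega
    have h2 : ∀ f : ℂ[T;T⁻¹], ((f, 0) : ℂ[T;T⁻¹] × DualNumber ℂ) ∈ S := fun f => by
      have : f ∈ S.comap (LinearMap.inl ℂ ℂ[T;T⁻¹] (DualNumber ℂ)) := by rw [h1]; trivial
      exact this
    have h3 : ((1, 1) : ℂ[T;T⁻¹] × DualNumber ℂ) ∈ S :=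
      Submodule.mem_sup_left ⟨1, map_one doubleC.emb⟩
    have h4 : ((LaurentPolynomial.T 1, DualNumber.eps) : ℂ[T;T⁻¹] × DualNumber ℂ) ∈ S := by
      refine Submodule.mem_sup_left ⟨Polynomial.X, ?_⟩
      refine Prod.ext ?_ ?_
      · exact Polynomial.toLaurent_X
      · exact Polynomial.aeval_X _
    rw [eq_top_iff]
    rintro ⟨f, z⟩ -
    have h5 : ((f, z) : ℂ[T;T⁻¹] × DualNumber ℂ) =
        (f - z.fst • 1 - z.snd • LaurentPolynomial.T 1, 0) + z.fst • (1, 1) +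
          z.snd • (LaurentPolynomial.T 1, DualNumber.eps) := by
      refine Prod.ext ?_ ?_
      · simp only [Prod.fst_add, Prod.smul_fst]
        abel
      · ext <;> simp
    rw [h5]
    exact add_mem (add_mem (h2 _) (S.smul_mem _ h3)) (S.smul_mem _ h4)

/-! ### Homomorphisms of the doubles to the common completion -/

section Homs

theorem invVar_ne_zero : invVar ≠ 0 := HahnSeries.single_ne_zero one_ne_zero

/-- The variable `x` as a unit. -/
def invVarUnit : (LaurentSeries ℂ)ˣ := Units.mk0 invVar invVar_ne_zero

theorem coeff_inv_mul_coeff {y : (LaurentSeries ℂ)ˣ} (hy : (y : LaurentSeries ℂ).order = -1) :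
    (y : LaurentSeries ℂ).coeff (-1) * ((y⁻¹ : (LaurentSeries ℂ)ˣ) : LaurentSeries ℂ).coeff 1 = 1 := by
  have h1 := unit_order_zpow hy (-1)
  rw [zpow_neg_one, neg_neg] at h1
  have h2 := HahnSeries.coeff_mul_order_add_order (y : LaurentSeries ℂ)
    ((y⁻¹ : (LaurentSeries ℂ)ˣ) : LaurentSeries ℂ)
  rw [HahnSeries.leadingCoeff_eq, HahnSeries.leadingCoeff_eq, hy, h1, Units.mul_inv] at h2
  rw [← h2]
  simp [HahnSeries.coeff_one]

theorem laurentEval_poleTerm {S : Type*} [CommRing S] [Algebra ℂ S] (y : Sˣ) (c : Polynomial ℂ)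
    (n : ℕ) : laurentEval y (poleTerm c n) = Polynomial.aeval (y : S) c * ↑(y ^ (-(n : ℤ) - 1)) := by
  rw [poleTerm, map_mul, laurentEval_toLaurent, laurentEval_T]

/-- For `c = x` the quotient `ℂ[x]/(x)` is `ℂ`, so the extra summand of the double is exactly the
second factor. -/
theorem doubleB_one_isPoleHom (b : PowerSeries ℂ) :
    ∃ hom, IsPoleHom (doubleB b) (fun n => (poleTerm Polynomial.X n, 0)) Polynomial.X hom
      AlgEquiv.refl invVarUnit 1 := by
  refine ⟨(laurentEval invVarUnit).prodMap (Algebra.ofId ℂ (AdjoinRoot (Polynomial.X : Polynomial ℂ))),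
    order_invVar, fun f => ?_, fun a => rfl, fun n => ?_⟩
  · refine Prod.ext (laurentEval_toLaurent _ f) ?_
    change Algebra.ofId ℂ (AdjoinRoot (Polynomial.X : Polynomial ℂ)) (Polynomial.aeval (0 : ℂ) f) =
      AdjoinRoot.mk Polynomial.X f
    have h : (Algebra.ofId ℂ (AdjoinRoot (Polynomial.X : Polynomial ℂ))).comp
        (Polynomial.aeval (0 : ℂ)) = AdjoinRoot.mkₐ Polynomial.X := by
      ext1
      simp
    exact DFunLike.congr_fun h f
  · refine Prod.ext ?_ ?_
    · change laurentEval invVarUnit (poleTerm Polynomial.X n) = (1 : ℂ) • _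
      rw [laurentEval_poleTerm, one_smul]
      rfl
    · change Algebra.ofId ℂ (AdjoinRoot (Polynomial.X : Polynomial ℂ)) 0 = (1 : ℂ) • 0
      simp

/-- For `c = x²` the second factor is the algebra of dual numbers, with `ε` going to the class of
`x`. -/
theorem doubleC_isPoleHom :
    ∃ hom, IsPoleHom doubleC (fun n => (poleTerm (Polynomial.X ^ 2) n, 0)) (Polynomial.X ^ 2) hom
      AlgEquiv.refl invVarUnit 1 := by
  let R := AdjoinRoot (Polynomial.X ^ 2 : Polynomial ℂ)
  have hroot : (AdjoinRoot.root (Polynomial.X ^ 2 : Polynomial ℂ)) *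
      AdjoinRoot.root (Polynomial.X ^ 2 : Polynomial ℂ) = 0 := by
    rw [← AdjoinRoot.mk_X, ← map_mul, ← pow_two, AdjoinRoot.mk_self]
  let ψ : DualNumber ℂ →ₐ[ℂ] R :=
    DualNumber.lift ⟨(Algebra.ofId ℂ R, AdjoinRoot.root _), hroot, fun r => mul_comm _ _⟩
  refine ⟨(laurentEval invVarUnit).prodMap ψ, order_invVar, fun f => ?_, fun a => rfl, fun n => ?_⟩
  · refine Prod.ext (laurentEval_toLaurent _ f) ?_
    change ψ (Polynomial.aeval DualNumber.eps f) = AdjoinRoot.mk (Polynomial.X ^ 2) f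
    have h : ψ.comp (Polynomial.aeval DualNumber.eps) = AdjoinRoot.mkₐ (Polynomial.X ^ 2) := by
      ext1
      simp [ψ]
      rfl
    exact DFunLike.congr_fun h f
  · refine Prod.ext ?_ ?_
    · change laurentEval invVarUnit (poleTerm (Polynomial.X ^ 2) n) = (1 : ℂ) • _
      rw [laurentEval_poleTerm, one_smul]
      rfl
    · change ψ 0 = (1 : ℂ) • 0
      simp

/-- For `c = x(1-x)` the second factor is `ℂ × ℂ`, the values at 0 and 1, with idempotents `1 - e`
and `e`. The extra summand of the double gives the value at 0; the value at 1 is that of the Laurent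
polynomial, and it vanishes on the `u n`. -/
theorem doubleB_two_isPoleHom (b : PowerSeries ℂ) :
    ∃ hom, IsPoleHom (doubleB b) (fun n => (poleTerm (Polynomial.X * (1 - Polynomial.X)) n, 0))
      (Polynomial.X * (1 - Polynomial.X)) hom AlgEquiv.refl invVarUnit 1 := by
  set c : Polynomial ℂ := Polynomial.X * (1 - Polynomial.X) with hc
  let e : AdjoinRoot c := AdjoinRoot.root c
  have he : e * (1 - e) = 0 := by
    have h : AdjoinRoot.mk c (Polynomial.X * (1 - Polynomial.X)) = 0 := AdjoinRoot.mk_self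
    rwa [map_mul, map_sub, map_one, AdjoinRoot.mk_X] at h
  let ev : ℂ[T;T⁻¹] →ₐ[ℂ] ℂ := laurentEval 1
  let ψ : ℂ[T;T⁻¹] × ℂ →ₐ[ℂ] AdjoinRoot c := AlgHom.ofLinearMap
    ((LinearMap.toSpanSingleton ℂ _ e) ∘ₗ ev.toLinearMap ∘ₗ LinearMap.fst ℂ _ _ +
      (LinearMap.toSpanSingleton ℂ _ (1 - e)) ∘ₗ LinearMap.snd ℂ _ _)
    (by simp)
    (by
      rintro ⟨f, z⟩ ⟨f', z'⟩
      have h1 : e * e = e := by linear_combination -he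
      have h2 : (1 - e) * (1 - e) = 1 - e := by linear_combination -he
      have h3 : (1 - e) * e = 0 := by linear_combination he
      simp only [LinearMap.add_apply, LinearMap.comp_apply, LinearMap.toSpanSingleton_apply,
        LinearMap.fst_apply, LinearMap.snd_apply, AlgHom.toLinearMap_apply, Prod.mk_mul_mk, map_mul,
        add_mul, mul_add, smul_mul_smul_comm, h1, h2, h3, he, smul_zero, add_zero, zero_add])
  have hψ : ∀ f z, ψ (f, z) = ev f • e + z • (1 - e) := fun f z => rfl
  refine ⟨((laurentEval invVarUnit).comp (AlgHom.fst ℂ _ _)).prod ψ, order_invVar, fun f => ?_,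
    fun a => rfl, fun n => ?_⟩
  · refine Prod.ext (laurentEval_toLaurent _ f) ?_
    change (ψ.comp (doubleB b).emb) f = AdjoinRoot.mkₐ c f
    congr 1
    ext1
    change ψ (Polynomial.toLaurent Polynomial.X, Polynomial.aeval (0 : ℂ) Polynomial.X) =
      AdjoinRoot.mk c Polynomial.X
    rw [hψ, Polynomial.toLaurent_X, Polynomial.aeval_X, laurentEval_T, one_zpow, Units.val_one,
      one_smul, zero_smul, add_zero, AdjoinRoot.mk_X]
  · refine Prod.ext ?_ ?_
    · change laurentEval invVarUnit (poleTerm c n) = (1 : ℂ) • _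
      rw [laurentEval_poleTerm, one_smul]
      rfl
    · change ψ (poleTerm c n, 0) = (1 : ℂ) • 0
      have h : Polynomial.aeval ((1 : ℂˣ) : ℂ) c = 0 := by simp [hc]
      rw [hψ, laurentEval_poleTerm, h]
      simp

/-- The variable goes to `(x-q)/p`, which is invertible in `ℂ((x⁻¹))` and modulo `c`, because `c(q)
= p s ≠ 0`. The polynomial `c'` goes to `c/(ps)`, so `u n` goes to a multiple of `c y^{-n-1}` with
second component zero. Here `κ = (ps)⁻¹`, and `y⁻¹` has leading coefficient `p`. -/
theorem doubleA_isPoleHom {a : PowerSeries ℂ} {c c' : Polynomial ℂ} (hc' : c'.coeff 0 = 1)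
    {p s : ℂˣ} {q : ℂ} (hc : affineOne p q c = Polynomial.C ((p : ℂ) * s) * c') :
    ∃ (hom : ℂ[T;T⁻¹] →ₐ[ℂ] PoleAlgebra c) (y : (LaurentSeries ℂ)ˣ) (κ : ℂ), κ ≠ 0 ∧
      IsPoleHom (doubleA a) (poleTerm c') c hom (affineOne p q).symm y κ ∧
      κ * ((y⁻¹ : (LaurentSeries ℂ)ˣ) : LaurentSeries ℂ).coeff 1 = (s : ℂ)⁻¹ := by
  set y₀ : LaurentSeries ℂ := Polynomial.aeval invVar ((affineOne p q).symm Polynomial.X) with hy₀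
  have hcoeff : ∀ k, y₀.coeff k = if k ≤ 0 then
      ((affineOne p q).symm Polynomial.X).coeff (-k).toNat else 0 := coeff_aeval_invVar _
  rw [affineOne_symm_X] at hcoeff
  have h1 : y₀.coeff (-1) = (p : ℂ)⁻¹ := by
    rw [hcoeff]
    simp [Polynomial.coeff_C_mul, Polynomial.coeff_X]
  have h2 : y₀.order = -1 := by
    refine order_eq (fun k hk => ?_) (by rw [h1]; exact inv_ne_zero p.ne_zero)
    rw [hcoeff, if_pos (by omega), Polynomial.coeff_C_mul, Polynomial.coeff_sub,
      Polynomial.coeff_X_of_ne_one (by omega), Polynomial.coeff_C_of_ne_zero (by omega)]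
    simp
  have h3 : y₀ ≠ 0 := by
    intro h
    rw [h, HahnSeries.coeff_zero] at h1
    exact inv_ne_zero p.ne_zero h1.symm
  have h4 : c.eval q ≠ 0 := by
    have h := congrArg (Polynomial.eval 0) hc
    rw [affineOne_apply, Polynomial.eval_comp, Polynomial.eval_mul, Polynomial.eval_C,
      ← Polynomial.coeff_zero_eq_eval_zero c', hc'] at h
    simp only [Polynomial.eval_add, Polynomial.eval_mul, Polynomial.eval_C, Polynomial.eval_X,
      mul_zero, zero_add, mul_one] at h
    rw [h]
    exact mul_ne_zero p.ne_zero s.ne_zero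
  have h5 : IsUnit (AdjoinRoot.mk c ((affineOne p q).symm Polynomial.X)) := by
    rw [affineOne_symm_X, map_mul]
    refine IsUnit.mul ?_ ?_
    · exact (Polynomial.isUnit_C.2 (p⁻¹).isUnit).map (AdjoinRoot.mk c)
    · obtain ⟨f, hf⟩ := Polynomial.X_sub_C_dvd_sub_C_eval (a := q) (p := c)
      have h6 := congrArg (AdjoinRoot.mk c) hf
      rw [map_sub, AdjoinRoot.mk_self, zero_sub, map_mul] at h6
      have h7 : IsUnit (-AdjoinRoot.mk c (Polynomial.C (c.eval q))) :=
        ((Polynomial.isUnit_C.2 (IsUnit.mk0 _ h4)).map (AdjoinRoot.mk c)).neg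
      rw [h6] at h7
      exact isUnit_of_mul_isUnit_left h7
  have h6 : IsUnit (poleEmb c ((affineOne p q).symm Polynomial.X)) :=
    Prod.isUnit_iff.2 ⟨IsUnit.mk0 _ h3, h5⟩
  obtain ⟨Y, hY⟩ := h6
  let y : (LaurentSeries ℂ)ˣ := Units.map (AlgHom.fst ℂ (LaurentSeries ℂ) (AdjoinRoot c) : _ →* _) Y
  have hy : (y : LaurentSeries ℂ) = y₀ := congrArg Prod.fst hY
  have haeval : ∀ f, Polynomial.aeval (Y : PoleAlgebra c) f = poleEmb c ((affineOne p q).symm f) := by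
    intro f
    have h : (Polynomial.aeval (Y : PoleAlgebra c)) =
        (poleEmb c).comp (affineOne p q).symm.toAlgHom := by
      ext1
      rw [Polynomial.aeval_X]
      exact hY
    exact DFunLike.congr_fun h f
  have hcc : (affineOne p q).symm c' = ((p : ℂ) * s)⁻¹ • c := by
    rw [AlgEquiv.symm_apply_eq, map_smul, hc, ← Polynomial.smul_eq_C_mul, smul_smul,
      inv_mul_cancel₀ (mul_ne_zero p.ne_zero s.ne_zero), one_smul]
  have hord : (y : LaurentSeries ℂ).order = -1 := by rw [hy, h2]
  refine ⟨laurentEval Y, y, ((p : ℂ) * s)⁻¹,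
    inv_ne_zero (mul_ne_zero p.ne_zero s.ne_zero), ⟨hord, fun f => ?_, fun f => ?_, fun n => ?_⟩, ?_⟩
  · exact (laurentEval_toLaurent Y f).trans (haeval f)
  · exact laurentEval_map (AlgHom.fst ℂ (LaurentSeries ℂ) (AdjoinRoot c)) Y f
  · rw [laurentEval_poleTerm, haeval, hcc, map_smul, smul_mul_assoc]
    congr 1
    refine Prod.ext ?_ ?_
    · rw [Prod.fst_mul, poleEmb_fst]
      congr 1
      rw [← map_zpow]
      rfl
    · rw [Prod.snd_mul, poleEmb_snd, AdjoinRoot.mk_self, zero_mul]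
  · have h7 := coeff_inv_mul_coeff hord
    rw [hy, h1] at h7
    rw [mul_inv, mul_assoc, mul_left_comm, h7, mul_one]

end Homs

/-! ### The bijection of Lagrangian subalgebras -/

section Correspondence

variable {g : Type*} [LieRing g] [LieAlgebra ℂ g] [FiniteDimensional ℂ g] [LieAlgebra.IsSimple ℂ g]
  {A₁ A₂ : Type} [CommRing A₁] [Algebra ℂ A₁] [CommRing A₂] [Algebra ℂ A₂]
  {d₁ : DoubleData A₁} {d₂ : DoubleData A₂} {c₁ c₂ : Polynomial ℂ} {u₁ : ℕ → A₁} {u₂ : ℕ → A₂}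

theorem existsUnique_isRMatrix {A : Type} [CommRing A] [Algebra ℂ A] {d : DoubleData A}
    {c c' : Polynomial ℂ} {u : ℕ → A} (hc : c ≠ 0) (hd : d.IsStandard c' u)
    {hom : A →ₐ[ℂ] PoleAlgebra c} {subst : Polynomial ℂ ≃ₐ[ℂ] Polynomial ℂ}
    {y : (LaurentSeries ℂ)ˣ} {κ : ℂ} (hm : IsPoleHom d u c hom subst y κ) (hκ : κ ≠ 0)
    (W : d.Lagrangians g) : ∃! r : Rat₂ ⊗[ℂ] (g ⊗[ℂ] g), IsRMatrix d W.1 r := by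
  have hπ := (hm.model hc hd hκ).proj_emb
  have hπu : ∀ n, (hm.model hc hd hκ).proj (u n) = 0 := fun n => by
    rw [Model.proj_apply]
    exact (congrArg _ (hm.pr_u hc n)).trans (map_zero _)
  obtain ⟨Q, hQ⟩ := exists_represents hd W.2 hπ hπu
  exact ⟨rationalTensor c' Q, (isRMatrix_iff hd W.2 hπ hπu hQ _).2 rfl,
    fun r hr => (isRMatrix_iff hd W.2 hπ hπu hQ r).1 hr⟩

/-- Both doubles are dense in the completion for `c₁`, so closure in one followed by preimage in the
other is a bijection. The scalars of the forms are `1` and `s⁻¹`; hence `Q` becomes `s⁻¹ Q(px+q,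
py+q)`, matching the change of the polar part. -/
theorem affineCorrespondence_of_isPoleHom (hc : c₁ ≠ 0) (hd₁ : d₁.IsStandard c₁ u₁)
    (hd₂ : d₂.IsStandard c₂ u₂)
    (h₁ : ∃ hom, IsPoleHom d₁ u₁ c₁ hom AlgEquiv.refl invVarUnit 1)
    (h₂ : ∀ (p : ℂˣ) (q : ℂ) (s : ℂˣ), affineOne p q c₁ = Polynomial.C ((p : ℂ) * s) * c₂ →
      ∃ hom y κ, κ ≠ 0 ∧ IsPoleHom d₂ u₂ c₁ hom (affineOne p q).symm y κ ∧
        κ * ((y⁻¹ : (LaurentSeries ℂ)ˣ) : LaurentSeries ℂ).coeff 1 = (s : ℂ)⁻¹)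
    {r₁ r₂ : Rat₂ ⊗[ℂ] (g ⊗[ℂ] g)}
    (hr : ∀ (p : ℂˣ) (q : ℂ) (s : ℂˣ), affineSubst p q r₁ = (s : ℂ) • r₂ →
      affineOne p q c₁ = Polynomial.C ((p : ℂ) * s) * c₂)
    (hex : ∃ (p : ℂˣ) (q : ℂ) (s : ℂˣ), affineSubst p q r₁ = (s : ℂ) • r₂) :
    AffineCorrespondence d₁ d₂ r₁ r₂ := by
  obtain ⟨hom₁, hm₁⟩ := h₁
  refine ⟨existsUnique_isRMatrix hc hd₁ hm₁ one_ne_zero, ?_, hex, fun p q s hpqs => ?_⟩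
  · obtain ⟨p, q, s, hpqs⟩ := hex
    obtain ⟨hom₂, y, κ, hκ, hm₂, -⟩ := h₂ p q s (hr p q s hpqs)
    exact existsUnique_isRMatrix hc hd₂ hm₂ hκ
  · have hcc := hr p q s hpqs
    obtain ⟨hom₂, y, κ, hκ, hm₂, hs⟩ := h₂ p q s hcc
    set m₁ := hm₁.model hc hd₁ one_ne_zero with hm₁'
    set m₂ := hm₂.model hc hd₂ hκ with hm₂'
    have hπu₁ : ∀ n, m₁.proj (u₁ n) = 0 := fun n => by
      rw [Model.proj_apply]
      exact (congrArg _ (hm₁.pr_u hc n)).trans (map_zero _)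
    have hπu₂ : ∀ n, m₂.proj (u₂ n) = 0 := fun n => by
      rw [Model.proj_apply]
      exact (congrArg _ (hm₂.pr_u hc n)).trans (map_zero _)
    have hs₁ : m₁.scalar = 1 := by
      have h := coeff_inv_mul_coeff (y := invVarUnit) order_invVar
      change (1 : ℂ) * _ = 1
      rw [one_mul]
      have h' : ((invVarUnit : (LaurentSeries ℂ)ˣ) : LaurentSeries ℂ).coeff (-1) = 1 :=
        HahnSeries.coeff_single_same _ _
      rwa [h', one_mul] at h
    have hs₂ : m₂.scalar = (s : ℂ)⁻¹ := hs
    refine ⟨m₁.lagrangiansEquiv.trans m₂.lagrangiansEquiv.symm, fun W r => ?_⟩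
    obtain ⟨Q, hQ⟩ := exists_represents hd₁ W.2 m₁.proj_emb hπu₁
    have hQ₂ := m₂.represents_comap (m₁.represents_closure W.2 hQ)
    have hid : Model.mapTwo (g := g) m₁.subst.toAlgHom = LinearMap.id := by
      have h : tensorMap g m₁.subst.toAlgHom = LinearMap.id := by
        refine TensorProduct.ext' fun f x => ?_
        rfl
      rw [Model.mapTwo, h, TensorProduct.map_id]
    have hsubst : m₂.subst.symm.toAlgHom = (affineOne p q).toAlgHom := by
      ext1
      rfl
    rw [hs₁, hs₂, inv_one, one_smul, hid, LinearMap.id_apply, hsubst] at hQ₂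
    have hW₂ : d₂.IsTransversalLagrangian ((m₁.closure W.1).comap (tensorMap g m₂.hom)) :=
      m₂.comap_isTransversalLagrangian (m₁.closure_isTransversalLagrangian W.2)
    refine (isRMatrix_iff hd₁ W.2 m₁.proj_emb hπu₁ hQ r).trans
      (Iff.trans ?_ (isRMatrix_iff hd₂ hW₂ m₂.proj_emb hπu₂ hQ₂ _).symm)
    rw [← affineSubst_rationalTensor hcc]
    constructor
    · rintro rfl
      rfl
    · intro h
      refine affineSubst_injective p q (smul_right_injective _ (inv_ne_zero s.ne_zero) h)

end Correspondence

/-! ### The triangular decomposition of the Casimir element -/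

section Casimir

variable {g : Type*} [LieRing g] [LieAlgebra ℂ g]

theorem contract_add {M : Type*} [AddCommGroup M] [Module ℂ M] (x y : g) (u : M ⊗[ℂ] g) :
    contract (x + y) u = contract x u + contract y u := by
  simp [contract, LinearMap.lTensor_add]

theorem contract_smul {M : Type*} [AddCommGroup M] [Module ℂ M] (z : ℂ) (x : g) (u : M ⊗[ℂ] g) :
    contract (z • x) u = z • contract x u := by
  simp [contract, LinearMap.lTensor_smul]

theorem contract_zero {M : Type*} [AddCommGroup M] [Module ℂ M] (u : M ⊗[ℂ] g) :
    contract (0 : g) u = 0 := by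
  simp [contract]

variable [FiniteDimensional ℂ g] [LieAlgebra.IsSimple ℂ g]

theorem contract_casimir (x : g) : contract x (casimir g) = x := by
  rw [casimir_eq (Module.finBasis ℂ g), map_sum]
  simp only [contract_tmul, killingForm_comm x, sum_killingForm_killingDual_smul]

/-- The Killing form identifies `𝔤 ⊗ 𝔤` with the endomorphisms of `𝔤`, and `Ω` corresponds to the
identity. -/
theorem eq_casimir_of_contract {u : g ⊗[ℂ] g} (h : ∀ x : g, contract x u = x) : u = casimir g := by
  rw [casimir_eq (Module.finBasis ℂ g), ← sum_contract_tmul_killingDual (Module.finBasis ℂ g) u]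
  simp only [h]

theorem casimir_ne_zero : casimir g ≠ 0 := by
  intro h
  have := LieAlgebra.IsSimple.nontrivial ℂ g
  obtain ⟨x, hx⟩ := exists_ne (0 : g)
  refine hx ?_
  rw [← contract_casimir x, h, map_zero]

attribute [local instance] CartanData.cartan

variable (c : CartanData g)

/-- The reindexing `α ↦ -α` turns `c.lower` into the sum over the roots that are not positive. -/
theorem CartanData.upper_add_lower : c.upper + c.lower =
    ∑ α : c.H.root, c.e α.1 ⊗ₜ[ℂ] c.e (-α.1) := by
  classical
  let := (LieAlgebra.IsKilling.rootSystem c.H).indexNeg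
  have hneg : ∀ α : c.H.root, (-α).1 = -α.1 := fun α => by
    have h : (LieAlgebra.IsKilling.rootSystem c.H).root (-α) =
        -(LieAlgebra.IsKilling.rootSystem c.H).root α := by
      rw [RootPairing.indexNeg_neg, RootPairing.root_reflectionPerm,
        RootPairing.reflection_apply_self]
    ext x
    exact DFunLike.congr_fun h x
  have h : c.lower = ∑ α : c.H.root with ¬ c.base.IsPos α, c.e α.1 ⊗ₜ[ℂ] c.e (-α.1) := by
    rw [CartanData.lower]
    refine Finset.sum_equiv (Equiv.neg _) (fun α => ?_) (fun α _ => ?_)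
    · have h := RootPairing.Base.IsPos.neg_iff_not c.base (-α)
      rw [neg_neg] at h
      simpa using h
    · simp only [Equiv.neg_apply, hneg, neg_neg]
  rw [h, CartanData.upper]
  exact Finset.sum_filter_add_sum_filter_not _ _ _

open Classical in
theorem CartanData.killingForm_e {α β : LieModule.Weight ℂ c.H g} (hα : α.IsNonZero)
    (hβ : β.IsNonZero) : killingForm ℂ g (c.e β) (c.e (-α)) = if α = β then 1 else 0 := by
  split_ifs with h
  · rw [h, c.e_pair β hβ]
  · refine LieAlgebra.killingForm_apply_eq_zero_of_mem_rootSpace_of_add_ne_zero ℂ g c.H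
      (c.e_mem β hβ) (c.e_mem (-α) hα.neg) fun h' => h ?_
    rw [LieModule.Weight.coe_neg, ← sub_eq_add_neg, sub_eq_zero] at h'
    exact DFunLike.coe_injective h'.symm

theorem CartanData.h'_mem_rootSpace (i : c.base.support) :
    c.h' i ∈ LieAlgebra.rootSpace c.H (0 : c.H → ℂ) := by
  rw [LieAlgebra.rootSpace_zero_eq]
  exact c.h'_mem i

theorem CartanData.contract_e (β : LieModule.Weight ℂ c.H g) (hβ : β.IsNonZero) :
    contract (c.e β) (c.upper + c.lower + c.middle) = c.e β := by
  classical
  have h : contract (c.e β) c.middle = 0 := by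
    rw [CartanData.middle, map_sum]
    refine Finset.sum_eq_zero fun i _ => ?_
    rw [contract_tmul, LieAlgebra.killingForm_apply_eq_zero_of_mem_rootSpace_of_add_ne_zero ℂ g c.H
      (c.e_mem β hβ) (c.h'_mem_rootSpace i) (by rwa [add_zero]), zero_smul]
  rw [map_add, h, add_zero, c.upper_add_lower, map_sum]
  have h2 : β ∈ c.H.root := by simpa using hβ
  rw [Finset.sum_eq_single (⟨β, h2⟩ : c.H.root)]
  · rw [contract_tmul, c.killingForm_e hβ hβ, if_pos rfl, one_smul]
  · intro α _ hα
    rw [contract_tmul, c.killingForm_e (c.H.isNonZero_coe_root α) hβ,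
      if_neg fun h => hα (Subtype.ext h), zero_smul]
  · simp

theorem CartanData.contract_lie_e (i : c.base.support) :
    contract ⁅c.e i.1.1, c.e (-i.1.1)⁆ c.middle = ⁅c.e i.1.1, c.e (-i.1.1)⁆ := by
  classical
  rw [CartanData.middle, map_sum]
  simp [c.h'_pair]

/-- By the normalization of the root vectors, `h_i` is the Killing dual of the simple root `α_i`;
the simple roots span the dual of the Cartan subalgebra, so it suffices to contract with the `h_i`.
-/
theorem CartanData.contract_middle (x : c.H) : contract (x : g) c.middle = x := by
  have h : ∀ φ : Module.Dual ℂ c.H,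
      contract ((LieAlgebra.IsKilling.cartanEquivDual c.H).symm φ : g) c.middle =
        (LieAlgebra.IsKilling.cartanEquivDual c.H).symm φ := by
    intro φ
    have hφ : φ ∈ Submodule.span ℂ ((LieAlgebra.IsKilling.rootSystem c.H).root '' c.base.support) := by
      rw [c.base.span_root_support, RootPairing.rootSpan,
        RootPairing.IsRootSystem.span_root_eq_top]
      trivial
    induction hφ using Submodule.span_induction with
    | mem φ hφ =>
      obtain ⟨i, hi, rfl⟩ := hφ
      have h := c.contract_lie_e ⟨i, hi⟩
      have hi' := c.H.isNonZero_coe_root i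
      rw [LieAlgebra.IsKilling.lie_eq_killingForm_smul_of_mem_rootSpace_of_mem_rootSpace_neg
        (c.e_mem i.1 hi') (c.e_mem (-i.1) hi'.neg), c.e_pair i.1 hi', one_smul] at h
      exact h
    | zero => simp [contract_zero]
    | add φ ψ _ _ hφ hψ =>
      rw [map_add]
      refine (contract_add _ _ _).trans ?_
      rw [hφ, hψ]
      rfl
    | smul z φ _ hφ =>
      rw [map_smul]
      refine (contract_smul _ _ _).trans ?_
      rw [hφ]
      rfl
  have h2 := h (LieAlgebra.IsKilling.cartanEquivDual c.H x)
  rwa [LinearEquiv.symm_apply_apply] at h2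

theorem CartanData.contract_coe (x : c.H) :
    contract (x : g) (c.upper + c.lower + c.middle) = x := by
  rw [map_add, c.contract_middle, c.upper_add_lower, map_sum, Finset.sum_eq_zero, zero_add]
  intro α _
  have hα := (c.H.isNonZero_coe_root α).neg
  have hx : (x : g) ∈ LieAlgebra.rootSpace c.H (0 : c.H → ℂ) := by
    rw [LieAlgebra.rootSpace_zero_eq]
    exact x.2
  rw [contract_tmul, LieAlgebra.killingForm_apply_eq_zero_of_mem_rootSpace_of_add_ne_zero ℂ g c.H
    hx (c.e_mem _ hα) (by rwa [zero_add]), zero_smul]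

/-- The decomposition of the Casimir element with respect to a triangular decomposition. -/
theorem CartanData.casimir_eq_add : casimir g = c.upper + c.lower + c.middle := by
  refine (eq_casimir_of_contract fun x => ?_).symm
  have hx : x ∈ ⨆ χ : LieModule.Weight ℂ c.H g, LieModule.genWeightSpace g χ := by
    rw [LieModule.iSup_genWeightSpace_eq_top']
    trivial
  rw [← LieSubmodule.mem_toSubmodule, LieSubmodule.iSup_toSubmodule] at hx
  induction hx using Submodule.iSup_induction' with
  | mem χ x hx =>
    by_cases hχ : χ.IsZero
    · have hx' : x ∈ LieAlgebra.rootSpace c.H (0 : c.H → ℂ) := by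
        have h : (χ : c.H → ℂ) = 0 := hχ
        rw [← h]
        exact hx
      rw [LieAlgebra.rootSpace_zero_eq] at hx'
      exact c.contract_coe ⟨x, hx'⟩
    · have h1 := LieAlgebra.IsKilling.finrank_rootSpace_eq_one χ hχ
      have h2 : (⟨c.e χ, c.e_mem χ hχ⟩ : LieAlgebra.rootSpace c.H χ) ≠ 0 := by
        intro h
        have h3 := c.e_pair χ hχ
        rw [show c.e χ = 0 from congrArg Subtype.val h] at h3
        simp at h3
      obtain ⟨z, hz⟩ := (finrank_eq_one_iff_of_nonzero' _ h2).1 h1 ⟨x, hx⟩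
      have h4 : z • c.e χ = x := congrArg Subtype.val hz
      rw [← h4, contract_smul, c.contract_e χ hχ]
  | zero => exact contract_zero _
  | add x y _ _ hx hy => rw [contract_add, hx, hy]

end Casimir

/-! ### Affine relations between basic `r`-matrices -/

section Poles

variable {g : Type*} [LieRing g] [LieAlgebra ℂ g] [FiniteDimensional ℂ g] [LieAlgebra.IsSimple ℂ g]

/-- The rational function `P(x, y) / (y - x) Ω + t`. -/
def poleTensor (P : Poly₂) (t : g ⊗[ℂ] g) : Rat₂ ⊗[ℂ] (g ⊗[ℂ] g) :=
  (algebraMap Poly₂ Rat₂ P / (ry - rx)) ⊗ₜ casimir g + 1 ⊗ₜ t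

theorem affineSubst_poleTensor (p : ℂˣ) (q : ℂ) (P : Poly₂) (t : g ⊗[ℂ] g) :
    affineSubst p q (poleTensor P t) =
      ((p : ℂ)⁻¹ • (algebraMap Poly₂ Rat₂ (affinePoly p q P) / (ry - rx))) ⊗ₜ casimir g +
        1 ⊗ₜ t := by
  rw [poleTensor, map_add, affineSubst, LinearMap.rTensor_tmul, LinearMap.rTensor_tmul,
    AlgEquiv.toLinearMap_apply, AlgEquiv.toLinearMap_apply, map_one, map_div₀, affineRat_sub,
    affineRat_algebraMap]
  congr 2
  simp only [Algebra.smul_def, map_inv₀]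
  have h1 := ry_sub_rx_ne_zero
  have h2 : algebraMap ℂ Rat₂ p ≠ 0 := (map_ne_zero _).2 p.ne_zero
  field_simp

/-- Numerators need only agree up to a multiple of `y - x`; that multiple cancels the pole and adds
the constant `z Ω` to the constant term. -/
theorem affineSubst_poleTensor_eq {p s : ℂˣ} {q z : ℂ} {P₁ P₂ : Poly₂} {t₁ t₂ : g ⊗[ℂ] g}
    (hP : affinePoly p q P₁ = MvPolynomial.C ((p : ℂ) * s) * P₂ +
      MvPolynomial.C ((p : ℂ) * z) * (MvPolynomial.X 1 - MvPolynomial.X 0))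
    (ht : z • casimir g + t₁ = (s : ℂ) • t₂) :
    affineSubst p q (poleTensor P₁ t₁) = (s : ℂ) • poleTensor P₂ t₂ := by
  have h1 : (p : ℂ)⁻¹ • (algebraMap Poly₂ Rat₂ (affinePoly p q P₁) / (ry - rx)) =
      (s : ℂ) • (algebraMap Poly₂ Rat₂ P₂ / (ry - rx)) + z • 1 := by
    rw [hP, map_add, algebraMap_C_mul, algebraMap_C_mul, ← ry_sub_rx, add_div, smul_div_assoc,
      smul_div_assoc, div_self ry_sub_rx_ne_zero, smul_add, smul_smul, smul_smul,
      inv_mul_cancel_left₀ p.ne_zero, inv_mul_cancel_left₀ p.ne_zero]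
  rw [affineSubst_poleTensor, h1, poleTensor, TensorProduct.add_tmul, add_assoc, smul_add,
    TensorProduct.smul_tmul', TensorProduct.smul_tmul z, ← TensorProduct.tmul_add, ht,
    TensorProduct.tmul_smul]

/-- The restriction of a polynomial to the diagonal. -/
def diagonal : Poly₂ →ₐ[ℂ] Polynomial ℂ := MvPolynomial.aeval fun _ => Polynomial.X

theorem diagonal_X (i : Fin 2) : diagonal (MvPolynomial.X i) = Polynomial.X :=
  MvPolynomial.aeval_X _ i

theorem diagonal_C (z : ℂ) : diagonal (MvPolynomial.C z) = Polynomial.C z :=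
  MvPolynomial.aeval_C _ z

theorem diagonal_affinePoly (p : ℂˣ) (q : ℂ) (P : Poly₂) :
    diagonal (affinePoly p q P) = affineOne p q (diagonal P) := by
  have h : diagonal.comp (affinePoly p q).toAlgHom = (affineOne p q).toAlgHom.comp diagonal := by
    ext i : 1
    simp [affinePoly_X, diagonal_X, affineOne_X]
  exact DFunLike.congr_fun h P

/-- A functional that is nonzero on `Ω` gives a scalar identity. After multiplication by `y - x` the
constant tensors carry the factor `y - x` and disappear on the diagonal. -/
theorem affineOne_diagonal_of_affineSubst {p s : ℂˣ} {q : ℂ} {P₁ P₂ : Poly₂} {t₁ t₂ : g ⊗[ℂ] g}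
    (h : affineSubst p q (poleTensor P₁ t₁) = (s : ℂ) • poleTensor P₂ t₂) :
    affineOne p q (diagonal P₁) = Polynomial.C ((p : ℂ) * s) * diagonal P₂ := by
  obtain ⟨φ, hφ⟩ : ∃ φ : Module.Dual ℂ (g ⊗[ℂ] g), φ (casimir g) ≠ 0 := by
    by_contra! h
    exact casimir_ne_zero ((Module.forall_dual_apply_eq_zero_iff ℂ _).1 h)
  have h1 := congrArg (TensorProduct.rid ℂ Rat₂ ∘ LinearMap.lTensor Rat₂ φ) h
  rw [affineSubst_poleTensor] at h1
  simp only [poleTensor, Function.comp_apply, map_add, map_smul, LinearMap.lTensor_tmul,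
    TensorProduct.rid_tmul, Algebra.smul_def, map_inv₀] at h1
  have h2 := ry_sub_rx_ne_zero
  have h3 : algebraMap ℂ Rat₂ p ≠ 0 := (map_ne_zero _).2 p.ne_zero
  field_simp at h1
  have hC : ∀ z, algebraMap Poly₂ Rat₂ (MvPolynomial.C z) = algebraMap ℂ Rat₂ z := fun z => by
    rw [← MvPolynomial.algebraMap_eq, ← IsScalarTower.algebraMap_apply]
  have h4 : MvPolynomial.C (φ (casimir g)) * affinePoly p q P₁ +
      MvPolynomial.C (p * φ t₁) * (MvPolynomial.X 1 - MvPolynomial.X 0) =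
      MvPolynomial.C (p * s * φ (casimir g)) * P₂ +
        MvPolynomial.C (p * s * φ t₂) * (MvPolynomial.X 1 - MvPolynomial.X 0) := by
    refine IsFractionRing.injective Poly₂ Rat₂ ?_
    rw [map_add, map_add]
    simp only [map_mul, hC, ← ry_sub_rx]
    linear_combination h1
  have h5 := congrArg diagonal h4
  simp only [map_add, map_mul, map_sub, diagonal_X, sub_self, mul_zero, add_zero, diagonal_C,
    diagonal_affinePoly] at h5
  have h6 : Polynomial.C (φ (casimir g)) ≠ 0 := Polynomial.C_ne_zero.2 hφ
  refine mul_left_cancel₀ h6 ?_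
  rw [h5, map_mul]
  ring

end Poles

/-! ### The three pairs of cases -/

section BasicTensors

variable {g : Type*} [LieRing g] [LieAlgebra ℂ g] [FiniteDimensional ℂ g] [LieAlgebra.IsSimple ℂ g]
  (c : CartanData g)

theorem CartanData.rB1_eq : c.rB1 = poleTensor (MvPolynomial.X 0) c.rDJ := rfl

theorem CartanData.rA2_eq : c.rA2 = poleTensor (1 - MvPolynomial.X 0) (-c.rDJ) := by
  rw [CartanData.rA2, poleTensor, TensorProduct.tmul_neg, ← sub_eq_add_neg, map_sub, map_one]
  rfl

theorem rC_eq : rC g = poleTensor (MvPolynomial.X 0 * MvPolynomial.X 1) 0 := by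
  rw [rC, poleTensor, TensorProduct.tmul_zero, add_zero, map_mul]
  rfl

theorem rA3_eq : rA3 g = poleTensor ((MvPolynomial.X 0 - 1) * (MvPolynomial.X 1 - 1)) 0 := by
  rw [rA3, poleTensor, TensorProduct.tmul_zero, add_zero, map_mul, map_sub, map_sub, map_one]
  rfl

theorem CartanData.rB2_eq :
    c.rB2 = poleTensor (MvPolynomial.X 0 * (1 - MvPolynomial.X 1)) c.rDJ := by
  rw [CartanData.rB2, poleTensor, map_mul, map_sub, map_one]
  rfl

theorem CartanData.rA4_eq (m₁ m₂ : ℂ) : c.rA4 m₁ m₂ =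
    poleTensor (1 - MvPolynomial.C (m₁ + m₂) * MvPolynomial.X 0 +
      MvPolynomial.C (m₁ * m₂) * (MvPolynomial.X 0 * MvPolynomial.X 1)) (-c.rm m₁ m₂) := by
  rw [CartanData.rA4, poleTensor, TensorProduct.tmul_neg, ← sub_eq_add_neg, map_add, map_sub,
    map_one, algebraMap_C_mul, algebraMap_C_mul, map_mul]
  rfl

/-- The given `p, q, s` only witness existence; for any others, restriction to the diagonal yields
the relation between `c₁` and `c₂` that the bijection needs. -/
theorem affineCorrespondence_of_poleTensor {A : Type} [CommRing A] [Algebra ℂ A]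
    {d : DoubleData A} {a : PowerSeries ℂ} {c₁ c₂ : Polynomial ℂ} {u : ℕ → A} (hc₁ : c₁ ≠ 0)
    (hd : d.IsStandard c₁ u) (h : ∃ hom, IsPoleHom d u c₁ hom AlgEquiv.refl invVarUnit 1)
    (hc₂ : c₂.coeff 0 = 1) (ha : (c₂ : PowerSeries ℂ) * a = 1) {P₁ P₂ : Poly₂}
    (hP₁ : diagonal P₁ = c₁) (hP₂ : diagonal P₂ = c₂) {t₁ t₂ : g ⊗[ℂ] g} (p s : ℂˣ) (q z : ℂ)
    (hP : affinePoly p q P₁ = MvPolynomial.C ((p : ℂ) * s) * P₂ +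
      MvPolynomial.C ((p : ℂ) * z) * (MvPolynomial.X 1 - MvPolynomial.X 0))
    (ht : z • casimir g + t₁ = (s : ℂ) • t₂) :
    AffineCorrespondence d (doubleA a) (poleTensor P₁ t₁) (poleTensor P₂ t₂) := by
  refine affineCorrespondence_of_isPoleHom hc₁ hd (doubleA_isStandard hc₂ ha) h
    (fun p q s hcc => doubleA_isPoleHom hc₂ hcc) (fun p q s hpqs => ?_)
    ⟨p, q, s, affineSubst_poleTensor_eq hP ht⟩
  rw [← hP₁, ← hP₂]
  exact affineOne_diagonal_of_affineSubst hpqs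

theorem affineCorrespondence_B1_A2 :
    AffineCorrespondence (doubleB seriesB1) (doubleA seriesA2) c.rB1 c.rA2 := by
  have h1 := doubleB_isStandard (b := seriesB1) (c := 1) (by simp) (by simp [seriesB1])
  rw [mul_one] at h1
  rw [c.rB1_eq, c.rA2_eq]
  -- The substitution is `x ↦ 1 - x` with `s = -1`; no multiple of `y - x` is left over.
  refine affineCorrespondence_of_poleTensor (c₂ := 1 - Polynomial.X) Polynomial.X_ne_zero h1
    (doubleB_one_isPoleHom _) (by simp) ?_ (diagonal_X 0) (by simp [diagonal_X]) (-1) (-1) 1 0 ?_ ?_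
  · rw [Polynomial.coe_sub, Polynomial.coe_one, Polynomial.coe_X, seriesA2]
    exact PowerSeries.mul_inv_cancel _ (by simp)
  · rw [affinePoly_X]
    simp
    ring
  · simp

theorem affineCorrespondence_C_A3 :
    AffineCorrespondence doubleC (doubleA seriesA3) (rC g) (rA3 g) := by
  rw [rC_eq, rA3_eq]
  refine affineCorrespondence_of_poleTensor (c₂ := (1 - Polynomial.X) ^ 2)
    (pow_ne_zero 2 Polynomial.X_ne_zero) doubleC_isStandard doubleC_isPoleHom
    (by simp [Polynomial.coeff_zero_eq_eval_zero]) ?_ ?_ ?_ (-1) (-1) 1 0 ?_ ?_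
  · rw [Polynomial.coe_pow, Polynomial.coe_sub, Polynomial.coe_one, Polynomial.coe_X, seriesA3]
    exact PowerSeries.mul_inv_cancel _ (by simp)
  · rw [map_mul, diagonal_X, diagonal_X, pow_two]
  · simp only [map_mul, map_sub, map_one, diagonal_X]
    ring
  · rw [map_mul, affinePoly_X, affinePoly_X]
    simp
    ring
  · simp

/-- The substitution takes the zeros `1/m₂, 1/m₁` of `c₂` to the zeros `0, 1` of `x(1-x)`, which
fixes `p` and `q`. Comparing the coefficients of the lower and upper parts in `zΩ + r_DJ = -s
r_{m₁,m₂}` gives `z = -m₁ s` and `s = 1/(m₁-m₂)`; the middle part then agrees. -/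
theorem affineCorrespondence_B2_A4 {m₁ m₂ : ℂ} (h : m₁ ≠ m₂) (h0 : m₁ * m₂ ≠ 0) :
    AffineCorrespondence (doubleB seriesB2) (doubleA (seriesA4 m₁ m₂)) c.rB2 (c.rA4 m₁ m₂) := by
  rw [c.rB2_eq, c.rA4_eq]
  have hd : m₁ - m₂ ≠ 0 := sub_ne_zero.2 h
  refine affineCorrespondence_of_poleTensor
    (c₂ := (1 - Polynomial.C m₁ * Polynomial.X) * (1 - Polynomial.C m₂ * Polynomial.X))
    ?_ (doubleB_isStandard (c := 1 - Polynomial.X) (by simp) ?_) (doubleB_two_isPoleHom _)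
    (by simp [Polynomial.coeff_zero_eq_eval_zero]) ?_ ?_ ?_
    (Units.mk0 (-(m₁ * m₂) / (m₁ - m₂)) (div_ne_zero (neg_ne_zero.2 h0) hd))
    (Units.mk0 (m₁ - m₂)⁻¹ (inv_ne_zero hd)) (m₁ / (m₁ - m₂)) (-(m₁ / (m₁ - m₂))) ?_ ?_
  · refine mul_ne_zero Polynomial.X_ne_zero fun h => ?_
    simpa using congrArg (Polynomial.eval 0) h
  · rw [Polynomial.coe_sub, Polynomial.coe_one, Polynomial.coe_X, seriesB2]
    exact PowerSeries.mul_inv_cancel _ (by simp)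
  · rw [seriesA4, ← Polynomial.smul_eq_C_mul, ← Polynomial.smul_eq_C_mul, Polynomial.coe_mul,
      Polynomial.coe_sub, Polynomial.coe_sub, Polynomial.coe_smul, Polynomial.coe_smul,
      Polynomial.coe_one, Polynomial.coe_X]
    exact PowerSeries.mul_inv_cancel _ (by simp)
  · simp only [map_mul, map_sub, map_one, diagonal_X]
  · simp only [map_mul, map_sub, map_add, map_one, diagonal_X, diagonal_C]
    ring
  · rw [map_mul, map_sub, map_one, affinePoly_X, affinePoly_X, Units.val_mk0, Units.val_mk0]
    refine MvPolynomial.funext fun x => ?_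
    simp only [map_mul, map_sub, map_add, map_one, MvPolynomial.eval_X, MvPolynomial.eval_C]
    field_simp
    ring
  · rw [c.casimir_eq_add, CartanData.rDJ, CartanData.rm, Units.val_mk0]
    match_scalars
    · field_simp
      ring
    · field_simp
    · field_simp
      ring

end BasicTensors

end CurrentLie

theorem mainTheorem12 (g : Type*) [LieRing g] [LieAlgebra ℂ g] [FiniteDimensional ℂ g]
    [LieAlgebra.IsSimple ℂ g] (c : CurrentLie.CartanData g) :
    CurrentLie.AffineCorrespondence
      (CurrentLie.doubleB CurrentLie.seriesB1) (CurrentLie.doubleA CurrentLie.seriesA2)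
      c.rB1 c.rA2 ∧
    CurrentLie.AffineCorrespondence
      CurrentLie.doubleC (CurrentLie.doubleA CurrentLie.seriesA3)
      (CurrentLie.rC g) (CurrentLie.rA3 g) ∧
    ∀ m₁ m₂ : ℂ, m₁ ≠ m₂ → m₁ * m₂ ≠ 0 →
      CurrentLie.AffineCorrespondence
        (CurrentLie.doubleB CurrentLie.seriesB2)
        (CurrentLie.doubleA (CurrentLie.seriesA4 m₁ m₂))
        c.rB2 (c.rA4 m₁ m₂) := by
  exact ⟨CurrentLie.affineCorrespondence_B1_A2 c, CurrentLie.affineCorrespondence_C_A3,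
    fun _ _ h h0 => CurrentLie.affineCorrespondence_B2_A4 c h h0⟩

end
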